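/- Let $T>0$, let $D(x)=\operatorname{diag}(d_1(x),d_2(x))$ where the real-valued functions $d_1,d_2$ are twice differentiable on $[0,\infty)$ and satisfy $d_1,d_2\ge\delta$ for some constant $\delta>0$ and $d_1+d_2=1$, let $\psi\in C^2([0,\infty);\mathbb R)$, and let $J=\begin{pmatrix}0&1\\-1&0\end{pmatrix}$. Put $\tau(x)=\int_0^x\sqrt{d_1(s)d_2(s)}\,ds$, let $x(\cdot)$ be the inverse function of $\tau$, and let $\Omega^T=\{x>0:\tau(x)<T\}=(0,x(T))$. For $f,g\in L_2(0,T;\mathbb C)$ let $V^f=\begin{pmatrix}v^1\\v^2\end{pmatrix}$ and $U^g=\begin{pmatrix}u^1\\u^2\end{pmatrix}$ be the weak solutions in $C([0,T];L_2(0,\infty;\mathbb C^2))$ of the Dirac-type system $$iDV_t+JV_x+\psi V=0\ \ (x>0,\ 0<t<T),\qquad V(x,0)=0,\qquad v^1(0,t)=f(t),$$ and of the auxiliary system $$iDU_t-JU_x-\psi U=0\ \ (x>0,\ 0<t<T),\qquad U(x,0)=0,\qquad u^1(0,t)=g(t).$$ Then these solutions exist and are unique, and the extended control operator $$W^T\begin{pmatrix}f\\g\end{pmatrix}=V^f(\cdot,T)+U^g(\cdot,T)$$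 is an isomorphism (a bounded linear bijection with bounded inverse) between $L_2(0,T;\mathbb C^2)$ and $L_2(\Omega^T;\mathbb C^2)=L_2(0,x(T);\mathbb C^2)$, the latter being regarded as the space of those functions in $L_2(0,\infty;\mathbb C^2)$ that vanish outside $\Omega^T$. In particular the extended reachable set $\{W^T(f,g)\}$ is the whole of $L_2(\Omega^T;\mathbb C^2)$. -/

import Mathlib

open MeasureTheory Set

noncomputable section

namespace DiracControl

/-- The values of the states: `ℂ²` with its Euclidean norm. -/
abbrev C2 : Type := EuclideanSpace ℂ (Fin 2)

/-- `L₂(S; ℂ²)` for a set `S` of real numbers, with Lebesgue measure. -/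
abbrev L2on (S : Set ℝ) : Type := Lp C2 2 (volume.restrict S)

/-- `h` is twice differentiable on the closed half-line `[0, ∞)` (one-sidedly at `0`). -/
def TwiceDifferentiable (h : ℝ → ℝ) : Prop :=
  DifferentiableOn ℝ h (Ici 0) ∧ DifferentiableOn ℝ (derivWithin h (Ici 0)) (Ici 0)

/-- The eikonal `τ(x) = ∫₀ˣ √(d₁ d₂)`. -/
def eikonal (d₁ d₂ : ℝ → ℝ) (x : ℝ) : ℝ := ∫ s in (0 : ℝ)..x, Real.sqrt (d₁ s * d₂ s)

/-- The part `Ω^T = {x > 0 | τ(x) < T}` of the half-line that waves from `x = 0` fill by the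
time `T`; it is the interval `(0, x(T))`, where `x(·)` is the inverse function of `τ`. -/
def filledDomain (d₁ d₂ : ℝ → ℝ) (T : ℝ) : Set ℝ := {x | 0 < x ∧ eikonal d₁ d₂ x < T}

/-- Test functions `Φ = (φ₁, φ₂)` for the initial boundary value problems on
`{x ≥ 0, 0 ≤ t ≤ T}`: continuously differentiable functions of `(x, t)` with compact support
that vanish at the final time and whose first component vanishes at the boundary `x = 0`
(the trace of the second component of the solution there is not prescribed). -/
structure IsTest (T : ℝ) (φ₁ φ₂ : ℝ → ℝ → ℂ) : Prop where
  contDiff₁ : ContDiff ℝ 1 (fun z : ℝ × ℝ => φ₁ z.1 z.2)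
  contDiff₂ : ContDiff ℝ 1 (fun z : ℝ × ℝ => φ₂ z.1 z.2)
  compact₁ : HasCompactSupport (fun z : ℝ × ℝ => φ₁ z.1 z.2)
  compact₂ : HasCompactSupport (fun z : ℝ × ℝ => φ₂ z.1 z.2)
  final₁ : ∀ x, φ₁ x T = 0
  final₂ : ∀ x, φ₂ x T = 0
  boundary : ∀ t, φ₁ 0 t = 0

/-- `V ∈ C([0, T]; L₂(0, ∞; ℂ²))` is the weak solution on `{x ≥ 0, 0 ≤ t ≤ T}` of
`i D V_t + σ (J V_x + ψ V) = 0`, `V(x, 0) = 0`, `v¹(0, t) = f(t)`,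
where `D = diag(d₁, d₂)` and `J = (0 1; -1 0)`. The equation and the boundary condition are
imposed by multiplying with a test function and integrating by parts:
`∫∫ (J V_x · Φ) = ∫∫ (v¹ ∂ₓφ₂ - v² ∂ₓφ₁) + ∫ f(t) φ₂(0, t) dt`. -/
structure IsWeakSolution (σ : ℝ) (d₁ d₂ ψ : ℝ → ℝ) (T : ℝ) (f : ℝ → ℂ)
    (V : ℝ → L2on (Ioi 0)) : Prop where
  continuousOn : ContinuousOn V (Icc 0 T)
  initial : V 0 = 0
  weak : ∀ φ₁ φ₂ : ℝ → ℝ → ℂ, IsTest T φ₁ φ₂ →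
    (∫ t in (0 : ℝ)..T, ∫ x in Ioi (0 : ℝ),
      (-Complex.I * ((d₁ x : ℂ) * V t x 0 * deriv (fun s => φ₁ x s) t
          + (d₂ x : ℂ) * V t x 1 * deriv (fun s => φ₂ x s) t)
        + (σ : ℂ) * (V t x 0 * deriv (fun y => φ₂ y t) x
          - V t x 1 * deriv (fun y => φ₁ y t) x
          + (ψ x : ℂ) * (V t x 0 * φ₁ x t + V t x 1 * φ₂ x t))))
      + (σ : ℂ) * ∫ t in (0 : ℝ)..T, f t * φ₂ 0 t = 0

/-- `V = V^f` solves the Dirac-type system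
`i D V_t + J V_x + ψ V = 0`, `V(x, 0) = 0`, `v¹(0, t) = f(t)`. -/
abbrev IsDiracSolution (d₁ d₂ ψ : ℝ → ℝ) (T : ℝ) (f : ℝ → ℂ) (V : ℝ → L2on (Ioi 0)) : Prop :=
  IsWeakSolution 1 d₁ d₂ ψ T f V

/-- `U = U^g` solves the auxiliary (time-reversed) system
`i D U_t - J U_x - ψ U = 0`, `U(x, 0) = 0`, `u¹(0, t) = g(t)`. -/
abbrev IsAuxiliarySolution (d₁ d₂ ψ : ℝ → ℝ) (T : ℝ) (g : ℝ → ℂ) (U : ℝ → L2on (Ioi 0)) :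
    Prop :=
  IsWeakSolution (-1) d₁ d₂ ψ T g U

/-- `W` is the extended control operator `W (f, g) = V^f(·, T) + U^g(·, T)`, from
`L₂(0, T; ℂ²)` to `L₂(Ω^T; ℂ²)`. Functions on `Ω^T` are identified with functions on the
half-line that vanish outside `Ω^T`; in particular the states on the right vanish there. -/
def IsExtendedControlOperator (d₁ d₂ ψ : ℝ → ℝ) (T : ℝ)
    (W : L2on (Ioo 0 T) → L2on (filledDomain d₁ d₂ T)) : Prop :=
  ∀ (F : L2on (Ioo 0 T)) (V U : ℝ → L2on (Ioi 0)),
    IsDiracSolution d₁ d₂ ψ T (fun t => F t 0) V →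
    IsAuxiliarySolution d₁ d₂ ψ T (fun t => F t 1) U →
    ∀ᵐ x ∂(volume.restrict (Ioi (0 : ℝ))),
      (filledDomain d₁ d₂ T).indicator (W F) x = V T x + U T x

end DiracControl

end

/-!
The coefficient matrix is `D = ρ diag(e^{-2v}, e^{2v})` with the slowness `ρ = √(d₁ d₂)`. In the
travel time `y = τ(x)`, and after the polarization factors `e^{±v}` and the phase factors
`e^{±iγ}`, `γ' = ψ cosh 2v`, have been divided out, the system consists of a wave travelling to
the right and a wave travelling to the left, which are coupled by reflection only. The left wave
is put, with a minus sign, on the negative half-line. The boundary condition then turns into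
continuity across `0` apart from a source, and the system becomes the scalar equation on the line

  `P_t + P_y = β(y) P(-y) + F(t) δ₀(y)`,   `F = 2 e^{-v(0)} f`,

(`Medium.integrand_eq`, `Medium.Represents.integral_eq` carry the weak form over in both
directions). Its coefficient `β` jumps at `0`. It is continuous on either side because the `d_i`
are continuously differentiable.

*Existence.* The wave emitted by an impulse at the time `0` is the impulse travelling along `y = t`
and a tail supported in `|y| < t`. In characteristic coordinates the tail solves a Goursat problem,
which is the fixed point of a contraction for an exponentially weighted norm
(`exists_goursat_kernel`). Superposition gives the solution for a control in `L₂` (`wave`,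
`wave_weak`, `exists_wave_toLp`).

*Uniqueness.* Test functions `χ(t) θ(y - t)` show that, in the frame moving with the waves to the
right, the difference of two solutions is the time integral of the reflected part. This bounds its
`L₂` norm on an interval of dependence by the time integral of the norm, and the norm vanishes by
Gronwall's argument (`unfolded_unique`).

*The control operator.* The sign `σ = 1` gives the Dirac system, `σ = -1` the auxiliary one, in
which the two phase factors change roles. So in `V^f(·, T) + U^g(·, T)` one polarization carries,
at the travel time `T - η` from the boundary, the direct wave `f(η)`, the other one the direct
wave `g(η)`, and the tails contribute only `f(r), g(r)` with `r < η`. Up to the invertible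
matrices `Medium.stateMatrix` and the substitution `η = T - τ(x)` (`Medium.exists_state_equiv`)
the operator `W^T` is therefore the identity plus a Volterra operator on `L₂(0, T; ℂ²)`
(`exists_control_equiv`), which is invertible since the powers of a Volterra operator with bounded
kernel decay factorially (`isUnit_one_add_of_volterra`).
-/

noncomputable section

namespace DiracControl

open scoped ENNReal NNReal Topology BoundedContinuousFunction
open Filter

/-! ### Substitution, integral and Volterra operators on `L₂` -/

theorem integral_norm_le_mul_norm {α E : Type*} [MeasurableSpace α] {μ : Measure α}
    [IsFiniteMeasure μ] [NormedAddCommGroup E] (u : Lp E 2 μ) :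
    ∫ r, ‖u r‖ ∂μ ≤ (μ univ ^ (2 : ℝ≥0∞).toReal⁻¹).toReal * ‖u‖ := by
  rw [integral_norm_eq_lintegral_enorm (Lp.aestronglyMeasurable u), Lp.norm_def,
    ← ENNReal.toReal_mul, ← eLpNorm_one_eq_lintegral_enorm]
  refine ENNReal.toReal_mono (ENNReal.mul_ne_top
    (ENNReal.rpow_ne_top_of_nonneg (by positivity) (measure_ne_top _ _))
    (Lp.memLp u).eLpNorm_ne_top) ?_
  have := eLpNorm_le_eLpNorm_mul_rpow_measure_univ (p := 1) (q := 2) (μ := μ) (by norm_num)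
    (Lp.aestronglyMeasurable u)
  rw [mul_comm]
  refine this.trans (le_of_eq ?_)
  norm_num

section LpOperators

variable {α β : Type*} [MeasurableSpace α] [MeasurableSpace β] {μ : Measure α} {ν : Measure β}
  {E F : Type*} [NormedAddCommGroup E] [NormedSpace ℂ E] [NormedAddCommGroup F] [NormedSpace ℂ F]

/-- A rule that sends classes in `L₂(ν)` to square integrable functions, is linear up to null
sets, and is bounded, is given by a bounded operator between the `L₂` spaces. -/
theorem exists_clm_of_ae (Φ : Lp E 2 ν → α → F) (C : ℝ)
    (hmem : ∀ u, MemLp (Φ u) 2 μ)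
    (hadd : ∀ u v, Φ (u + v) =ᵐ[μ] fun x => Φ u x + Φ v x)
    (hsmul : ∀ (a : ℂ) u, Φ (a • u) =ᵐ[μ] fun x => a • Φ u x)
    (hC : ∀ u, (eLpNorm (Φ u) 2 μ).toReal ≤ C * ‖u‖) :
    ∃ S : Lp E 2 ν →L[ℂ] Lp F 2 μ, ∀ u, S u =ᵐ[μ] Φ u := by
  let L : Lp E 2 ν →ₗ[ℂ] Lp F 2 μ :=
    { toFun := fun u => (hmem u).toLp (Φ u)
      map_add' := fun u v => by
        rw [← MemLp.toLp_add]
        exact MemLp.toLp_congr _ _ (hadd u v)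
      map_smul' := fun a u => by
        rw [RingHom.id_apply, ← MemLp.toLp_const_smul]
        exact MemLp.toLp_congr _ _ (hsmul a u) }
  refine ⟨L.mkContinuous C fun u => ?_, fun u => (hmem u).coeFn_toLp⟩
  change ‖(hmem u).toLp (Φ u)‖ ≤ _
  rw [Lp.norm_toLp]
  exact hC u

/-- Weighted substitution `u ↦ M(x) u(s(x))` as a bounded operator between `L₂` spaces. -/
theorem exists_substitution_operator {M : α → E →L[ℂ] F} {s : α → β} {C : ℝ} {c : ℝ≥0∞}
    (hM : AEStronglyMeasurable M μ) (hC : ∀ᵐ x ∂μ, ‖M x‖ ≤ C) (hs : Measurable s)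
    (hc : c ≠ ∞) (hmap : μ.map s ≤ c • ν) :
    ∃ S : Lp E 2 ν →L[ℂ] Lp F 2 μ, ∀ u, S u =ᵐ[μ] fun x => M x (u (s x)) := by
  have hmem0 : ∀ u : Lp E 2 ν, MemLp (fun x => u (s x)) 2 μ := fun u =>
    ((Lp.memLp u).of_measure_le_smul hc hmap).comp_of_map hs.aemeasurable
  have hle : ∀ u : Lp E 2 ν, ∀ᵐ x ∂μ, ‖M x (u (s x))‖ ≤ C * ‖u (s x)‖ := fun u => by
    filter_upwards [hC] with x hx
    exact (M x).le_of_opNorm_le hx _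
  have hq : Measure.QuasiMeasurePreserving s μ ν :=
    ⟨hs, (Measure.absolutelyContinuous_of_le_smul hmap)⟩
  have hmem : ∀ u : Lp E 2 ν, MemLp (fun x => M x (u (s x))) 2 μ := fun u =>
    (hmem0 u).of_le_mul
      ((ContinuousLinearMap.id ℂ (E →L[ℂ] F)).aestronglyMeasurable_comp₂ hM
        (hmem0 u).aestronglyMeasurable) (hle u)
  refine exists_clm_of_ae (fun u x => M x (u (s x)))
    ((ENNReal.ofReal C * c ^ (1 / (2 : ℝ≥0∞)).toReal).toReal) hmem ?_ ?_ ?_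
  · intro u v
    filter_upwards [hq.ae_eq_comp (Lp.coeFn_add u v)] with x hx
    simp only [Function.comp_apply] at hx
    rw [hx, Pi.add_apply, map_add]
  · intro a u
    filter_upwards [hq.ae_eq_comp (Lp.coeFn_smul a u)] with x hx
    simp only [Function.comp_apply] at hx
    rw [hx, Pi.smul_apply, map_smul]
  · intro u
    rw [Lp.norm_def, ← ENNReal.toReal_mul]
    refine ENNReal.toReal_mono ?_ ?_
    · exact ENNReal.mul_ne_top (ENNReal.mul_ne_top ENNReal.ofReal_ne_top
        (ENNReal.rpow_ne_top_of_nonneg (by positivity) hc)) (Lp.memLp u).eLpNorm_ne_top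
    · refine (eLpNorm_le_mul_eLpNorm_of_ae_le_mul (hle u) 2).trans ?_
      rw [mul_assoc]
      refine mul_le_mul_right ?_ _
      have h1 : eLpNorm (fun x => u (s x)) 2 μ = eLpNorm u 2 (μ.map s) :=
        (eLpNorm_map_measure ((Lp.aestronglyMeasurable u).mono_ac hq.2) hs.aemeasurable).symm
      rw [h1]
      exact eLpNorm_le_of_measure_le_smul hmap

/-- An integral operator with a bounded kernel on a bounded interval is bounded on `L₂`. -/
theorem exists_integral_operator {T C : ℝ} {N : ℝ → ℝ → E →L[ℂ] F}
    (hN : StronglyMeasurable (Function.uncurry N))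
    (hC : ∀ x ∈ Ioo 0 T, ∀ r ∈ Ioo 0 T, ‖N x r‖ ≤ C) :
    ∃ S : Lp E 2 (volume.restrict (Ioo 0 T)) →L[ℂ] Lp F 2 (volume.restrict (Ioo 0 T)),
      ∀ u, S u =ᵐ[volume.restrict (Ioo 0 T)] fun x => ∫ r in Ioo 0 T, N x r (u r) := by
  set μ : Measure ℝ := volume.restrict (Ioo 0 T)
  have hint : ∀ u : Lp E 2 μ, Integrable u μ := fun u =>
    (Lp.memLp u).integrable (by norm_num)
  have hmeas : ∀ u : Lp E 2 μ, ∀ x, AEStronglyMeasurable (fun r => N x r (u r)) μ := fun u x =>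
    (ContinuousLinearMap.id ℂ (E →L[ℂ] F)).aestronglyMeasurable_comp₂
      (hN.comp_measurable measurable_prodMk_left).aestronglyMeasurable
      (Lp.aestronglyMeasurable u)
  have hle : ∀ u : Lp E 2 μ, ∀ x ∈ Ioo 0 T, ∀ᵐ r ∂μ, ‖N x r (u r)‖ ≤ C * ‖u r‖ := by
    intro u x hx
    filter_upwards [ae_restrict_mem measurableSet_Ioo] with r hr
    exact (N x r).le_of_opNorm_le (hC x hx r hr) _
  have hi : ∀ u : Lp E 2 μ, ∀ x ∈ Ioo 0 T, Integrable (fun r => N x r (u r)) μ :=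
    fun u x hx => ((hint u).norm.const_mul C).mono' (hmeas u x) (hle u x hx)
  have hbd : ∀ u : Lp E 2 μ, ∀ x ∈ Ioo 0 T,
      ‖∫ r, N x r (u r) ∂μ‖ ≤ C * ∫ r, ‖u r‖ ∂μ := fun u x hx => by
    rw [← integral_const_mul]
    exact norm_integral_le_of_norm_le ((hint u).norm.const_mul C) (hle u x hx)
  have hbd' : ∀ u : Lp E 2 μ, ∀ᵐ x ∂μ, ‖∫ r, N x r (u r) ∂μ‖ ≤ C * ∫ r, ‖u r‖ ∂μ := fun u =>
    (ae_restrict_mem measurableSet_Ioo).mono fun x hx => hbd u x hx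
  have hm2 : ∀ u : Lp E 2 μ, AEStronglyMeasurable (fun x => ∫ r, N x r (u r) ∂μ) μ := fun u =>
    AEStronglyMeasurable.integral_prod_right' (f := fun z : ℝ × ℝ => N z.1 z.2 (u z.2))
      ((ContinuousLinearMap.id ℂ (E →L[ℂ] F)).aestronglyMeasurable_comp₂
        hN.aestronglyMeasurable (Lp.aestronglyMeasurable u).comp_snd)
  refine exists_clm_of_ae (fun u x => ∫ r, N x r (u r) ∂μ)
    ((μ univ ^ (2 : ℝ≥0∞).toReal⁻¹).toReal * (|C| * (μ univ ^ (2 : ℝ≥0∞).toReal⁻¹).toReal))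
    ?_ ?_ ?_ ?_
  · exact fun u => MemLp.of_bound (hm2 u) _ (hbd' u)
  · intro u v
    filter_upwards [ae_restrict_mem measurableSet_Ioo] with x hx
    rw [← integral_add (hi u x hx) (hi v x hx)]
    refine integral_congr_ae ?_
    filter_upwards [Lp.coeFn_add u v] with r hr
    rw [hr, Pi.add_apply, map_add]
  · intro a u
    refine Eventually.of_forall fun x => ?_
    simp only
    rw [← integral_smul]
    refine integral_congr_ae ?_
    filter_upwards [Lp.coeFn_smul a u] with r hr
    rw [hr, Pi.smul_apply, map_smul]
  · intro u
    have hnn : 0 ≤ ∫ r, ‖u r‖ ∂μ := integral_nonneg fun _ => norm_nonneg _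
    have h1 := integral_norm_le_mul_norm u
    refine (ENNReal.toReal_mono (ENNReal.mul_ne_top
        (ENNReal.rpow_ne_top_of_nonneg (by positivity) (measure_ne_top _ _))
        ENNReal.ofReal_ne_top) (eLpNorm_le_of_ae_bound (hbd' u))).trans ?_
    rw [ENNReal.toReal_mul, mul_assoc, ENNReal.toReal_ofReal']
    refine mul_le_mul_of_nonneg_left (max_le ?_ (by positivity)) ENNReal.toReal_nonneg
    calc C * ∫ r, ‖u r‖ ∂μ ≤ |C| * ∫ r, ‖u r‖ ∂μ :=
          mul_le_mul_of_nonneg_right (le_abs_self C) hnn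
      _ ≤ _ := by
        rw [mul_assoc]
        exact mul_le_mul_of_nonneg_left h1 (abs_nonneg C)

end LpOperators

/-- A bounded operator on `L₂(0, T)` that is dominated pointwise by integration from `0` is
quasi-nilpotent, so that `1 + S` is invertible. -/
theorem isUnit_one_add_of_volterra {E : Type*} [NormedAddCommGroup E] [NormedSpace ℂ E]
    [CompleteSpace E] {T C : ℝ} (hT : 0 < T) (hC0 : 0 ≤ C)
    {μ : Measure ℝ} (hμ : μ = volume.restrict (Ioo 0 T)) (S : Lp E 2 μ →L[ℂ] Lp E 2 μ)
    (hS : ∀ u, ∀ᵐ x ∂μ, ‖S u x‖ ≤ C * ∫ r in Ioo 0 x, ‖u r‖) :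
    IsUnit (1 + S) := by
  have hfin : IsFiniteMeasure μ := by rw [hμ]; infer_instance
  have hmemT : ∀ᵐ x ∂μ, x ∈ Ioo 0 T := by rw [hμ]; exact ae_restrict_mem measurableSet_Ioo
  have hint : ∀ u : Lp E 2 μ, Integrable u μ := fun u =>
    (Lp.memLp u).integrable (by norm_num)
  have hsub : ∀ x ∈ Ioo 0 T, volume.restrict (Ioo 0 x) ≤ μ := fun x hx => by
    rw [hμ]
    exact Measure.restrict_mono (Ioo_subset_Ioo_right hx.2.le) le_rfl
  have himp : ∀ p : ℝ → Prop, (∀ᵐ x ∂μ, p x) → ∀ᵐ x : ℝ, x ∈ Ioo 0 T → p x := fun p hp => by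
    rw [hμ] at hp
    exact ae_imp_of_ae_restrict hp
  -- iterated integration produces the factor `x ^ n / n!`
  have hiter : ∀ (n : ℕ) (u : Lp E 2 μ), ∀ᵐ x ∂μ,
      ‖(S ^ (n + 1)) u x‖ ≤ C ^ (n + 1) * (x ^ n / n.factorial) * ∫ r, ‖u r‖ ∂μ := by
    intro n
    induction n with
    | zero =>
      intro u
      filter_upwards [hS u, hmemT] with x hx hxT
      simp only [zero_add, pow_one, pow_zero, Nat.factorial_zero, Nat.cast_one, div_one, mul_one]
      refine hx.trans (mul_le_mul_of_nonneg_left ?_ hC0)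
      exact integral_mono_measure (hsub x hxT) (Eventually.of_forall fun _ => norm_nonneg _)
        (hint u).norm
    | succ n ih =>
      intro u
      filter_upwards [hS ((S ^ (n + 1)) u), hmemT] with x hx hxT
      rw [pow_succ' S (n + 1)]
      refine hx.trans ?_
      set I := ∫ r, ‖u r‖ ∂μ
      have h1 : ∫ r in Ioo 0 x, ‖(S ^ (n + 1)) u r‖ ≤
          ∫ r in Ioo 0 x, C ^ (n + 1) * (r ^ n / n.factorial) * I := by
        refine setIntegral_mono_on_ae ?_ ?_ measurableSet_Ioo ?_
        · exact (hint _).norm.mono_measure (hsub x hxT)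
        · exact (Continuous.integrableOn_Icc (by fun_prop)).mono_set Ioo_subset_Icc_self
        · have := himp _ (ih u)
          filter_upwards [this] with r hr hrx
          exact hr ⟨hrx.1, hrx.2.trans hxT.2⟩
      have h2 : ∫ r in Ioo 0 x, C ^ (n + 1) * (r ^ n / n.factorial) * I =
          C ^ (n + 1) * (x ^ (n + 1) / (n + 1).factorial) * I := by
        rw [← integral_Ioc_eq_integral_Ioo, ← intervalIntegral.integral_of_le hxT.1.le]
        rw [intervalIntegral.integral_mul_const, intervalIntegral.integral_const_mul,
          intervalIntegral.integral_div, integral_pow]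
        rw [Nat.factorial_succ]
        push_cast
        field_simp
        ring
      calc C * ∫ r in Ioo 0 x, ‖(S ^ (n + 1)) u r‖
          ≤ C * (C ^ (n + 1) * (x ^ (n + 1) / (n + 1).factorial) * I) :=
            mul_le_mul_of_nonneg_left (h1.trans h2.le) hC0
        _ = _ := by ring
  set κ : ℝ := (μ univ ^ (2 : ℝ≥0∞).toReal⁻¹).toReal with hκ
  have hκ0 : 0 ≤ κ := ENNReal.toReal_nonneg
  have hL1 : ∀ u : Lp E 2 μ, ∫ r, ‖u r‖ ∂μ ≤ κ * ‖u‖ := integral_norm_le_mul_norm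
  have hnorm : ∀ n : ℕ, ‖S ^ (n + 1)‖ ≤ κ * κ * C * ((C * T) ^ n / n.factorial) := by
    intro n
    refine ContinuousLinearMap.opNorm_le_bound _ (by positivity) fun u => ?_
    have hI : 0 ≤ ∫ r, ‖u r‖ ∂μ := integral_nonneg fun _ => norm_nonneg _
    have hb : ∀ᵐ x ∂μ, ‖(S ^ (n + 1)) u x‖ ≤
        C ^ (n + 1) * (T ^ n / n.factorial) * ∫ r, ‖u r‖ ∂μ := by
      filter_upwards [hiter n u, hmemT] with x hx hxT
      refine hx.trans ?_
      have := hxT.1.le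
      have := hxT.2.le
      gcongr
    rw [Lp.norm_def]
    refine (ENNReal.toReal_mono (ENNReal.mul_ne_top
        (ENNReal.rpow_ne_top_of_nonneg (by positivity) (measure_ne_top _ _))
        ENNReal.ofReal_ne_top) (eLpNorm_le_of_ae_bound hb)).trans ?_
    rw [ENNReal.toReal_mul, ENNReal.toReal_ofReal (by positivity)]
    calc κ * (C ^ (n + 1) * (T ^ n / n.factorial) * ∫ r, ‖u r‖ ∂μ)
        ≤ κ * (C ^ (n + 1) * (T ^ n / n.factorial) * (κ * ‖u‖)) := by
          gcongr
          exact hL1 u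
      _ = _ := by rw [mul_pow]; ring
  obtain ⟨n, hn⟩ : ∃ n : ℕ, κ * κ * C * ((C * T) ^ n / n.factorial) < 1 := by
    have := (FloorSemiring.tendsto_pow_div_factorial_atTop (C * T)).const_mul (κ * κ * C)
    rw [mul_zero] at this
    exact (this.eventually_lt_const one_pos).exists
  have hu : IsUnit (1 - (-S) ^ (n + 1)) := by
    refine isUnit_one_sub_of_norm_lt_one ?_
    rw [neg_pow]
    refine lt_of_le_of_lt ?_ hn
    refine le_trans ?_ (hnorm n)
    rcases neg_one_pow_eq_or (Lp E 2 μ →L[ℂ] Lp E 2 μ) (n + 1) with h | h <;> simp [h]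
  have hfac : (1 - (-S)) * (∑ i ∈ Finset.range (n + 1), (-S) ^ i) = 1 - (-S) ^ (n + 1) :=
    mul_neg_geom_sum _ _
  have hcomm : Commute (1 - (-S)) (∑ i ∈ Finset.range (n + 1), (-S) ^ i) :=
    Commute.sum_right _ _ _ fun i _ =>
      (Commute.one_left _).sub_left ((Commute.refl (-S)).pow_right i)
  rw [← hfac, hcomm.isUnit_mul_iff, sub_neg_eq_add] at hu
  exact hu.1

/-! ### The reflection kernel -/

/-- The coefficient of the unfolded system `P_t + P_y = β(y) P(-y)`: it is `b` on the right and
`c` on the left half-line, both continuous up to `0`, with a jump at `0`. -/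
def reflection (b c : ℝ → ℂ) (y : ℝ) : ℂ := if 0 < y then b y else c y

section Reflection

variable {b c : ℝ → ℂ} {C : ℝ}

theorem measurable_reflection (hb : Continuous b) (hc : Continuous c) :
    Measurable (reflection b c) :=
  Measurable.ite measurableSet_Ioi hb.measurable hc.measurable

theorem continuousAt_reflection (hb : Continuous b) (hc : Continuous c) {y : ℝ} (hy : y ≠ 0) :
    ContinuousAt (reflection b c) y := by
  rcases lt_or_gt_of_ne hy with h | h
  · refine hc.continuousAt.congr ?_
    filter_upwards [Iio_mem_nhds h] with z hz
    simp [reflection, not_lt.2 (le_of_lt (mem_Iio.1 hz))]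
  · refine hb.continuousAt.congr ?_
    filter_upwards [Ioi_mem_nhds h] with z hz
    simp [reflection, mem_Ioi.1 hz]

theorem norm_reflection_le (hbC : ∀ y, ‖b y‖ ≤ C) (hcC : ∀ y, ‖c y‖ ≤ C) (y : ℝ) :
    ‖reflection b c y‖ ≤ C := by
  unfold reflection
  split_ifs
  exacts [hbC y, hcC y]

end Reflection

theorem abs_integral_exp_abs_le {l : ℝ} (hl : 0 < l) (z : ℝ) :
    |∫ r in (0 : ℝ)..z, Real.exp (l * |r|)| ≤ Real.exp (l * |z|) / l := by
  have key : ∀ z : ℝ, 0 ≤ z →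
      |∫ r in (0 : ℝ)..z, Real.exp (l * |r|)| ≤ Real.exp (l * |z|) / l := by
    intro z hz
    have h1 : ∫ r in (0 : ℝ)..z, Real.exp (l * |r|) = ∫ r in (0 : ℝ)..z, Real.exp (l * r) := by
      refine intervalIntegral.integral_congr fun r hr => ?_
      rw [uIcc_of_le hz] at hr
      simp only [abs_of_nonneg hr.1]
    rw [h1, intervalIntegral.integral_comp_mul_left (fun x => Real.exp x) hl.ne', integral_exp,
      mul_zero, Real.exp_zero, smul_eq_mul, abs_of_nonneg hz, abs_of_nonneg]
    · rw [div_eq_inv_mul]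
      exact mul_le_mul_of_nonneg_left (by linarith) (inv_nonneg.2 hl.le)
    · exact mul_nonneg (inv_nonneg.2 hl.le)
        (by linarith [Real.one_le_exp (mul_nonneg hl.le hz)])
  rcases le_total 0 z with hz | hz
  · exact key z hz
  · have := key (-z) (by linarith)
    rw [abs_neg] at this
    refine le_trans (le_of_eq ?_) this
    have h2 := intervalIntegral.integral_comp_neg (a := 0) (b := -z)
      (fun r => Real.exp (l * |r|))
    simp only [abs_neg, neg_neg, neg_zero] at h2
    rw [h2, intervalIntegral.integral_symm, abs_neg]

/-- The Goursat problem for the response to an impulse at the boundary, in the characteristic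
coordinates `ξ = t - y`, `ζ = t + y`. The fixed point equation is a contraction for the supremum
norm with the weight `exp (-l (|ξ| + |ζ|))`, for `l` large. -/
theorem exists_goursat_kernel {b c : ℝ → ℂ} {C : ℝ} (hb : Continuous b) (hc : Continuous c)
    (hbC : ∀ y, ‖b y‖ ≤ C) (hcC : ∀ y, ‖c y‖ ≤ C) :
    ∃ K : ℝ → ℝ → ℂ, Continuous (fun z : ℝ × ℝ => K z.1 z.2) ∧
      ∀ ξ ζ, K ξ ζ = 1 / 2 * c (-ξ / 2) +
        1 / 2 * ∫ r in (0 : ℝ)..ζ, reflection b c ((r - ξ) / 2) * K r ξ := by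
  have hC0 : 0 ≤ C := (norm_nonneg _).trans (hbC 0)
  set l : ℝ := C + 1 with hl
  have hl0 : 0 < l := by positivity
  set β := reflection b c with hβ
  have hβm : Measurable β := measurable_reflection hb hc
  -- the integral operator of the weighted unknown
  let A : ((ℝ × ℝ) →ᵇ ℂ) → ℝ × ℝ → ℂ := fun κ z =>
    ∫ r in (0 : ℝ)..z.2, β ((r - z.1) / 2) * κ (r, z.1) * (Real.exp (l * |r|) : ℝ)
  have hint : ∀ (κ : (ℝ × ℝ) →ᵇ ℂ) (ξ u v : ℝ), IntervalIntegrable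
      (fun r => β ((r - ξ) / 2) * κ (r, ξ) * (Real.exp (l * |r|) : ℝ)) volume u v := by
    intro κ ξ u v
    refine IntervalIntegrable.mono_fun' (g := fun r => C * ‖κ‖ * Real.exp (l * |r|))
      (Continuous.intervalIntegrable (by fun_prop) _ _) ?_ ?_
    · refine Measurable.aestronglyMeasurable ?_
      exact ((hβm.comp (by fun_prop)).mul (κ.continuous.measurable.comp (by fun_prop))).mul
        (by fun_prop)
    · refine Eventually.of_forall fun r => ?_
      simp only [norm_mul, Complex.norm_real, Real.norm_eq_abs, Real.abs_exp]
      have := norm_reflection_le hbC hcC ((r - ξ) / 2)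
      have := κ.norm_coe_le_norm (r, ξ)
      gcongr
  have hAcont : ∀ κ, Continuous (A κ) := by
    intro κ
    refine continuous_iff_continuousAt.2 fun z => ?_
    obtain ⟨ξ, ζ⟩ := z
    refine intervalIntegral.continuousAt_parametric_primitive_of_dominated
      (F := fun ξ r => β ((r - ξ) / 2) * κ (r, ξ) * (Real.exp (l * |r|) : ℝ))
      (fun r => C * ‖κ‖ * Real.exp (l * |r|)) (-(|ζ| + 1)) (|ζ| + 1) ?_ ?_ ?_ ?_ ?_ ?_ ?_
    · intro ξ
      refine Measurable.aestronglyMeasurable ?_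
      exact ((hβm.comp (by fun_prop)).mul (κ.continuous.measurable.comp (by fun_prop))).mul
        (by fun_prop)
    · refine Eventually.of_forall fun ξ => Eventually.of_forall fun r => ?_
      simp only [norm_mul, Complex.norm_real, Real.norm_eq_abs, Real.abs_exp]
      have := norm_reflection_le hbC hcC ((r - ξ) / 2)
      have := κ.norm_coe_le_norm (r, ξ)
      gcongr
    · exact Continuous.intervalIntegrable (by fun_prop) _ _
    · have : ∀ᵐ r ∂(volume : Measure ℝ), r ≠ ξ := by
        simp [ae_iff, measure_singleton]
      filter_upwards [ae_restrict_of_ae this] with r hr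
      have h1 : ContinuousAt β ((r - ξ) / 2) :=
        continuousAt_reflection hb hc (div_ne_zero (sub_ne_zero.2 hr) two_ne_zero)
      have h2 : ContinuousAt (fun ξ : ℝ => β ((r - ξ) / 2)) ξ :=
        ContinuousAt.comp (f := fun ξ : ℝ => (r - ξ) / 2) h1 (by fun_prop)
      have h3 : Continuous fun ξ : ℝ => κ (r, ξ) := κ.continuous.comp (by fun_prop)
      exact (h2.mul h3.continuousAt).mul continuousAt_const
    · constructor <;> linarith [abs_nonneg ζ]
    · constructor <;> linarith [neg_abs_le ζ, le_abs_self ζ]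
    · exact measure_singleton _
  have hAbound : ∀ κ z, ‖((Real.exp (-(l * |z.2|)) : ℝ) : ℂ) * A κ z‖ ≤ ‖κ‖ := by
    intro κ z
    have h1 : ‖A κ z‖ ≤ |∫ r in (0 : ℝ)..z.2, C * ‖κ‖ * Real.exp (l * |r|)| := by
      refine intervalIntegral.norm_integral_le_abs_of_norm_le (Eventually.of_forall fun r => ?_)
        (Continuous.intervalIntegrable (by fun_prop) _ _)
      simp only [norm_mul, Complex.norm_real, Real.norm_eq_abs, Real.abs_exp]
      have := norm_reflection_le hbC hcC ((r - z.1) / 2)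
      have := κ.norm_coe_le_norm (r, z.1)
      gcongr
    rw [intervalIntegral.integral_const_mul, abs_mul, abs_of_nonneg (by positivity)] at h1
    have h2 := h1.trans (mul_le_mul_of_nonneg_left (abs_integral_exp_abs_le hl0 z.2)
      (by positivity))
    rw [norm_mul, Complex.norm_real, Real.norm_eq_abs, Real.abs_exp]
    calc Real.exp (-(l * |z.2|)) * ‖A κ z‖
        ≤ Real.exp (-(l * |z.2|)) * (C * ‖κ‖ * (Real.exp (l * |z.2|) / l)) := by gcongr
      _ = (C / l) * ‖κ‖ := by
        rw [Real.exp_neg]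
        field_simp
      _ ≤ 1 * ‖κ‖ := by
        gcongr
        rw [div_le_one hl0]
        linarith
      _ = ‖κ‖ := one_mul _
  let g : ℝ × ℝ → ℂ := fun z => 1 / 2 * ((Real.exp (-(l * (|z.1| + |z.2|))) : ℝ) : ℂ) *
    c (-z.1 / 2)
  have hgbound : ∀ z, ‖g z‖ ≤ C := by
    intro z
    have h1 : Real.exp (-(l * (|z.1| + |z.2|))) ≤ 1 := by
      rw [Real.exp_le_one_iff]
      have : 0 ≤ l * (|z.1| + |z.2|) := by positivity
      linarith
    have h2 := hcC (-z.1 / 2)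
    simp only [g, norm_mul, Complex.norm_real, Real.norm_eq_abs, Real.abs_exp]
    have h3 : ‖(1 / 2 : ℂ)‖ ≤ 1 := by norm_num
    calc _ ≤ 1 * 1 * C := by gcongr
      _ = C := by ring
  let Ψ : ((ℝ × ℝ) →ᵇ ℂ) → ((ℝ × ℝ) →ᵇ ℂ) := fun κ =>
    BoundedContinuousFunction.ofNormedAddCommGroup
      (fun z => g z + 1 / 2 * (((Real.exp (-(l * |z.2|)) : ℝ) : ℂ) * A κ z))
      (by
        have := hAcont κ
        simp only [g]
        fun_prop) (C + 1 / 2 * ‖κ‖) (by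
        intro z
        refine (norm_add_le _ _).trans (add_le_add (hgbound z) ?_)
        rw [norm_mul]
        have h3 : ‖(1 / 2 : ℂ)‖ = 1 / 2 := by norm_num
        rw [h3]
        exact mul_le_mul_of_nonneg_left (hAbound κ z) (by norm_num))
  have hcontr : ContractingWith (1 / 2) Ψ := by
    refine ⟨by norm_num, LipschitzWith.of_dist_le_mul fun κ κ' => ?_⟩
    refine (BoundedContinuousFunction.dist_le (by positivity)).2 fun z => ?_
    have hsub : A κ z - A κ' z = A (κ - κ') z := by
      simp only [A]
      rw [← intervalIntegral.integral_sub (hint κ _ _ _) (hint κ' _ _ _)]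
      refine intervalIntegral.integral_congr fun r _ => ?_
      simp only [BoundedContinuousFunction.coe_sub, Pi.sub_apply]
      ring
    have h1 : Ψ κ z - Ψ κ' z = 1 / 2 * (((Real.exp (-(l * |z.2|)) : ℝ) : ℂ) * A (κ - κ') z) := by
      rw [← hsub]
      simp only [Ψ, BoundedContinuousFunction.coe_ofNormedAddCommGroup]
      ring
    rw [dist_eq_norm, h1, norm_mul, dist_eq_norm]
    have h3 : ‖(1 / 2 : ℂ)‖ = ((1 / 2 : ℝ≥0) : ℝ) := by norm_num
    rw [h3]
    exact mul_le_mul_of_nonneg_left (hAbound _ z) (by positivity)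
  obtain ⟨κ, hκ⟩ : ∃ κ, Ψ κ = κ := ⟨_, hcontr.fixedPoint_isFixedPt⟩
  refine ⟨fun ξ ζ => ((Real.exp (l * (|ξ| + |ζ|)) : ℝ) : ℂ) * κ (ξ, ζ), ?_, ?_⟩
  · have := κ.continuous
    fun_prop
  · intro ξ ζ
    have h1 : κ (ξ, ζ) = g (ξ, ζ) + 1 / 2 * (((Real.exp (-(l * |ζ|)) : ℝ) : ℂ) * A κ (ξ, ζ)) := by
      conv_lhs => rw [← hκ]
      rfl
    have h2 : ∫ r in (0 : ℝ)..ζ, β ((r - ξ) / 2) *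
        (((Real.exp (l * (|r| + |ξ|)) : ℝ) : ℂ) * κ (r, ξ)) =
        ((Real.exp (l * |ξ|) : ℝ) : ℂ) * A κ (ξ, ζ) := by
      simp only [A]
      rw [← intervalIntegral.integral_const_mul]
      refine intervalIntegral.integral_congr fun r _ => ?_
      simp only [mul_add, Real.exp_add]
      push_cast
      ring
    rw [h2]
    beta_reduce
    rw [h1]
    simp only [g, mul_add, neg_add, Real.exp_add, Real.exp_neg]
    push_cast
    have e1 : Complex.exp (l * |ξ|) ≠ 0 := Complex.exp_ne_zero _
    have e2 : Complex.exp (l * |ζ|) ≠ 0 := Complex.exp_ne_zero _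
    field_simp

/-! ### Waves on the unfolded line -/

/-- The response at the point `y` and the time `t` to an impulse emitted at the boundary at the
time `0`, without the impulse itself; `K` is the Goursat kernel in characteristic coordinates. -/
def impulseResponse (K : ℝ → ℝ → ℂ) (y t : ℝ) : ℂ := if |y| < t then K (t - y) (t + y) else 0

/-- The solution of the unfolded system with the boundary source `F`: the signal travelling with
unit speed to the right, and its reflections. -/
def wave (K : ℝ → ℝ → ℂ) (F : ℝ → ℂ) (y t : ℝ) : ℂ :=
  (if 0 < y then F (t - y) else 0) + ∫ r, impulseResponse K y (t - r) * F r

section ImpulseResponse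

variable {K : ℝ → ℝ → ℂ}

theorem impulseResponse_of_le {y t : ℝ} (h : t ≤ |y|) : impulseResponse K y t = 0 :=
  if_neg (not_lt.2 h)

theorem impulseResponse_of_nonpos {y t : ℝ} (h : t ≤ 0) : impulseResponse K y t = 0 :=
  impulseResponse_of_le (h.trans (abs_nonneg y))

theorem measurable_impulseResponse (hK : Continuous fun z : ℝ × ℝ => K z.1 z.2) :
    Measurable fun z : ℝ × ℝ => impulseResponse K z.1 z.2 := by
  have h : Measurable fun z : ℝ × ℝ => K (z.2 - z.1) (z.2 + z.1) :=
    (hK.comp (g := fun z : ℝ × ℝ => K z.1 z.2) (f := fun z : ℝ × ℝ => (z.2 - z.1, z.2 + z.1))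
      (by fun_prop)).measurable
  exact Measurable.ite (measurableSet_lt (by fun_prop) (by fun_prop)) h measurable_const

theorem exists_impulseResponse_bound (hK : Continuous fun z : ℝ × ℝ => K z.1 z.2) (a : ℝ) :
    ∃ B, 0 ≤ B ∧ ∀ y t, t ≤ a → ‖impulseResponse K y t‖ ≤ B := by
  obtain ⟨B, hB⟩ := (isCompact_Icc.prod isCompact_Icc :
    IsCompact (Icc (0 : ℝ) (2 * a) ×ˢ Icc (0 : ℝ) (2 * a))).exists_bound_of_continuousOn
      hK.continuousOn
  refine ⟨max B 0, le_max_right _ _, fun y t ht => ?_⟩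
  unfold impulseResponse
  split_ifs with h
  · have := abs_lt.1 h
    refine (hB (t - y, t + y) ⟨⟨?_, ?_⟩, ⟨?_, ?_⟩⟩).trans (le_max_left _ _) <;> simp only <;>
      linarith
  · simp

theorem continuousAt_impulseResponse (hK : Continuous fun z : ℝ × ℝ => K z.1 z.2) {y t : ℝ}
    (h : |y| ≠ t) : ContinuousAt (fun z : ℝ × ℝ => impulseResponse K z.1 z.2) (y, t) := by
  rcases lt_or_gt_of_ne h with h | h
  · have h1 : Continuous fun z : ℝ × ℝ => K (z.2 - z.1) (z.2 + z.1) :=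
      hK.comp (g := fun z : ℝ × ℝ => K z.1 z.2) (f := fun z : ℝ × ℝ => (z.2 - z.1, z.2 + z.1))
        (by fun_prop)
    refine h1.continuousAt.congr ?_
    have : ∀ᶠ z : ℝ × ℝ in 𝓝 (y, t), |z.1| < z.2 :=
      (isOpen_lt (by fun_prop) (by fun_prop)).mem_nhds h
    filter_upwards [this] with z hz
    simp [impulseResponse, hz]
  · refine (continuousAt_const (y := (0 : ℂ))).congr ?_
    have : ∀ᶠ z : ℝ × ℝ in 𝓝 (y, t), z.2 < |z.1| :=
      (isOpen_lt (by fun_prop) (by fun_prop)).mem_nhds h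
    filter_upwards [this] with z hz
    rw [impulseResponse_of_le hz.le]

/-- The equation `k_t + k_y = β(y) k(-y)` for the impulse response, integrated along the
characteristics; the first term stems from the reflection of the impulse. -/
theorem impulseResponse_eq {b c : ℝ → ℂ}
    (hKeq : ∀ ξ ζ, K ξ ζ = 1 / 2 * c (-ξ / 2) +
        1 / 2 * ∫ r in (0 : ℝ)..ζ, reflection b c ((r - ξ) / 2) * K r ξ) (y t : ℝ) :
    impulseResponse K y t = (if |y| < t then 1 / 2 * reflection b c ((y - t) / 2) else 0) +
      ∫ s in (0 : ℝ)..t, reflection b c (y - t + s) * impulseResponse K (t - y - s) s := by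
  by_cases h : |y| < t
  · obtain ⟨h1, h2⟩ := abs_lt.1 h
    have ht : 0 < t := (abs_nonneg y).trans_lt h
    rw [if_pos h, impulseResponse, if_pos h, hKeq]
    have e1 : reflection b c ((y - t) / 2) = c (-(t - y) / 2) := by
      rw [reflection, if_neg (by linarith)]
      congr 1
      ring
    rw [e1]
    congr 1
    have hsplit : ∫ s in (0 : ℝ)..t, reflection b c (y - t + s) * impulseResponse K (t - y - s) s =
        ∫ s in ((t - y) / 2)..t, reflection b c (y - t + s) * K (2 * s - (t - y)) (t - y) := by
      rw [intervalIntegral.integral_of_le ht.le, intervalIntegral.integral_of_le (by linarith)]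
      have hsub : Ioc ((t - y) / 2) t ⊆ Ioc 0 t := Ioc_subset_Ioc_left (by linarith)
      rw [setIntegral_eq_of_subset_of_forall_sdiff_eq_zero measurableSet_Ioc hsub]
      · refine setIntegral_congr_fun measurableSet_Ioc fun s hs => ?_
        have hlt : |t - y - s| < s := abs_lt.2 ⟨by linarith, by linarith [hs.1]⟩
        simp only [impulseResponse, if_pos hlt]
        congr 2 <;> ring
      · intro s hs
        have : s ≤ (t - y) / 2 := by
          by_contra hcon
          exact hs.2 ⟨not_le.1 hcon, hs.1.2⟩
        rw [impulseResponse_of_le, mul_zero]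
        exact le_trans (by linarith) (le_abs_self _)
    rw [hsplit]
    have hsubst := intervalIntegral.integral_comp_mul_sub (a := (t - y) / 2) (b := t)
      (fun r => reflection b c ((r - (t - y)) / 2) * K r (t - y)) (two_ne_zero (α := ℝ)) (t - y)
    have e2 : 2 * ((t - y) / 2) - (t - y) = 0 := by ring
    have e3 : 2 * t - (t - y) = t + y := by ring
    rw [e2, e3] at hsubst
    rw [Complex.real_smul] at hsubst
    have e4 : (((2 : ℝ)⁻¹ : ℝ) : ℂ) = 1 / 2 := by norm_num
    rw [e4] at hsubst
    rw [← hsubst]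
    refine intervalIntegral.integral_congr fun s _ => ?_
    congr 2
    ring
  · rw [if_neg h, zero_add, impulseResponse, if_neg h]
    symm
    have hz : ∀ s ∈ uIcc 0 t,
        reflection b c (y - t + s) * impulseResponse K (t - y - s) s = 0 := by
      intro s hs
      have : impulseResponse K (t - y - s) s = 0 := by
        rcases le_total t 0 with ht | ht
        · rw [uIcc_of_ge ht] at hs
          exact impulseResponse_of_nonpos hs.2
        · rw [uIcc_of_le ht] at hs
          apply impulseResponse_of_le
          rcases le_abs.1 (not_lt.1 h) with h' | h'
          · exact le_trans (by linarith) (neg_le_abs _)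
          · exact le_trans (by linarith [hs.2]) (le_abs_self _)
      rw [this, mul_zero]
    rw [intervalIntegral.integral_congr hz, intervalIntegral.integral_zero]

end ImpulseResponse

theorem integral_eq_integral_two_mul_sub (G : ℝ → ℂ) (a : ℝ) :
    ∫ r, G r = ∫ s, 2 * G (2 * s - a) := by
  rw [integral_const_mul, Measure.integral_comp_mul_left (fun x => G (x - a)) 2,
    integral_sub_right_eq_self G, Complex.real_smul, ← mul_assoc]
  norm_num

section Wave

variable {K : ℝ → ℝ → ℂ} {F : ℝ → ℂ} {T : ℝ}

theorem integrable_impulseResponse_mul (hK : Continuous fun z : ℝ × ℝ => K z.1 z.2)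
    (hF : Integrable F) (hF0 : ∀ r, r ∉ Ioo 0 T → F r = 0) (y t : ℝ) :
    Integrable fun r => impulseResponse K y (t - r) * F r := by
  obtain ⟨B, hB0, hB⟩ := exists_impulseResponse_bound hK t
  refine (hF.norm.const_mul B).mono' ?_ (Eventually.of_forall fun r => ?_)
  · exact ((measurable_impulseResponse hK).comp
      (by fun_prop : Measurable fun r : ℝ => (y, t - r))).aestronglyMeasurable.mul
      hF.aestronglyMeasurable
  · rw [norm_mul]
    by_cases hr : r ∈ Ioo 0 T
    · exact mul_le_mul_of_nonneg_right (hB _ _ (by linarith [hr.1])) (norm_nonneg _)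
    · simp [hF0 r hr]

theorem continuous_integral_impulseResponse (hK : Continuous fun z : ℝ × ℝ => K z.1 z.2)
    (hF : Integrable F) (hF0 : ∀ r, r ∉ Ioo 0 T → F r = 0) :
    Continuous fun z : ℝ × ℝ => ∫ r, impulseResponse K z.1 (z.2 - r) * F r := by
  refine continuous_iff_continuousAt.2 fun z => ?_
  obtain ⟨y, t⟩ := z
  obtain ⟨B, hB0, hB⟩ := exists_impulseResponse_bound hK (t + 1)
  refine continuousAt_of_dominated (bound := fun r => B * ‖F r‖) ?_ ?_ (hF.norm.const_mul B) ?_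
  · exact Eventually.of_forall fun z =>
      (integrable_impulseResponse_mul hK hF hF0 z.1 z.2).aestronglyMeasurable
  · have : ∀ᶠ z : ℝ × ℝ in 𝓝 (y, t), z.2 < t + 1 :=
      (isOpen_lt (by fun_prop) (by fun_prop)).mem_nhds (by simp)
    filter_upwards [this] with z hz
    refine Eventually.of_forall fun r => ?_
    rw [norm_mul]
    by_cases hr : r ∈ Ioo 0 T
    · exact mul_le_mul_of_nonneg_right (hB _ _ (by linarith [hr.1])) (norm_nonneg _)
    · simp [hF0 r hr]
  · have : ∀ᵐ r ∂(volume : Measure ℝ), r ≠ t - |y| := by simp [ae_iff, measure_singleton]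
    filter_upwards [this] with r hr
    have h1 : ContinuousAt (fun z : ℝ × ℝ => impulseResponse K z.1 z.2) (y, t - r) :=
      continuousAt_impulseResponse hK fun h => hr (by linarith)
    have h2 : ContinuousAt (fun z : ℝ × ℝ => impulseResponse K z.1 (z.2 - r)) (y, t) :=
      ContinuousAt.comp (g := fun z : ℝ × ℝ => impulseResponse K z.1 z.2)
        (f := fun z : ℝ × ℝ => (z.1, z.2 - r)) (x := (y, t)) h1 (by fun_prop)
    exact h2.mul continuousAt_const

theorem integral_impulseResponse_eq_zero (hF0 : ∀ r, r ∉ Ioo 0 T → F r = 0) {y t : ℝ}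
    (h : t ≤ |y|) : ∫ r, impulseResponse K y (t - r) * F r = 0 := by
  have : ∀ r, impulseResponse K y (t - r) * F r = 0 := fun r => by
    by_cases hr : r ∈ Ioo 0 T
    · rw [impulseResponse_of_le (by linarith [hr.1]), zero_mul]
    · rw [hF0 r hr, mul_zero]
  simp [this]

theorem wave_eq_zero (hF0 : ∀ r, r ∉ Ioo 0 T → F r = 0) {y t : ℝ} (h : t ≤ |y|) :
    wave K F y t = 0 := by
  rw [wave, integral_impulseResponse_eq_zero hF0 h, add_zero]
  split_ifs with hy
  · rw [abs_of_pos hy] at h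
    exact hF0 _ fun hr => by linarith [hr.1]
  · rfl

/-- The equation `P_t + P_y = β(y) P(-y)` with the boundary source `F` at `y = 0`, integrated
along the characteristics. -/
theorem wave_eq {b c : ℝ → ℂ} {C : ℝ} (hb : Continuous b) (hc : Continuous c)
    (hbC : ∀ y, ‖b y‖ ≤ C) (hcC : ∀ y, ‖c y‖ ≤ C)
    (hK : Continuous fun z : ℝ × ℝ => K z.1 z.2)
    (hKeq : ∀ ξ ζ, K ξ ζ = 1 / 2 * c (-ξ / 2) +
        1 / 2 * ∫ r in (0 : ℝ)..ζ, reflection b c ((r - ξ) / 2) * K r ξ)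
    (hF : Integrable F) (hF0 : ∀ r, r ∉ Ioo 0 T → F r = 0) (y : ℝ) {t : ℝ} (ht : 0 ≤ t) :
    wave K F y t = (if 0 < y then F (t - y) else 0) +
      ∫ s in (0 : ℝ)..t, reflection b c (y - t + s) * wave K F (t - y - s) s := by
  set β := reflection b c with hβ
  have hβm : Measurable β := measurable_reflection hb hc
  have hβC : ∀ y, ‖β y‖ ≤ C := norm_reflection_le hbC hcC
  obtain ⟨B, hB0, hB⟩ := exists_impulseResponse_bound hK t
  have hC0 : 0 ≤ C := (norm_nonneg _).trans (hbC 0)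
  rw [wave]
  congr 1
  -- the reflection of the direct signal
  have hint1 : Integrable fun s => β (y - t + s) *
      (if 0 < t - y - s then F (s - (t - y - s)) else 0) := by
    have h1 : Integrable fun s => F (2 * s - (t - y)) :=
      (hF.comp_sub_right (t - y)).comp_mul_left' two_ne_zero
    have h2 : Integrable fun s => if 0 < t - y - s then F (2 * s - (t - y)) else 0 := by
      refine h1.mono ?_ (Eventually.of_forall fun s => ?_)
      · exact h1.aestronglyMeasurable.indicator
          (measurableSet_lt measurable_const (by fun_prop) : MeasurableSet {s | 0 < t - y - s})
      · split_ifs <;> simp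
    have h3 := h2.bdd_mul (c := C)
      (hβm.comp (by fun_prop : Measurable fun s => y - t + s)).aestronglyMeasurable
      (Eventually.of_forall fun s => hβC _)
    refine h3.congr (Eventually.of_forall fun s => ?_)
    simp only [Function.comp_apply]
    congr 3
    ring
  have hI1 : ∫ s in (0 : ℝ)..t, β (y - t + s) *
      (if 0 < t - y - s then F (s - (t - y - s)) else 0) =
      ∫ r, (if |y| < t - r then 1 / 2 * β ((y - (t - r)) / 2) else 0) * F r := by
    rw [intervalIntegral.integral_of_le ht, integral_Ioc_eq_integral_Ioo,
      ← integral_indicator measurableSet_Ioo]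
    rw [integral_eq_integral_two_mul_sub (fun r => (if |y| < t - r then
      1 / 2 * β ((y - (t - r)) / 2) else 0) * F r) (t - y)]
    refine integral_congr_ae (Eventually.of_forall fun s => ?_)
    simp only [indicator_apply]
    have ea : s - (t - y - s) = 2 * s - (t - y) := by ring
    have eb : (y - (t - (2 * s - (t - y)))) / 2 = y - t + s := by ring
    rw [ea, eb]
    by_cases hr : 2 * s - (t - y) ∈ Ioo 0 T
    · have hiff : |y| < t - (2 * s - (t - y)) ↔ s ∈ Ioo 0 t ∧ 0 < t - y - s := by
        rw [abs_lt]
        constructor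
        · rintro ⟨h1, h2⟩
          exact ⟨⟨by linarith [hr.1], by linarith⟩, by linarith⟩
        · rintro ⟨⟨h1, h2⟩, h3⟩
          exact ⟨by linarith, by linarith⟩
      by_cases h1 : s ∈ Ioo 0 t
      · by_cases h2 : 0 < t - y - s
        · rw [if_pos h1, if_pos h2, if_pos (hiff.2 ⟨h1, h2⟩)]
          ring
        · rw [if_pos h1, if_neg h2, if_neg (fun h => h2 (hiff.1 h).2)]
          ring
      · rw [if_neg h1, if_neg (fun h => h1 (hiff.1 h).1)]
        ring
    · simp [hF0 _ hr]
  -- the reflections of the reflected signal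
  have hprod : Integrable (fun z : ℝ × ℝ => β (y - t + z.1) *
      (impulseResponse K (t - y - z.1) (z.1 - z.2) * F z.2))
      ((volume.restrict (Ioc 0 t)).prod volume) := by
    have h0 : Integrable (fun z : ℝ × ℝ => C * (B * ‖F z.2‖))
        ((volume.restrict (Ioc 0 t)).prod volume) :=
      ((hF.norm.comp_snd (volume.restrict (Ioc 0 t))).const_mul B).const_mul C
    refine h0.mono' ?_ ?_
    · refine AEStronglyMeasurable.mul (hβm.comp (by fun_prop)).aestronglyMeasurable
        (AEStronglyMeasurable.mul ?_ hF.aestronglyMeasurable.comp_snd)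
      exact ((measurable_impulseResponse hK).comp
        (by fun_prop : Measurable fun z : ℝ × ℝ => (t - y - z.1, z.1 - z.2))).aestronglyMeasurable
    · have h1 : ∀ᵐ z ∂((volume.restrict (Ioc 0 t)).prod (volume : Measure ℝ)),
          z.1 ∈ Ioc 0 t :=
        Measure.quasiMeasurePreserving_fst.ae (ae_restrict_mem measurableSet_Ioc)
      filter_upwards [h1] with z hz
      rw [norm_mul, norm_mul]
      by_cases hr : z.2 ∈ Ioo 0 T
      · have e1 := hβC (y - t + z.1)
        have e2 := hB (t - y - z.1) (z.1 - z.2) (by linarith [hz.2, hr.1])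
        gcongr
      · simp [hF0 _ hr]
  have hint2 : IntervalIntegrable (fun s => β (y - t + s) *
      ∫ r, impulseResponse K (t - y - s) (s - r) * F r) volume 0 t := by
    rw [intervalIntegrable_iff_integrableOn_Ioc_of_le ht]
    refine hprod.integral_prod_left.congr (Eventually.of_forall fun s => ?_)
    simp only
    rw [integral_const_mul]
  have hI2 : ∫ s in (0 : ℝ)..t, β (y - t + s) *
      ∫ r, impulseResponse K (t - y - s) (s - r) * F r =
      ∫ r, (∫ s in (0 : ℝ)..(t - r), β (y - (t - r) + s) *
        impulseResponse K (t - r - y - s) s) * F r := by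
    rw [intervalIntegral.integral_of_le ht]
    simp_rw [← integral_const_mul]
    rw [integral_integral_swap hprod]
    refine integral_congr_ae (Eventually.of_forall fun r => ?_)
    simp only
    simp_rw [← mul_assoc]
    rw [integral_mul_const, ← intervalIntegral.integral_of_le ht]
    by_cases hr : r ∈ Ioo 0 T
    · congr 1
      have hsh := intervalIntegral.integral_comp_sub_right (a := 0) (b := t)
        (fun s => β (y - (t - r) + s) * impulseResponse K (t - r - y - s) s) r
      rw [zero_sub] at hsh
      have h1 : ∫ s in (0 : ℝ)..t, β (y - t + s) * impulseResponse K (t - y - s) (s - r) =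
          ∫ s in (0 : ℝ)..t, β (y - (t - r) + (s - r)) *
            impulseResponse K (t - r - y - (s - r)) (s - r) := by
        refine intervalIntegral.integral_congr fun s _ => ?_
        congr 2 <;> ring
      rw [h1, hsh]
      have hii : ∀ u v, IntervalIntegrable (fun s => β (y - (t - r) + s) *
          impulseResponse K (t - r - y - s) s) volume u v := by
        intro u v
        obtain ⟨B', hB0', hB'⟩ := exists_impulseResponse_bound hK (max u v)
        refine IntervalIntegrable.mono_fun' (g := fun _ => C * B') intervalIntegrable_const ?_ ?_
        · exact ((hβm.comp (by fun_prop)).mul ((measurable_impulseResponse hK).comp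
            (by fun_prop : Measurable fun s : ℝ => (t - r - y - s, s)))).aestronglyMeasurable
        · filter_upwards [ae_restrict_mem measurableSet_uIoc] with s hs
          rw [norm_mul]
          have e1 := hβC (y - (t - r) + s)
          have e2 := hB' (t - r - y - s) s hs.2
          gcongr
      rw [← intervalIntegral.integral_add_adjacent_intervals (hii (-r) 0) (hii 0 (t - r))]
      have hz : ∀ s ∈ uIcc (-r) 0, β (y - (t - r) + s) *
          impulseResponse K (t - r - y - s) s = 0 := by
        intro s hs
        rw [uIcc_of_le (by linarith [hr.1])] at hs
        rw [impulseResponse_of_nonpos hs.2, mul_zero]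
      rw [intervalIntegral.integral_congr hz, intervalIntegral.integral_zero, zero_add]
    · simp [hF0 r hr]
  have hsum : ∫ s in (0 : ℝ)..t, β (y - t + s) * wave K F (t - y - s) s =
      (∫ s in (0 : ℝ)..t, β (y - t + s) *
        (if 0 < t - y - s then F (s - (t - y - s)) else 0)) +
      ∫ s in (0 : ℝ)..t, β (y - t + s) *
        ∫ r, impulseResponse K (t - y - s) (s - r) * F r := by
    rw [← intervalIntegral.integral_add hint1.intervalIntegrable hint2]
    refine intervalIntegral.integral_congr fun s _ => ?_
    simp only [wave, mul_add]
  have hE : Integrable fun r =>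
      (if |y| < t - r then 1 / 2 * β ((y - (t - r)) / 2) else 0) * F r := by
    refine (hF.norm.const_mul C).mono' ?_ (Eventually.of_forall fun r => ?_)
    · refine AEStronglyMeasurable.mul (Measurable.aestronglyMeasurable ?_) hF.aestronglyMeasurable
      exact Measurable.ite (measurableSet_lt measurable_const (by fun_prop))
        (measurable_const.mul (hβm.comp (by fun_prop))) measurable_const
    · rw [norm_mul]
      refine mul_le_mul_of_nonneg_right ?_ (norm_nonneg _)
      split_ifs
      · rw [norm_mul]
        have h3 : ‖(1 / 2 : ℂ)‖ ≤ 1 := by norm_num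
        calc _ ≤ 1 * C := by
              have := hβC ((y - (t - r)) / 2)
              gcongr
          _ = C := one_mul _
      · simpa using hC0
  rw [hsum, hI1, hI2, ← integral_add hE]
  · refine integral_congr_ae (Eventually.of_forall fun r => ?_)
    simp only
    rw [← add_mul, impulseResponse_eq hKeq y (t - r)]
  · refine ((integrable_impulseResponse_mul hK hF hF0 y t).sub hE).congr
      (Eventually.of_forall fun r => ?_)
    simp only [Pi.sub_apply]
    rw [← sub_mul, impulseResponse_eq hKeq y (t - r), add_sub_cancel_left]

end Wave

/-! ### The wave as a continuous curve in `L₂(ℝ)` -/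

/-- A jointly continuous function whose sections have locally uniformly bounded supports is a
continuous curve in `L₂(ℝ)`. -/
theorem exists_continuous_toLp {R : ℝ → ℝ → ℂ} (hR : Continuous fun z : ℝ × ℝ => R z.1 z.2)
    (hsupp : ∀ y t, t ≤ |y| → R y t = 0) :
    ∃ Q : ℝ → Lp ℂ 2 (volume : Measure ℝ), Continuous Q ∧ ∀ t, Q t =ᵐ[volume] fun y => R y t := by
  have hsec : ∀ t, Continuous fun y => R y t := fun t =>
    hR.comp (g := fun z : ℝ × ℝ => R z.1 z.2) (f := fun y => (y, t)) (by fun_prop)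
  have hmem : ∀ t, MemLp (fun y => R y t) 2 volume := fun t => by
    refine (hsec t).memLp_of_hasCompactSupport
      (HasCompactSupport.intro (isCompact_Icc (a := -t) (b := t)) fun y hy => hsupp y t ?_)
    by_contra hcon
    have := abs_lt.1 (not_le.1 hcon)
    exact hy ⟨this.1.le, this.2.le⟩
  refine ⟨fun t => (hmem t).toLp _, ?_, fun t => (hmem t).coeFn_toLp⟩
  refine continuous_iff_continuousAt.2 fun t₀ => ?_
  set a := |t₀| + 1 with ha
  have ha0 : 0 < a := by positivity
  let G : C(ℝ, C(Icc (-a) a, ℂ)) := ContinuousMap.curry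
    ⟨fun p : ℝ × Icc (-a) a => R p.2 p.1, hR.comp (g := fun z : ℝ × ℝ => R z.1 z.2)
      (f := fun p : ℝ × Icc (-a) a => ((p.2 : ℝ), p.1)) (by fun_prop)⟩
  refine (Lp.tendsto_Lp_iff_tendsto_eLpNorm'' _ hmem _ (hmem t₀)).2 ?_
  have hG : Tendsto (fun t => dist (G t) (G t₀)) (𝓝 t₀) (𝓝 0) := by
    have := (tendsto_iff_dist_tendsto_zero.1 (G.continuous.tendsto t₀))
    exact this
  set κ : ℝ≥0∞ := (volume.restrict (Icc (-a) a)) univ ^ (2 : ℝ≥0∞).toReal⁻¹ with hκ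
  have hκt : κ ≠ ∞ := ENNReal.rpow_ne_top_of_nonneg (by positivity) (measure_ne_top _ _)
  have hlim : Tendsto (fun t => κ * ENNReal.ofReal (dist (G t) (G t₀))) (𝓝 t₀) (𝓝 0) := by
    have := ENNReal.Tendsto.const_mul (ENNReal.tendsto_ofReal hG) (Or.inr hκt)
    simpa using this
  refine tendsto_of_tendsto_of_tendsto_of_le_of_le' tendsto_const_nhds hlim
    (Eventually.of_forall fun _ => zero_le) ?_
  have hnear : ∀ᶠ t in 𝓝 t₀, |t| < a :=
    (isOpen_lt continuous_abs continuous_const).mem_nhds (by simp [ha])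
  filter_upwards [hnear] with t ht
  have hres : eLpNorm ((fun y => R y t) - fun y => R y t₀) 2 volume =
      eLpNorm ((fun y => R y t) - fun y => R y t₀) 2 (volume.restrict (Icc (-a) a)) := by
    refine (eLpNorm_restrict_eq_of_support_subset fun y hy => ?_).symm
    by_contra hcon
    have hya : a ≤ |y| := by
      by_contra h
      have := abs_lt.1 (not_le.1 h)
      exact hcon ⟨this.1.le, this.2.le⟩
    refine hy ?_
    simp only [Pi.sub_apply]
    rw [hsupp y t ((le_abs_self t).trans (ht.le.trans hya)),
      hsupp y t₀ ((le_abs_self t₀).trans (by linarith)), sub_zero]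
  rw [hres]
  refine eLpNorm_le_of_ae_bound ?_
  filter_upwards [ae_restrict_mem measurableSet_Icc] with y hy
  have := ContinuousMap.dist_apply_le_dist (f := G t) (g := G t₀) ⟨y, hy⟩
  rwa [dist_eq_norm] at this

theorem exists_continuous_reflected_translate {F : ℝ → ℂ} (hF : MemLp F 2 volume) :
    ∃ Q : ℝ → Lp ℂ 2 (volume : Measure ℝ), Continuous Q ∧
      ∀ t, Q t =ᵐ[volume] fun y => F (t - y) := by
  have hmp : ∀ t : ℝ, MeasurePreserving (fun y => t - y) volume volume := fun t =>
    Measure.measurePreserving_sub_left volume t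
  let g : C(ℝ, C(ℝ, ℝ)) := ContinuousMap.curry ⟨fun p : ℝ × ℝ => p.1 - p.2, by fun_prop⟩
  refine ⟨fun t => Lp.compMeasurePreserving (g t) (hmp t) (hF.toLp F), ?_, fun t => ?_⟩
  · exact Continuous.compMeasurePreservingLp continuous_const g.continuous hmp (by norm_num)
  · refine (Lp.coeFn_compMeasurePreserving _ (hmp t)).trans ?_
    exact (hmp t).quasiMeasurePreserving.ae_eq_comp hF.coeFn_toLp

section Wave

variable {K : ℝ → ℝ → ℂ} {F : ℝ → ℂ} {T : ℝ}

/-- The wave is a continuous curve in `L₂(ℝ)`. -/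
theorem exists_wave_toLp (hK : Continuous fun z : ℝ × ℝ => K z.1 z.2)
    (hF : MemLp F 2 volume) (hF1 : Integrable F) (hF0 : ∀ r, r ∉ Ioo 0 T → F r = 0) :
    ∃ Q : ℝ → Lp ℂ 2 (volume : Measure ℝ), Continuous Q ∧
      ∀ t, Q t =ᵐ[volume] fun y => wave K F y t := by
  obtain ⟨Q₁, hQ₁, hQ₁'⟩ := exists_continuous_reflected_translate hF
  obtain ⟨Q₂, hQ₂, hQ₂'⟩ := exists_continuous_toLp
    (R := fun y t => ∫ r, impulseResponse K y (t - r) * F r)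
    (continuous_integral_impulseResponse hK hF1 hF0)
    (fun y t h => integral_impulseResponse_eq_zero hF0 h)
  obtain ⟨S, hS⟩ := exists_substitution_operator (μ := (volume : Measure ℝ))
    (ν := (volume : Measure ℝ)) (E := ℂ) (F := ℂ) (s := id) (C := 1) (c := 1)
    (M := (Ioi (0 : ℝ)).indicator fun _ => ContinuousLinearMap.id ℂ ℂ)
    (aestronglyMeasurable_const.indicator measurableSet_Ioi)
    (Eventually.of_forall fun x => by
      by_cases hx : x ∈ Ioi (0 : ℝ)
      · rw [indicator_of_mem hx]; exact ContinuousLinearMap.norm_id_le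
      · rw [indicator_of_notMem hx]; simp)
    measurable_id ENNReal.one_ne_top (by simp)
  refine ⟨fun t => S (Q₁ t) + Q₂ t, (S.continuous.comp hQ₁).add hQ₂, fun t => ?_⟩
  filter_upwards [Lp.coeFn_add (S (Q₁ t)) (Q₂ t), hS (Q₁ t), hQ₁' t, hQ₂' t] with y h1 h2 h3 h4
  rw [h1, Pi.add_apply, h2, h4, wave]
  congr 1
  by_cases hy : 0 < y
  · rw [indicator_of_mem (mem_Ioi.2 hy), if_pos hy]
    exact h3
  · rw [indicator_of_notMem (by simpa using hy), if_neg hy]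
    rfl

end Wave

/-! ### The weak form of the unfolded system -/

/-- Shearing preserves integrability on a strip. -/
theorem integrable_shear {m : Measure ℝ} [SFinite m] {H : ℝ × ℝ → ℂ} (hH : Measurable H)
    (hHi : Integrable H (m.prod volume)) {φ : ℝ → ℝ} (hφ : Measurable φ) :
    Integrable (fun z : ℝ × ℝ => H (z.1, z.2 + φ z.1)) (m.prod volume) := by
  have h := (integrable_prod_iff hHi.aestronglyMeasurable).1 hHi
  refine (integrable_prod_iff (hH.comp (by fun_prop)).aestronglyMeasurable).2 ⟨?_, ?_⟩
  · filter_upwards [h.1] with s hs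
    exact hs.comp_add_right (φ s)
  · refine h.2.congr (Eventually.of_forall fun s => ?_)
    exact (integral_add_right_eq_self (fun y => ‖H (s, y)‖) (φ s)).symm

section WeakForm

variable {K : ℝ → ℝ → ℂ} {F : ℝ → ℂ} {T : ℝ}

theorem measurable_wave (hK : Continuous fun z : ℝ × ℝ => K z.1 z.2)
    (hFm : Measurable F) (hF1 : Integrable F) (hF0 : ∀ r, r ∉ Ioo 0 T → F r = 0) :
    Measurable fun z : ℝ × ℝ => wave K F z.1 z.2 :=
  (Measurable.ite (measurableSet_lt measurable_const measurable_fst)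
    (hFm.comp (by fun_prop)) measurable_const).add
    (continuous_integral_impulseResponse hK hF1 hF0).measurable

theorem integrable_direct (hFm : Measurable F) (hF1 : Integrable F) :
    Integrable (fun z : ℝ × ℝ => if 0 < z.2 then F (z.1 - z.2) else 0)
      ((volume.restrict (Ioc 0 T)).prod volume) := by
  have h1 : Integrable (fun z : ℝ × ℝ => F (-z.2)) ((volume.restrict (Ioc 0 T)).prod volume) :=
    hF1.comp_neg.comp_snd _
  have h2 := integrable_shear (hFm.comp (by fun_prop)) h1 (φ := fun s => -s) (by fun_prop)
  refine h2.mono ?_ (Eventually.of_forall fun z => ?_)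
  · exact (Measurable.ite (measurableSet_lt measurable_const measurable_snd)
      (hFm.comp (by fun_prop)) measurable_const).aestronglyMeasurable
  · split_ifs
    · apply le_of_eq
      congr 2
      ring
    · simp

theorem integrable_wave (hK : Continuous fun z : ℝ × ℝ => K z.1 z.2)
    (hFm : Measurable F) (hF1 : Integrable F) (hF0 : ∀ r, r ∉ Ioo 0 T → F r = 0) :
    Integrable (fun z : ℝ × ℝ => wave K F z.2 z.1)
      ((volume.restrict (Ioc 0 T)).prod volume) := by
  refine (integrable_direct hFm hF1).add ?_
  obtain ⟨B, hB0, hB⟩ := exists_impulseResponse_bound hK T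
  have hc : Integrable (fun z : ℝ × ℝ => (Icc (-T) T).indicator (fun _ => B * ∫ r, ‖F r‖) z.2)
      ((volume.restrict (Ioc 0 T)).prod volume) :=
    Integrable.comp_snd
      ((integrable_indicator_iff measurableSet_Icc).2 (integrableOn_const (by simp))) _
  refine hc.mono' ?_ ?_
  · exact ((continuous_integral_impulseResponse hK hF1 hF0).comp
      (by fun_prop : Continuous fun z : ℝ × ℝ => (z.2, z.1))).aestronglyMeasurable
  · have h1 : ∀ᵐ z ∂((volume.restrict (Ioc 0 T)).prod (volume : Measure ℝ)), z.1 ∈ Ioc 0 T :=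
      Measure.quasiMeasurePreserving_fst.ae (ae_restrict_mem measurableSet_Ioc)
    filter_upwards [h1] with z hz
    by_cases hy : z.2 ∈ Icc (-T) T
    · rw [indicator_of_mem hy, ← integral_const_mul]
      refine norm_integral_le_of_norm_le (hF1.norm.const_mul B) (Eventually.of_forall fun r => ?_)
      rw [norm_mul]
      by_cases hr : r ∈ Ioo 0 T
      · exact mul_le_mul_of_nonneg_right (hB _ _ (by linarith [hz.2, hr.1])) (norm_nonneg _)
      · simp [hF0 r hr]
    · rw [indicator_of_notMem hy, integral_impulseResponse_eq_zero hF0, norm_zero]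
      by_contra hcon
      have := abs_lt.1 (not_le.1 hcon)
      exact hy ⟨by linarith [hz.2], by linarith [hz.2]⟩

/-- The wave solves `P_t + P_y = β(y) P(-y) + F(t) δ(y)` weakly. Of the test function `Θ` and its
derivative `DΘ` along the characteristics only the fundamental theorem of calculus along the
characteristics is used, which allows for a kink at `y = 0`. -/
theorem wave_weak {b c : ℝ → ℂ} {C : ℝ} (hb : Continuous b) (hc : Continuous c)
    (hbC : ∀ y, ‖b y‖ ≤ C) (hcC : ∀ y, ‖c y‖ ≤ C)
    (hK : Continuous fun z : ℝ × ℝ => K z.1 z.2)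
    (hKeq : ∀ ξ ζ, K ξ ζ = 1 / 2 * c (-ξ / 2) +
        1 / 2 * ∫ r in (0 : ℝ)..ζ, reflection b c ((r - ξ) / 2) * K r ξ)
    (hFm : Measurable F) (hF1 : Integrable F) (hF0 : ∀ r, r ∉ Ioo 0 T → F r = 0) (hT : 0 < T)
    {Θ DΘ : ℝ → ℝ → ℂ} (hΘm : Measurable fun z : ℝ × ℝ => Θ z.1 z.2)
    (hDm : Measurable fun z : ℝ × ℝ => DΘ z.1 z.2) {A : ℝ} (hΘA : ∀ y t, ‖Θ y t‖ ≤ A)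
    (hDA : ∀ y t, ‖DΘ y t‖ ≤ A)
    (hftc : ∀ z s, s ≤ T → ∫ t in s..T, DΘ (z + t) t = Θ (z + T) T - Θ (z + s) s)
    (hfin : ∀ y, Θ y T = 0) :
    (∫ t in (0 : ℝ)..T, ∫ y, (wave K F y t * DΘ y t +
      reflection b c y * wave K F (-y) t * Θ y t)) + ∫ t in (0 : ℝ)..T, F t * Θ 0 t = 0 := by
  set β := reflection b c with hβ
  have hβm : Measurable β := measurable_reflection hb hc
  have hβC : ∀ y, ‖β y‖ ≤ C := norm_reflection_le hbC hcC
  have hA0 : 0 ≤ A := (norm_nonneg _).trans (hΘA 0 0)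
  set m : Measure ℝ := volume.restrict (Ioc 0 T) with hm
  set P := wave K F with hP
  have hPm : Measurable fun z : ℝ × ℝ => P z.1 z.2 := measurable_wave hK hFm hF1 hF0
  have hPi : Integrable (fun z : ℝ × ℝ => P z.2 z.1) (m.prod volume) :=
    integrable_wave hK hFm hF1 hF0
  -- the reflected part of the wave as a source
  let h : ℝ × ℝ → ℂ := fun z => β z.2 * P (-z.2) z.1
  have hhm : Measurable h :=
    (hβm.comp measurable_snd).mul (hPm.comp (by fun_prop : Measurable fun z : ℝ × ℝ => (-z.2, z.1)))
  have hneg : Integrable (fun z : ℝ × ℝ => P (-z.2) z.1) (m.prod volume) := by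
    have e := (integrable_prod_iff hPi.aestronglyMeasurable).1 hPi
    refine (integrable_prod_iff (hPm.comp
      (by fun_prop : Measurable fun z : ℝ × ℝ => (-z.2, z.1))).aestronglyMeasurable).2 ⟨?_, ?_⟩
    · filter_upwards [e.1] with s hs
      exact hs.comp_neg
    · refine e.2.congr (Eventually.of_forall fun s => ?_)
      exact (integral_neg_eq_self (fun y => ‖P y s‖) volume).symm
  have hhi : Integrable h (m.prod volume) :=
    hneg.bdd_mul (c := C) (hβm.comp measurable_snd).aestronglyMeasurable
      (Eventually.of_forall fun z => hβC _)
  -- the direct signal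
  have hB : ∫ t, (∫ y, (if 0 < y then F (t - y) else 0) * DΘ y t) ∂m =
      -∫ t in (0 : ℝ)..T, F t * Θ 0 t := by
    have e1 : ∀ t, ∫ y, (if 0 < y then F (t - y) else 0) * DΘ y t =
        ∫ r, (if r < t then F r else 0) * DΘ (t - r) t := fun t => by
      rw [← integral_sub_left_eq_self _ volume t]
      refine integral_congr_ae (Eventually.of_forall fun r => ?_)
      simp [sub_pos]
    simp_rw [e1]
    have hpi : Integrable (fun z : ℝ × ℝ => (if z.2 < z.1 then F z.2 else 0) *
        DΘ (z.1 - z.2) z.1) (m.prod volume) := by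
      refine ((hF1.norm.comp_snd m).mul_const A).mono' ?_ (Eventually.of_forall fun z => ?_)
      · exact ((Measurable.ite (measurableSet_lt measurable_snd measurable_fst)
          (hFm.comp measurable_snd) measurable_const).mul (hDm.comp
          (by fun_prop : Measurable fun z : ℝ × ℝ => (z.1 - z.2, z.1)))).aestronglyMeasurable
      · rw [norm_mul]
        have := hDA (z.1 - z.2) z.1
        split_ifs
        · gcongr
        · simpa using mul_nonneg (norm_nonneg _) hA0
    rw [integral_integral_swap hpi, intervalIntegral.integral_of_le hT.le,
      integral_Ioc_eq_integral_Ioo, ← integral_indicator measurableSet_Ioo, ← integral_neg]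
    refine integral_congr_ae (Eventually.of_forall fun r => ?_)
    by_cases hr : r ∈ Ioo 0 T
    · simp only [indicator_of_mem hr]
      have e2 : ∫ t, (if r < t then F r else 0) * DΘ (t - r) t ∂m =
          ∫ t in r..T, F r * DΘ (-r + t) t := by
        rw [intervalIntegral.integral_of_le hr.2.le]
        have hsub : Ioc r T ⊆ Ioc 0 T := Ioc_subset_Ioc_left hr.1.le
        rw [setIntegral_eq_of_subset_of_forall_sdiff_eq_zero measurableSet_Ioc hsub]
        · refine setIntegral_congr_fun measurableSet_Ioc fun t ht => ?_
          simp only [if_pos ht.1]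
          rw [neg_add_eq_sub]
        · intro t ht
          have : ¬ r < t := fun hlt => ht.2 ⟨hlt, ht.1.2⟩
          rw [if_neg this, zero_mul]
      rw [e2, intervalIntegral.integral_const_mul, hftc (-r) r hr.2.le, hfin]
      simp
    · simp [hF0 r hr, indicator_of_notMem hr]
  -- the reflections
  have hR : ∫ t, (∫ y, (∫ s in (0 : ℝ)..t, β (y - t + s) * P (t - y - s) s) * DΘ y t) ∂m =
      -∫ t, (∫ y, β y * P (-y) t * Θ y t) ∂m := by
    have hΘh : Integrable (fun z : ℝ × ℝ => h z * Θ z.2 z.1) (m.prod volume) :=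
      hhi.mul_bdd (c := A) (hΘm.comp (by fun_prop : Measurable fun z : ℝ × ℝ =>
        (z.2, z.1))).aestronglyMeasurable (Eventually.of_forall fun z => hΘA _ _)
    have htri : Integrable (fun w : ℝ × (ℝ × ℝ) => (if w.2.1 < w.1 then h w.2 else 0) *
        DΘ (w.2.2 - w.2.1 + w.1) w.1) (m.prod (m.prod volume)) := by
      refine ((hhi.norm.comp_snd m).mul_const A).mono' ?_ (Eventually.of_forall fun w => ?_)
      · exact ((Measurable.ite (measurableSet_lt (by fun_prop) (by fun_prop))
          (hhm.comp measurable_snd) measurable_const).mul (hDm.comp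
          (by fun_prop : Measurable fun w : ℝ × (ℝ × ℝ) =>
            (w.2.2 - w.2.1 + w.1, w.1)))).aestronglyMeasurable
      · rw [norm_mul]
        have := hDA (w.2.2 - w.2.1 + w.1) w.1
        split_ifs
        · gcongr
        · simpa using mul_nonneg (norm_nonneg _) hA0
    have hstep : ∀ t ∈ Ioc 0 T,
        ∫ y, (∫ s in (0 : ℝ)..t, β (y - t + s) * P (t - y - s) s) * DΘ y t =
        ∫ w : ℝ × ℝ, (if w.1 < t then h w else 0) * DΘ (w.2 - w.1 + t) t ∂(m.prod volume) := by
      intro t ht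
      have hii : Integrable (fun z : ℝ × ℝ => (if z.1 < t then h (z.1, z.2 + (z.1 - t)) else 0) *
          DΘ z.2 t) (m.prod volume) := by
        have h1 := integrable_shear hhm hhi (φ := fun s => s - t) (by fun_prop)
        refine (h1.norm.mul_const A).mono' ?_ (Eventually.of_forall fun z => ?_)
        · exact ((Measurable.ite (measurableSet_lt measurable_fst measurable_const)
            (hhm.comp (by fun_prop)) measurable_const).mul (hDm.comp
            (by fun_prop : Measurable fun z : ℝ × ℝ => (z.2, t)))).aestronglyMeasurable
        · rw [norm_mul]
          have := hDA z.2 t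
          split_ifs
          · gcongr
          · simpa using mul_nonneg (norm_nonneg _) hA0
      have hin : ∀ y, (∫ s in (0 : ℝ)..t, β (y - t + s) * P (t - y - s) s) * DΘ y t =
          ∫ s, (if s < t then h (s, y + (s - t)) else 0) * DΘ y t ∂m := by
        intro y
        rw [integral_mul_const, intervalIntegral.integral_of_le ht.1.le,
          integral_Ioc_eq_integral_Ioo]
        congr 1
        have hsub : Ioo 0 t ⊆ Ioc 0 T := fun s hs => ⟨hs.1, hs.2.le.trans ht.2⟩
        rw [hm, setIntegral_eq_of_subset_of_forall_sdiff_eq_zero measurableSet_Ioc hsub]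
        · refine setIntegral_congr_fun measurableSet_Ioo fun s hs => ?_
          simp only [if_pos hs.2, h]
          congr 2 <;> ring
        · intro s hs
          have : ¬ s < t := fun hlt => hs.2 ⟨hs.1.1, hlt⟩
          rw [if_neg this]
      simp_rw [hin]
      rw [← integral_integral_swap (f := fun s y => (if s < t then h (s, y + (s - t)) else 0) *
          DΘ y t) hii]
      have hjj : Integrable (fun w : ℝ × ℝ => (if w.1 < t then h w else 0) *
          DΘ (w.2 - w.1 + t) t) (m.prod volume) := by
        refine (hhi.norm.mul_const A).mono' ?_ (Eventually.of_forall fun w => ?_)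
        · exact ((Measurable.ite (measurableSet_lt measurable_fst measurable_const)
            hhm measurable_const).mul (hDm.comp
            (by fun_prop : Measurable fun w : ℝ × ℝ => (w.2 - w.1 + t, t)))).aestronglyMeasurable
        · rw [norm_mul]
          have := hDA (w.2 - w.1 + t) t
          split_ifs
          · gcongr
          · simpa using mul_nonneg (norm_nonneg _) hA0
      rw [integral_prod _ hjj]
      refine integral_congr_ae (Eventually.of_forall fun s => ?_)
      simp only
      rw [← integral_add_right_eq_self
        (fun y => (if s < t then h (s, y) else 0) * DΘ (y - s + t) t) (s - t)]
      refine integral_congr_ae (Eventually.of_forall fun y => ?_)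
      simp only
      congr 2
      ring
    have e1 : ∫ t, (∫ y, (∫ s in (0 : ℝ)..t, β (y - t + s) * P (t - y - s) s) * DΘ y t) ∂m =
        ∫ t, (∫ w : ℝ × ℝ, (if w.1 < t then h w else 0) * DΘ (w.2 - w.1 + t) t
          ∂(m.prod volume)) ∂m :=
      setIntegral_congr_fun measurableSet_Ioc hstep
    rw [e1, integral_integral_swap (f := fun t (w : ℝ × ℝ) => (if w.1 < t then h w else 0) *
      DΘ (w.2 - w.1 + t) t) htri]
    have e3 : ∫ t, (∫ y, β y * P (-y) t * Θ y t) ∂m =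
        ∫ w : ℝ × ℝ, h w * Θ w.2 w.1 ∂(m.prod volume) := (integral_prod _ hΘh).symm
    rw [e3, ← integral_neg]
    refine integral_congr_ae ?_
    have h1 : ∀ᵐ z ∂(m.prod (volume : Measure ℝ)), z.1 ∈ Ioc 0 T :=
      Measure.quasiMeasurePreserving_fst.ae (ae_restrict_mem measurableSet_Ioc)
    filter_upwards [h1] with w hw
    have e2 : ∫ t, (if w.1 < t then h w else 0) * DΘ (w.2 - w.1 + t) t ∂m =
        ∫ t in w.1..T, h w * DΘ (w.2 - w.1 + t) t := by
      rw [intervalIntegral.integral_of_le hw.2]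
      have hsub : Ioc w.1 T ⊆ Ioc 0 T := Ioc_subset_Ioc_left hw.1.le
      rw [setIntegral_eq_of_subset_of_forall_sdiff_eq_zero measurableSet_Ioc hsub]
      · refine setIntegral_congr_fun measurableSet_Ioc fun t ht => ?_
        simp only [if_pos ht.1]
      · intro t ht
        have : ¬ w.1 < t := fun hlt => ht.2 ⟨hlt, ht.1.2⟩
        rw [if_neg this, zero_mul]
    rw [e2, intervalIntegral.integral_const_mul, hftc _ _ hw.2, hfin]
    simp
  -- summation
  have hi1 : Integrable (fun z : ℝ × ℝ => P z.2 z.1 * DΘ z.2 z.1) (m.prod volume) :=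
    hPi.mul_bdd (c := A) (hDm.comp (by fun_prop : Measurable fun z : ℝ × ℝ =>
      (z.2, z.1))).aestronglyMeasurable (Eventually.of_forall fun z => hDA _ _)
  have hi2 : Integrable (fun z : ℝ × ℝ => β z.2 * P (-z.2) z.1 * Θ z.2 z.1) (m.prod volume) :=
    hhi.mul_bdd (c := A) (hΘm.comp (by fun_prop : Measurable fun z : ℝ × ℝ =>
      (z.2, z.1))).aestronglyMeasurable (Eventually.of_forall fun z => hΘA _ _)
  have hi3 : Integrable (fun z : ℝ × ℝ => (if 0 < z.2 then F (z.1 - z.2) else 0) * DΘ z.2 z.1)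
      (m.prod volume) :=
    (integrable_direct hFm hF1).mul_bdd (c := A) (hDm.comp (by fun_prop : Measurable fun z : ℝ × ℝ =>
      (z.2, z.1))).aestronglyMeasurable (Eventually.of_forall fun z => hDA _ _)
  have hi4 : Integrable (fun z : ℝ × ℝ =>
      (∫ s in (0 : ℝ)..z.1, β (z.2 - z.1 + s) * P (z.1 - z.2 - s) s) * DΘ z.2 z.1)
      (m.prod volume) := by
    refine (hi1.sub hi3).congr ?_
    have h1 : ∀ᵐ z ∂(m.prod (volume : Measure ℝ)), z.1 ∈ Ioc 0 T :=
      Measure.quasiMeasurePreserving_fst.ae (ae_restrict_mem measurableSet_Ioc)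
    filter_upwards [h1] with z hz
    simp only [Pi.sub_apply]
    rw [hP, wave_eq hb hc hbC hcC hK hKeq hF1 hF0 z.2 hz.1.le, ← sub_mul, add_sub_cancel_left]
  rw [intervalIntegral.integral_of_le hT.le]
  have hs1 : ∫ t, (∫ y, (P y t * DΘ y t + β y * P (-y) t * Θ y t)) ∂m =
      (∫ t, (∫ y, P y t * DΘ y t) ∂m) + ∫ t, (∫ y, β y * P (-y) t * Θ y t) ∂m := by
    rw [← integral_integral_add hi1 hi2]
  have hs2 : ∫ t, (∫ y, P y t * DΘ y t) ∂m =
      (∫ t, (∫ y, (if 0 < y then F (t - y) else 0) * DΘ y t) ∂m) +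
      ∫ t, (∫ y, (∫ s in (0 : ℝ)..t, β (y - t + s) * P (t - y - s) s) * DΘ y t) ∂m := by
    rw [← integral_integral_add hi3 hi4]
    refine setIntegral_congr_fun measurableSet_Ioc fun t ht => ?_
    refine integral_congr_ae (Eventually.of_forall fun y => ?_)
    simp only
    rw [← add_mul, hP, wave_eq hb hc hbC hcC hK hKeq hF1 hF0 y ht.1.le]
  rw [hs1, hs2, hB, hR]
  ring

end WeakForm

/-! ### Uniqueness for the unfolded system -/

/-- A function whose weak derivative on `[0, T]` is `G` and which vanishes weakly at `0` is the
integral of `G`. The test functions do not vanish at `0`. -/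
theorem eq_integral_of_weak_derivative {F G : ℝ → ℂ} {T : ℝ} (hT : 0 < T) (hF : Continuous F)
    (hG : Continuous G)
    (h : ∀ χ : ℝ → ℂ, ContDiff ℝ 1 χ → HasCompactSupport χ → χ T = 0 →
      ∫ t in (0 : ℝ)..T, (deriv χ t * F t + χ t * G t) = 0) :
    ∀ t ∈ Icc 0 T, F t = ∫ s in (0 : ℝ)..t, G s := by
  set Γ : ℝ → ℂ := fun t => ∫ s in (0 : ℝ)..t, G s with hΓ
  have hΓd : ∀ t, HasDerivAt Γ (G t) t := fun t => hG.integral_hasStrictDerivAt 0 t |>.hasDerivAt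
  have hΓc : Continuous Γ := continuous_iff_continuousAt.2 fun t => (hΓd t).continuousAt
  set H : ℝ → ℂ := fun t => F t - Γ t with hH
  have hHc : Continuous H := hF.sub hΓc
  set Hc : ℝ → ℂ := fun t => (starRingEnd ℂ) (H t) with hHcdef
  have hHcc : Continuous Hc := Complex.continuous_conj.comp hHc
  -- the test function is a primitive of the conjugate of the function that has to vanish
  set Λ : ℝ → ℂ := fun t => ∫ s in T..t, Hc s with hΛ
  have hΛd : ∀ t, HasDerivAt Λ (Hc t) t := fun t =>
    hHcc.integral_hasStrictDerivAt T t |>.hasDerivAt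
  have hΛ1 : ContDiff ℝ 1 Λ := by
    refine contDiff_one_iff_deriv.2 ⟨fun t => (hΛd t).differentiableAt, ?_⟩
    have : deriv Λ = Hc := funext fun t => (hΛd t).deriv
    rw [this]
    exact hHcc
  let f : ContDiffBump (0 : ℝ) := ⟨T + 1, T + 2, by linarith, by linarith⟩
  set χ : ℝ → ℂ := fun t => f t • Λ t with hχ
  have hnear : ∀ t ∈ Icc 0 T, χ =ᶠ[𝓝 t] Λ := fun t ht => by
    have : t ∈ Metric.ball (0 : ℝ) f.rIn := by
      rw [Metric.mem_ball, dist_zero_right, Real.norm_eq_abs, abs_of_nonneg ht.1]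
      change t < T + 1
      linarith [ht.2]
    filter_upwards [f.eventuallyEq_one_of_mem_ball this] with s hs
    simp [hχ, hs]
  have h0 := h χ (f.contDiff.smul hΛ1) (f.hasCompactSupport.smul_right)
    (by rw [(hnear T ⟨hT.le, le_rfl⟩).eq_of_nhds]; simp [hΛ])
  have h1 : ∫ t in (0 : ℝ)..T, (deriv χ t * F t + χ t * G t) =
      ∫ t in (0 : ℝ)..T, (Hc t * F t + Λ t * G t) := by
    refine intervalIntegral.integral_congr fun t ht => ?_
    rw [uIcc_of_le hT.le] at ht
    rw [(hnear t ht).deriv_eq, (hΛd t).deriv, (hnear t ht).eq_of_nhds]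
  have h2 : ∫ t in (0 : ℝ)..T, Λ t * G t = - ∫ t in (0 : ℝ)..T, Hc t * Γ t := by
    rw [intervalIntegral.integral_mul_deriv_eq_deriv_mul (fun t _ => hΛd t) (fun t _ => hΓd t)
      (hHcc.intervalIntegrable _ _) (hG.intervalIntegrable _ _)]
    simp [hΛ, hΓ]
  have hΛc : Continuous Λ := hΛ1.continuous
  have h3 : ∫ t in (0 : ℝ)..T, Hc t * H t = 0 := by
    have i1 : IntervalIntegrable (fun t => Hc t * F t) volume 0 T :=
      (hHcc.mul hF).intervalIntegrable _ _
    have i2 : IntervalIntegrable (fun t => Λ t * G t) volume 0 T :=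
      (hΛc.mul hG).intervalIntegrable _ _
    have i3 : IntervalIntegrable (fun t => Hc t * Γ t) volume 0 T :=
      (hHcc.mul hΓc).intervalIntegrable _ _
    rw [h1, intervalIntegral.integral_add i1 i2, h2, ← sub_eq_add_neg,
      ← intervalIntegral.integral_sub i1 i3] at h0
    rw [← h0]
    refine intervalIntegral.integral_congr fun t _ => ?_
    simp only [hH]
    ring
  have h4 : ∫ t in (0 : ℝ)..T, ‖H t‖ ^ 2 = 0 := by
    have h5 : ∀ t, Hc t * H t = ((‖H t‖ ^ 2 : ℝ) : ℂ) := fun t => by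
      rw [hHcdef, mul_comm, Complex.mul_conj, Complex.normSq_eq_norm_sq]
    simp_rw [h5] at h3
    rw [intervalIntegral.integral_ofReal] at h3
    exact_mod_cast h3
  rw [intervalIntegral.integral_of_le hT.le, ← integral_Icc_eq_integral_Ioc] at h4
  have h5 := (integral_eq_zero_iff_of_nonneg (fun t => by positivity)
    (Continuous.integrableOn_Icc (by fun_prop))).1 h4
  have h6 := Measure.eqOn_Icc_of_ae_eq volume hT.ne h5 (by fun_prop) continuousOn_const
  intro t ht
  have h7 := h6 ht
  simp only [Pi.zero_apply, ne_eq, OfNat.ofNat_ne_zero, not_false_eq_true, pow_eq_zero_iff,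
    norm_eq_zero] at h7
  exact sub_eq_zero.1 h7

/-- The pairing of a square integrable function with a fixed real one. -/
theorem exists_pairing {θ : ℝ → ℝ} (hθ : MemLp θ 2 volume) :
    ∃ S : Lp ℂ 2 (volume : Measure ℝ) →L[ℂ] ℂ, ∀ u, S u = ∫ y, u y * (θ y : ℂ) := by
  have hθ' : MemLp (fun y => (θ y : ℂ)) 2 volume := hθ.ofReal
  refine ⟨innerSL ℂ hθ'.toLp, fun u => ?_⟩
  rw [innerSL_apply_apply, L2.inner_def]
  refine integral_congr_ae ?_
  filter_upwards [hθ'.coeFn_toLp] with y hy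
  rw [hy, RCLike.inner_apply]
  simp

theorem continuousOn_translate {T : ℝ} {P : ℝ → Lp ℂ 2 (volume : Measure ℝ)}
    (hP : ContinuousOn P (Icc 0 T)) :
    ∃ Q : ℝ → Lp ℂ 2 (volume : Measure ℝ), ContinuousOn Q (Icc 0 T) ∧
      ∀ t, Q t =ᵐ[volume] fun y => P t (y + t) := by
  have hmp : ∀ t : ℝ, MeasurePreserving (fun y => y + t) volume volume := fun t =>
    measurePreserving_add_right volume t
  let g : C(ℝ, C(ℝ, ℝ)) := ContinuousMap.curry ⟨fun p : ℝ × ℝ => p.2 + p.1, by fun_prop⟩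
  exact ⟨fun t => Lp.compMeasurePreserving (g t) (hmp t) (P t),
    hP.compMeasurePreservingLp g.continuous.continuousOn hmp (by norm_num),
    fun t => Lp.coeFn_compMeasurePreserving _ (hmp t)⟩

theorem integral_translate {q u : ℝ → ℂ} {t : ℝ} (hq : q =ᵐ[volume] fun y => u (y + t))
    (θ : ℝ → ℝ) : ∫ y, q y * (θ y : ℂ) = ∫ y, u y * (θ (y - t) : ℂ) := by
  rw [← integral_add_right_eq_self (fun y => u y * (θ (y - t) : ℂ)) t]
  refine integral_congr_ae ?_
  filter_upwards [hq] with y hy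
  rw [hy, add_sub_cancel_right]

/-- Two square integrable curves with the same weak form of `P_t + P_y = β(y) P(-y)`, tested with
functions that are transported along the characteristics, coincide. In the moving frame
`P(z + t, t)` the equation is an ordinary differential equation in `L₂`, local in the dependence
intervals `-L < z < L - 2 t`, so that Grönwall's argument applies. -/
theorem unfolded_unique {b c : ℝ → ℂ} {T : ℝ} (hb : Continuous b) (hc : Continuous c) (hT : 0 < T)
    {P₁ P₂ : ℝ → Lp ℂ 2 (volume : Measure ℝ)} (hP₁ : ContinuousOn P₁ (Icc 0 T))
    (hP₂ : ContinuousOn P₂ (Icc 0 T))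
    (h : ∀ (χ : ℝ → ℂ) (θ : ℝ → ℝ), ContDiff ℝ 1 χ → HasCompactSupport χ → χ T = 0 →
      ContDiff ℝ 1 θ → HasCompactSupport θ →
      ∫ t in (0 : ℝ)..T, (deriv χ t * (∫ y, P₁ t y * (θ (y - t) : ℂ)) +
        χ t * ∫ y, reflection b c y * P₁ t (-y) * (θ (y - t) : ℂ)) =
      ∫ t in (0 : ℝ)..T, (deriv χ t * (∫ y, P₂ t y * (θ (y - t) : ℂ)) +
        χ t * ∫ y, reflection b c y * P₂ t (-y) * (θ (y - t) : ℂ))) :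
    EqOn P₁ P₂ (Icc 0 T) := by
  set β := reflection b c with hβ
  have hβm : Measurable β := measurable_reflection hb hc
  -- it suffices to show that the difference vanishes on the dependence intervals
  suffices hloc : ∀ L : ℕ, ∀ t ∈ Icc 0 T, ∀ᵐ z : ℝ, z ∈ Ioo (-(L : ℝ)) (L - 2 * t) →
      P₁ t (z + t) = P₂ t (z + t) by
    intro t ht
    refine Lp.ext ?_
    have h1 := ae_all_iff.2 fun L => hloc L t ht
    have h2 : ∀ᵐ z : ℝ, P₁ t (z + t) = P₂ t (z + t) := by
      filter_upwards [h1] with z hz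
      obtain ⟨L, hL⟩ := exists_nat_gt (|z| + 2 * |t|)
      refine hz L ⟨?_, ?_⟩
      · linarith [neg_abs_le z, abs_nonneg t]
      · linarith [le_abs_self z, le_abs_self t]
    have h3 := (measurePreserving_sub_right volume t).quasiMeasurePreserving.ae h2
    filter_upwards [h3] with y hy
    simpa using hy
  intro L
  obtain ⟨C, hC⟩ : ∃ C, ∀ y ∈ Icc (-(L + T)) (L + T), ‖β y‖ ≤ C := by
    obtain ⟨C₁, h₁⟩ := (isCompact_Icc (a := -(L + T)) (b := L + T)).exists_bound_of_continuousOn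
      hb.continuousOn
    obtain ⟨C₂, h₂⟩ := (isCompact_Icc (a := -(L + T)) (b := L + T)).exists_bound_of_continuousOn
      hc.continuousOn
    refine ⟨max C₁ C₂, fun y hy => ?_⟩
    rw [hβ, reflection]
    split_ifs
    · exact (h₁ y hy).trans (le_max_left _ _)
    · exact (h₂ y hy).trans (le_max_right _ _)
  have hC0 : 0 ≤ C := (norm_nonneg _).trans
    (hC 0 ⟨by have : (0 : ℝ) ≤ L := L.cast_nonneg; linarith, by positivity⟩)
  obtain ⟨B, hB⟩ := exists_substitution_operator (μ := (volume : Measure ℝ))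
    (ν := (volume : Measure ℝ)) (E := ℂ) (F := ℂ) (s := fun y => -y) (C := C) (c := 1)
    (M := (Icc (-(L + T)) (L + T)).indicator fun y => β y • ContinuousLinearMap.id ℂ ℂ)
    ((hβm.aestronglyMeasurable.smul_const _).indicator measurableSet_Icc)
    (Eventually.of_forall fun y => by
      by_cases hy : y ∈ Icc (-(L + T)) (L + T)
      · rw [indicator_of_mem hy, norm_smul, ContinuousLinearMap.norm_id, mul_one]
        exact hC y hy
      · rw [indicator_of_notMem hy]; simpa using hC0)
    measurable_neg ENNReal.one_ne_top
    (by rw [(Measure.measurePreserving_neg volume).map_eq, one_smul])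
  have hB' : ∀ u : Lp ℂ 2 (volume : Measure ℝ), ∀ᵐ y, y ∈ Icc (-(L + T)) (L + T) →
      B u y = β y * u (-y) := fun u => by
    filter_upwards [hB u] with y hy hyL
    rw [hy, indicator_of_mem hyL]
    rfl
  obtain ⟨Q₁, hQc₁, hQ₁⟩ := continuousOn_translate hP₁
  obtain ⟨Q₂, hQc₂, hQ₂⟩ := continuousOn_translate hP₂
  obtain ⟨g₁, hgc₁, hg₁⟩ := continuousOn_translate (B.continuous.comp_continuousOn hP₁)
  obtain ⟨g₂, hgc₂, hg₂⟩ := continuousOn_translate (B.continuous.comp_continuousOn hP₂)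
  set Q : ℝ → Lp ℂ 2 (volume : Measure ℝ) := fun t => Q₁ t - Q₂ t with hQdef
  set g : ℝ → Lp ℂ 2 (volume : Measure ℝ) := fun t => g₁ t - g₂ t with hgdef
  have hQc : ContinuousOn Q (Icc 0 T) := hQc₁.sub hQc₂
  have hgc : ContinuousOn g (Icc 0 T) := hgc₁.sub hgc₂
  have hii : ∀ t ∈ Icc 0 T, IntervalIntegrable g volume 0 t := fun t ht =>
    ContinuousOn.intervalIntegrable (by
      rw [uIcc_of_le ht.1]
      exact hgc.mono (Icc_subset_Icc_right ht.2))
  -- the equation in the moving frame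
  have hmild : ∀ t ∈ Icc 0 T, ∀ᵐ z : ℝ, z ∈ Ioo (-(L : ℝ)) L →
      Q t z = (∫ s in (0 : ℝ)..t, g s) z := by
    intro t ht
    have hli : LocallyIntegrableOn (fun z => (Q t - ∫ s in (0 : ℝ)..t, g s : Lp ℂ 2 volume) z)
        (Ioo (-(L : ℝ)) L) volume :=
      ((Lp.memLp _).locallyIntegrable (by norm_num)).locallyIntegrableOn _
    have hz := isOpen_Ioo.ae_eq_zero_of_integral_contDiff_smul_eq_zero hli
      (fun θ hθ hθc hθL => ?_)
    · filter_upwards [hz, Lp.coeFn_sub (Q t) (∫ s in (0 : ℝ)..t, g s)] with z h1 h2 hzL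
      have := h1 hzL
      rw [h2, Pi.sub_apply] at this
      exact sub_eq_zero.1 this
    have hθ1 : ContDiff ℝ 1 θ := hθ.of_le (by exact_mod_cast le_top)
    obtain ⟨S, hS⟩ := exists_pairing (hθ1.continuous.memLp_of_hasCompactSupport (p := 2)
      (μ := volume) hθc)
    have hSg : ∀ (u q : Lp ℂ 2 (volume : Measure ℝ)), ∀ t ∈ Icc 0 T,
        (q =ᵐ[volume] fun y => B u (y + t)) →
        S q = ∫ y, β y * u (-y) * (θ (y - t) : ℂ) := fun u q t ht hq => by
      rw [hS, integral_translate hq]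
      refine integral_congr_ae ?_
      filter_upwards [hB' u] with y hy
      by_cases hyt : θ (y - t) = 0
      · simp [hyt]
      · have h1 := hθL (subset_tsupport _ hyt)
        rw [hy ⟨by linarith [h1.1, ht.1, hT], by linarith [h1.2, ht.2]⟩]
    have hSQc : ∀ {P : ℝ → Lp ℂ 2 (volume : Measure ℝ)}, ContinuousOn P (Icc 0 T) →
        ContinuousOn (fun t => S (P t)) (Icc 0 T) := fun hP => S.continuous.comp_continuousOn hP
    have hweak : ∀ χ : ℝ → ℂ, ContDiff ℝ 1 χ → HasCompactSupport χ → χ T = 0 →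
        ∫ t in (0 : ℝ)..T, (deriv χ t * S (Q t) + χ t * S (g t)) = 0 := by
      intro χ hχ hχc hχT
      have e := h χ θ hχ hχc hχT hθ1 hθc
      have e1 : ∀ (P q r : ℝ → Lp ℂ 2 (volume : Measure ℝ)),
          (∀ t, q t =ᵐ[volume] fun y => P t (y + t)) →
          (∀ t, r t =ᵐ[volume] fun y => B (P t) (y + t)) →
          ∫ t in (0 : ℝ)..T, (deriv χ t * (∫ y, P t y * (θ (y - t) : ℂ)) +
            χ t * ∫ y, β y * P t (-y) * (θ (y - t) : ℂ)) =
          ∫ t in (0 : ℝ)..T, (deriv χ t * S (q t) + χ t * S (r t)) := by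
        intro P q r hq hr
        refine intervalIntegral.integral_congr fun t ht => ?_
        rw [uIcc_of_le hT.le] at ht
        rw [hSg (P t) (r t) t ht (hr t), hS, integral_translate (hq t)]
      have e2 : ∀ (q r : ℝ → Lp ℂ 2 (volume : Measure ℝ)), ContinuousOn q (Icc 0 T) →
          ContinuousOn r (Icc 0 T) →
          IntervalIntegrable (fun t => deriv χ t * S (q t) + χ t * S (r t)) volume 0 T := by
        intro q r hq hr
        refine ContinuousOn.intervalIntegrable ?_
        rw [uIcc_of_le hT.le]
        exact ((hχ.continuous_deriv le_rfl).continuousOn.mul (hSQc hq)).add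
          (hχ.continuous.continuousOn.mul (hSQc hr))
      rw [e1 P₁ Q₁ g₁ hQ₁ hg₁, e1 P₂ Q₂ g₂ hQ₂ hg₂, ← sub_eq_zero,
        ← intervalIntegral.integral_sub (e2 _ _ hQc₁ hgc₁) (e2 _ _ hQc₂ hgc₂)] at e
      rw [← e]
      refine intervalIntegral.integral_congr fun t _ => ?_
      simp only [hQdef, hgdef, map_sub]
      ring
    have hext : ∀ {P : ℝ → ℂ} {t : ℝ}, t ∈ Icc 0 T →
        IccExtend hT.le ((Icc 0 T).domRestrict P) t = P t := fun ht => by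
      rw [IccExtend_of_mem _ _ ht, domRestrict_apply]
    have hkey := eq_integral_of_weak_derivative hT
      (F := IccExtend hT.le ((Icc 0 T).domRestrict fun t => S (Q t)))
      (G := IccExtend hT.le ((Icc 0 T).domRestrict fun t => S (g t)))
      (hSQc hQc).domRestrict.Icc_extend' (hSQc hgc).domRestrict.Icc_extend' (fun χ hχ hχc hχT => by
        rw [← hweak χ hχ hχc hχT]
        refine intervalIntegral.integral_congr fun t ht => ?_
        rw [uIcc_of_le hT.le] at ht
        rw [hext ht, hext ht]) t ht
    rw [hext ht] at hkey
    have hkey2 : S (Q t) = S (∫ s in (0 : ℝ)..t, g s) := by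
      rw [hkey, ← S.intervalIntegral_comp_comm (hii t ht)]
      refine intervalIntegral.integral_congr fun s hs => ?_
      rw [uIcc_of_le ht.1] at hs
      exact hext ⟨hs.1, hs.2.trans ht.2⟩
    have hfin : S (Q t - ∫ s in (0 : ℝ)..t, g s) = 0 := by rw [map_sub, hkey2, sub_self]
    rw [hS] at hfin
    rw [← hfin]
    refine integral_congr_ae (Eventually.of_forall fun z => ?_)
    simp only [Complex.real_smul]
    ring
  -- restriction to the dependence intervals
  have hR : ∀ t : ℝ, ∃ R : Lp ℂ 2 (volume : Measure ℝ) →L[ℂ] Lp ℂ 2 (volume : Measure ℝ),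
      ∀ u, R u =ᵐ[volume] (Ioo (-(L : ℝ)) (L - 2 * t)).indicator u := fun t => by
    obtain ⟨R, hR⟩ := exists_substitution_operator (μ := (volume : Measure ℝ))
      (ν := (volume : Measure ℝ)) (E := ℂ) (F := ℂ) (s := id) (C := 1) (c := 1)
      (M := (Ioo (-(L : ℝ)) (L - 2 * t)).indicator fun _ => ContinuousLinearMap.id ℂ ℂ)
      (aestronglyMeasurable_const.indicator measurableSet_Ioo)
      (Eventually.of_forall fun x => by
        by_cases hx : x ∈ Ioo (-(L : ℝ)) (L - 2 * t)
        · rw [indicator_of_mem hx]; exact ContinuousLinearMap.norm_id_le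
        · rw [indicator_of_notMem hx]; simp)
      measurable_id ENNReal.one_ne_top (by simp)
    refine ⟨R, fun u => (hR u).trans (Eventually.of_forall fun x => ?_)⟩
    by_cases hx : x ∈ Ioo (-(L : ℝ)) (L - 2 * t)
    · simp only [indicator_of_mem hx]; rfl
    · simp only [indicator_of_notMem hx]; rfl
  choose R hR using hR
  have hstep : ∀ s ∈ Icc 0 T, ∀ t, s ≤ t → ‖R t (g s)‖ ≤ C * ‖R s (Q s)‖ := by
    intro s hs t hst
    have hmp : MeasurePreserving (fun z : ℝ => -2 * s - z) volume volume :=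
      Measure.measurePreserving_sub_left volume (-2 * s)
    have hnorm : ‖R s (Q s)‖ = ‖Lp.compMeasurePreserving _ hmp (R s (Q s))‖ :=
      (Lp.norm_compMeasurePreserving _ hmp).symm
    rw [hnorm]
    refine Lp.norm_le_mul_norm_of_ae_le_mul ?_
    have hshift : ∀ {p : ℝ → Prop}, (∀ᵐ y, p y) → ∀ᵐ z : ℝ, p (z + s) := fun hp =>
      (measurePreserving_add_right volume s).quasiMeasurePreserving.ae hp
    have hrefl : ∀ {p : ℝ → Prop}, (∀ᵐ y, p y) → ∀ᵐ z : ℝ, p (-2 * s - z) := fun hp =>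
      hmp.quasiMeasurePreserving.ae hp
    filter_upwards [hR t (g s), Lp.coeFn_sub (g₁ s) (g₂ s), hg₁ s, hg₂ s, hshift (hB' (P₁ s)),
      hshift (hB' (P₂ s)), Lp.coeFn_compMeasurePreserving (R s (Q s)) hmp, hrefl (hR s (Q s)),
      hrefl (Lp.coeFn_sub (Q₁ s) (Q₂ s)), hrefl (hQ₁ s), hrefl (hQ₂ s)]
      with z h1 h2 h3 h4 h5 h6 h7 h8 h9 h10 h11
    rw [h1, h7, Function.comp_apply, h8]
    by_cases hz : z ∈ Ioo (-(L : ℝ)) (L - 2 * t)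
    · have hz' : -2 * s - z ∈ Ioo (-(L : ℝ)) (L - 2 * s) :=
        ⟨by linarith [hz.2], by linarith [hz.1]⟩
      have hzL : z + s ∈ Icc (-(L + T)) (L + T) :=
        ⟨by linarith [hz.1, hs.1], by linarith [hz.2, hs.1, hs.2]⟩
      rw [indicator_of_mem hz, indicator_of_mem hz', hgdef, hQdef]
      simp only
      rw [h2, h9, Pi.sub_apply, Pi.sub_apply, h3, h4, h10, h11, Function.comp_apply,
        Function.comp_apply, h5 hzL, h6 hzL, ← mul_sub, norm_mul]
      have e : -2 * s - z + s = -(z + s) := by ring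
      rw [e]
      exact mul_le_mul_of_nonneg_right (hC _ hzL) (norm_nonneg _)
    · rw [indicator_of_notMem hz, norm_zero]
      positivity
  have hRQ : ∀ t ∈ Icc 0 T, R t (Q t) = ∫ s in (0 : ℝ)..t, R t (g s) := by
    intro t ht
    rw [(R t).intervalIntegral_comp_comm (hii t ht)]
    refine Lp.ext ?_
    filter_upwards [hR t (Q t), hR t (∫ s in (0 : ℝ)..t, g s), hmild t ht] with z h1 h2 h3
    rw [h1, h2]
    by_cases hz : z ∈ Ioo (-(L : ℝ)) (L - 2 * t)
    · rw [indicator_of_mem hz, indicator_of_mem hz, h3 ⟨hz.1, by linarith [hz.2, ht.1]⟩]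
    · rw [indicator_of_notMem hz, indicator_of_notMem hz]
  obtain ⟨M, hM⟩ := isCompact_Icc.exists_bound_of_continuousOn hQc
  have hM0 : 0 ≤ M := (norm_nonneg _).trans (hM 0 ⟨le_rfl, hT.le⟩)
  have hiter : ∀ n : ℕ, ∀ t ∈ Icc 0 T, ‖R t (Q t)‖ ≤ M * (C * t) ^ n / n.factorial := by
    intro n
    induction n with
    | zero =>
      intro t ht
      simp only [pow_zero, mul_one, Nat.factorial_zero, Nat.cast_one, div_one]
      refine le_trans ?_ (hM t ht)
      refine Lp.norm_le_norm_of_ae_le ?_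
      filter_upwards [hR t (Q t)] with z hz
      rw [hz]
      exact norm_indicator_le_norm_self _ _
    | succ n ih =>
      intro t ht
      rw [hRQ t ht]
      have hb : ‖∫ s in (0 : ℝ)..t, R t (g s)‖ ≤
          ∫ s in (0 : ℝ)..t, C * (M * (C * s) ^ n / n.factorial) := by
        refine intervalIntegral.norm_integral_le_of_norm_le ht.1 ?_
          (Continuous.intervalIntegrable (by fun_prop) _ _)
        refine Eventually.of_forall fun s hs => ?_
        have hsT : s ∈ Icc 0 T := ⟨hs.1.le, hs.2.trans ht.2⟩
        exact (hstep s hsT t hs.2).trans (mul_le_mul_of_nonneg_left (ih s hsT) hC0)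
      refine hb.trans (le_of_eq ?_)
      have e : ∀ s : ℝ, C * (M * (C * s) ^ n / n.factorial) =
          (M * C ^ (n + 1) / n.factorial) * s ^ n := fun s => by
        rw [mul_pow]
        ring
      simp_rw [e]
      rw [intervalIntegral.integral_const_mul, integral_pow, Nat.factorial_succ]
      push_cast
      field_simp
      ring
  intro t ht
  have hzero : R t (Q t) = 0 := by
    have hlim := (FloorSemiring.tendsto_pow_div_factorial_atTop (C * t)).const_mul M
    rw [mul_zero] at hlim
    refine norm_le_zero_iff.1 (ge_of_tendsto' hlim fun n => ?_)
    rw [← mul_div_assoc]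
    exact hiter n t ht
  have h0 := hR t (Q t)
  rw [hzero] at h0
  filter_upwards [h0, Lp.coeFn_zero ℂ 2 (volume : Measure ℝ), Lp.coeFn_sub (Q₁ t) (Q₂ t), hQ₁ t,
    hQ₂ t] with z h1 h2 h3 h4 h5 hz
  rw [indicator_of_mem hz, h2, hQdef] at h1
  simp only at h1
  rw [h3, Pi.sub_apply, h4, h5, Pi.zero_apply] at h1
  exact (sub_eq_zero.1 h1.symm)

/-! ### The medium and the travel time -/

/-- A substitution with derivative bounded below maps Lebesgue measure to a measure dominated by
a multiple of Lebesgue measure. -/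
theorem map_restrict_le_of_deriv {f f' : ℝ → ℝ} {s t : Set ℝ} {m : ℝ} (hs : MeasurableSet s)
    (hfm : Measurable f) (hf : ∀ x ∈ s, HasDerivAt f (f' x) x) (hinj : InjOn f s) (hm : 0 < m)
    (hle : ∀ x ∈ s, m ≤ |f' x|) (hst : MapsTo f s t) :
    (volume.restrict s).map f ≤ (ENNReal.ofReal m)⁻¹ • volume.restrict t := by
  refine Measure.le_iff.2 fun E hE => ?_
  rw [Measure.map_apply hfm hE, Measure.restrict_apply (hfm hE), Measure.smul_apply,
    Measure.restrict_apply hE, smul_eq_mul]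
  set A := f ⁻¹' E ∩ s with hA
  have hAm : MeasurableSet A := (hfm hE).inter hs
  have h1 := lintegral_image_eq_lintegral_abs_deriv_mul hAm
    (fun x hx => (hf x hx.2).hasDerivWithinAt) (hinj.mono inter_subset_right) (fun _ => 1)
  simp only [mul_one, lintegral_const, Measure.restrict_apply, MeasurableSet.univ, univ_inter,
    one_mul] at h1
  have h2 : ENNReal.ofReal m * volume A ≤ volume (f '' A) := by
    rw [h1, ← setLIntegral_const]
    refine setLIntegral_mono' hAm fun x hx => ENNReal.ofReal_le_ofReal (hle x hx.2)
  have h3 : volume (f '' A) ≤ volume (E ∩ t) := by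
    refine measure_mono ?_
    rintro _ ⟨x, hx, rfl⟩
    exact ⟨hx.1, hst hx.2⟩
  have hm0 : ENNReal.ofReal m ≠ 0 := by simpa using hm
  calc volume A = (ENNReal.ofReal m)⁻¹ * (ENNReal.ofReal m * volume A) := by
        rw [← mul_assoc, ENNReal.inv_mul_cancel hm0 ENNReal.ofReal_ne_top, one_mul]
    _ ≤ _ := mul_le_mul_right (h2.trans h3) _

/-- The coefficients of the system on the whole line. The matrix `D` is `ρ diag(e^{-2v}, e^{2v})`,
so that `ρ = √(d₁ d₂)` is the slowness of the waves and `v = log (d₂ / d₁) / 4` describes their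
polarization. Only the values on `[0, ∞)` are prescribed by the problem; the extension to the line
provides changes of variables and test functions on the whole plane. -/
structure Medium where
  /-- the slowness -/
  ρ : ℝ → ℝ
  /-- the logarithm of the ratio of the components -/
  v : ℝ → ℝ
  /-- the potential -/
  ψ : ℝ → ℝ
  /-- a positive lower bound of the slowness -/
  m : ℝ
  /-- an upper bound of the ratio -/
  N : ℝ
  m_pos : 0 < m
  continuous_ρ : Continuous ρ
  m_le : ∀ x, m ≤ ρ x
  ρ_le : ∀ x, ρ x ≤ 1
  contDiff_v : ContDiff ℝ 1 v
  abs_v_le : ∀ x, 0 ≤ x → |v x| ≤ N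
  continuous_ψ : Continuous ψ

namespace Medium

variable (M : Medium)

theorem ρ_pos (x : ℝ) : 0 < M.ρ x := M.m_pos.trans_le (M.m_le x)

/-- The travel time from `0` to `x`. -/
def τ (x : ℝ) : ℝ := ∫ s in (0 : ℝ)..x, M.ρ s

theorem hasDerivAt_τ (x : ℝ) : HasDerivAt M.τ (M.ρ x) x :=
  (M.continuous_ρ.integral_hasStrictDerivAt 0 x).hasDerivAt

theorem τ_zero : M.τ 0 = 0 := by simp [τ]

theorem contDiff_τ : ContDiff ℝ 1 M.τ := by
  refine contDiff_one_iff_deriv.2 ⟨fun x => (M.hasDerivAt_τ x).differentiableAt, ?_⟩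
  rw [funext fun x => (M.hasDerivAt_τ x).deriv]
  exact M.continuous_ρ

theorem continuous_τ : Continuous M.τ := M.contDiff_τ.continuous

theorem strictMono_τ : StrictMono M.τ :=
  strictMono_of_deriv_pos fun x => by rw [(M.hasDerivAt_τ x).deriv]; exact M.ρ_pos x

theorem le_τ_sub {x y : ℝ} (h : x ≤ y) : M.m * (y - x) ≤ M.τ y - M.τ x := by
  rw [τ, τ, intervalIntegral.integral_interval_sub_left (M.continuous_ρ.intervalIntegrable _ _)
    (M.continuous_ρ.intervalIntegrable _ _)]
  have := intervalIntegral.integral_mono_on h (intervalIntegrable_const (c := M.m) (μ := volume))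
    (M.continuous_ρ.intervalIntegrable _ _) fun s _ => M.m_le s
  rwa [intervalIntegral.integral_const, smul_eq_mul, mul_comm] at this

theorem surjective_τ : Function.Surjective M.τ := by
  refine M.continuous_τ.surjective ?_ ?_
  · refine tendsto_atTop_mono' atTop ?_ (tendsto_id.const_mul_atTop M.m_pos)
    filter_upwards [eventually_ge_atTop 0] with x hx
    simpa [M.τ_zero] using M.le_τ_sub hx
  · refine tendsto_atBot_mono' atBot ?_ (tendsto_id.const_mul_atBot M.m_pos)
    filter_upwards [eventually_le_atBot 0] with x hx
    have := M.le_τ_sub hx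
    rw [M.τ_zero] at this
    simp only [id]
    linarith

/-- The travel time as an order isomorphism of the line. -/
def travelIso : ℝ ≃o ℝ := M.strictMono_τ.orderIsoOfSurjective M.τ M.surjective_τ

/-- The point that is reached at the time `y`: the inverse function of the travel time. -/
def X (y : ℝ) : ℝ := M.travelIso.symm y

theorem X_τ (x : ℝ) : M.X (M.τ x) = x := M.travelIso.symm_apply_apply x

theorem τ_X (y : ℝ) : M.τ (M.X y) = y := M.travelIso.apply_symm_apply y

theorem X_zero : M.X 0 = 0 := by simpa [M.τ_zero] using M.X_τ 0

theorem strictMono_X : StrictMono M.X := M.travelIso.symm.strictMono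

theorem continuous_X : Continuous M.X := M.travelIso.symm.continuous

theorem X_pos {y : ℝ} (h : 0 < y) : 0 < M.X y := by
  have := M.strictMono_X h
  rwa [X_zero] at this

theorem τ_pos {x : ℝ} (h : 0 < x) : 0 < M.τ x := by
  have := M.strictMono_τ h
  rwa [τ_zero] at this

theorem hasDerivAt_X (y : ℝ) : HasDerivAt M.X (M.ρ (M.X y))⁻¹ y :=
  HasDerivAt.of_local_left_inverse M.continuous_X.continuousAt (M.hasDerivAt_τ _)
    (M.ρ_pos _).ne' (Eventually.of_forall M.τ_X)

theorem contDiff_X : ContDiff ℝ 1 M.X := by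
  refine contDiff_one_iff_deriv.2 ⟨fun x => (M.hasDerivAt_X x).differentiableAt, ?_⟩
  rw [funext fun x => (M.hasDerivAt_X x).deriv]
  exact (M.continuous_ρ.comp M.continuous_X).inv₀ fun x => (M.ρ_pos _).ne'

/-- The homeomorphism of the `(x, t)` plane given by the travel time. -/
def planeHomeo : ℝ × ℝ ≃ₜ ℝ × ℝ := M.travelIso.toHomeomorph.prodCongr (Homeomorph.refl ℝ)

/-- The phase of the waves accumulated from `0` to `x`. -/
def γ (x : ℝ) : ℝ := ∫ s in (0 : ℝ)..x, M.ψ s * Real.cosh (2 * M.v s)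

theorem continuous_v : Continuous M.v := M.contDiff_v.continuous

theorem hasDerivAt_γ (x : ℝ) : HasDerivAt M.γ (M.ψ x * Real.cosh (2 * M.v x)) x := by
  have h : Continuous fun s => M.ψ s * Real.cosh (2 * M.v s) := by
    have := M.continuous_ψ
    have := M.continuous_v
    fun_prop
  exact (h.integral_hasStrictDerivAt 0 x).hasDerivAt

theorem γ_zero : M.γ 0 = 0 := by simp [γ]

theorem contDiff_γ : ContDiff ℝ 1 M.γ := by
  refine contDiff_one_iff_deriv.2 ⟨fun x => (M.hasDerivAt_γ x).differentiableAt, ?_⟩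
  rw [funext fun x => (M.hasDerivAt_γ x).deriv]
  have := M.continuous_ψ
  have := M.continuous_v
  fun_prop

/-- The phase factor `e^{-iσγ}`. -/
def g (σ x : ℝ) : ℂ := Complex.exp (-(σ * M.γ x : ℝ) * Complex.I)

theorem norm_g (σ x : ℝ) : ‖M.g σ x‖ = 1 := by
  rw [g, ← Complex.ofReal_neg, Complex.norm_exp_ofReal_mul_I]

theorem g_mul_g_neg (σ x : ℝ) : M.g σ x * M.g (-σ) x = 1 := by
  rw [g, g, ← Complex.exp_add]
  simp

theorem g_zero (σ : ℝ) : M.g σ 0 = 1 := by simp [g, γ_zero]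

theorem contDiff_g (σ : ℝ) : ContDiff ℝ 1 (M.g σ) := by
  have h1 : ContDiff ℝ 1 fun x => ((σ * M.γ x : ℝ) : ℂ) :=
    Complex.ofRealCLM.contDiff.comp (contDiff_const.mul M.contDiff_γ)
  exact (h1.neg.mul contDiff_const).cexp

theorem hasDerivAt_g (σ x : ℝ) : HasDerivAt (M.g σ)
    (-(σ * (M.ψ x * Real.cosh (2 * M.v x)) : ℝ) * Complex.I * M.g σ x) x := by
  have h1 : HasDerivAt (fun x => ((σ * M.γ x : ℝ) : ℂ))
      ((σ * (M.ψ x * Real.cosh (2 * M.v x)) : ℝ) : ℂ) x :=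
    ((M.hasDerivAt_γ x).const_mul σ).ofReal_comp
  have h2 := (h1.neg.mul_const Complex.I).cexp
  rw [mul_comm]
  exact h2

theorem continuous_g (σ : ℝ) : Continuous (M.g σ) := (M.contDiff_g σ).continuous

/-- The factor `e^v` of the polarization. -/
def u (x : ℝ) : ℂ := (Real.exp (M.v x) : ℝ)

/-- The factor `e^{-v}` of the polarization. -/
def ui (x : ℝ) : ℂ := (Real.exp (-M.v x) : ℝ)

theorem u_mul_ui (x : ℝ) : M.u x * M.ui x = 1 := by
  rw [u, ui, ← Complex.ofReal_mul, ← Real.exp_add]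
  simp

theorem contDiff_u : ContDiff ℝ 1 M.u :=
  Complex.ofRealCLM.contDiff.comp M.contDiff_v.exp

theorem contDiff_ui : ContDiff ℝ 1 M.ui :=
  Complex.ofRealCLM.contDiff.comp M.contDiff_v.neg.exp

theorem continuous_u : Continuous M.u := M.contDiff_u.continuous

theorem continuous_ui : Continuous M.ui := M.contDiff_ui.continuous

/-- The derivative of `v`. -/
def dv (x : ℝ) : ℝ := deriv M.v x

theorem continuous_dv : Continuous M.dv := M.contDiff_v.continuous_deriv le_rfl

theorem hasDerivAt_v (x : ℝ) : HasDerivAt M.v (M.dv x) x :=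
  (M.contDiff_v.differentiable one_ne_zero x).hasDerivAt

theorem hasDerivAt_u (x : ℝ) : HasDerivAt M.u ((M.dv x : ℂ) * M.u x) x := by
  have := (M.hasDerivAt_v x).exp.ofReal_comp
  rw [mul_comm, Complex.ofReal_mul] at this
  exact this

theorem hasDerivAt_ui (x : ℝ) : HasDerivAt M.ui (-(M.dv x : ℂ) * M.ui x) x := by
  have := (M.hasDerivAt_v x).neg.exp.ofReal_comp
  rw [mul_comm, Complex.ofReal_mul, Complex.ofReal_neg] at this
  exact this

theorem norm_u_le {x : ℝ} (hx : 0 ≤ x) : ‖M.u x‖ ≤ Real.exp M.N := by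
  rw [u, Complex.norm_real, Real.norm_eq_abs, Real.abs_exp, Real.exp_le_exp]
  exact (le_abs_self _).trans (M.abs_v_le x hx)

theorem norm_ui_le {x : ℝ} (hx : 0 ≤ x) : ‖M.ui x‖ ≤ Real.exp M.N := by
  rw [ui, Complex.norm_real, Real.norm_eq_abs, Real.abs_exp, Real.exp_le_exp]
  exact (neg_le_abs _).trans (M.abs_v_le x hx)

theorem cosh_eq (x : ℝ) : ((Real.cosh (2 * M.v x) : ℝ) : ℂ) = (M.u x ^ 2 + M.ui x ^ 2) / 2 := by
  rw [u, ui, Real.cosh_eq, ← Complex.ofReal_pow, ← Complex.ofReal_pow, ← Real.exp_nat_mul,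
    ← Real.exp_nat_mul]
  push_cast
  ring_nf

theorem sinh_eq (x : ℝ) : ((Real.sinh (2 * M.v x) : ℝ) : ℂ) = (M.u x ^ 2 - M.ui x ^ 2) / 2 := by
  rw [u, ui, Real.sinh_eq, ← Complex.ofReal_pow, ← Complex.ofReal_pow, ← Real.exp_nat_mul,
    ← Real.exp_nat_mul]
  push_cast
  ring_nf

/-- The rate, per unit of travel time, at which waves travelling to the left are reflected to the
right. The squared phase factor stems from the different phases of the two waves. -/
def toRight (σ y : ℝ) : ℂ :=
  ((M.dv (M.X y) : ℂ) - Complex.I * σ * M.ψ (M.X y) * (Real.sinh (2 * M.v (M.X y)) : ℝ)) /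
    M.ρ (M.X y) * M.g σ (M.X y) ^ 2

/-- The rate at which waves travelling to the right are reflected to the left. It is a
function on the left half-line, which carries the waves travelling to the left after the
unfolding. -/
def toLeft (σ y : ℝ) : ℂ :=
  -((M.dv (M.X (-y)) : ℂ) +
    Complex.I * σ * M.ψ (M.X (-y)) * (Real.sinh (2 * M.v (M.X (-y))) : ℝ)) /
    M.ρ (M.X (-y)) * M.g (-σ) (M.X (-y)) ^ 2

theorem continuous_toRight (σ : ℝ) : Continuous (M.toRight σ) := by
  have h1 := M.continuous_X
  have h2 := M.continuous_dv
  have h3 := M.continuous_g σ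
  have h4 := M.continuous_ψ
  have h5 := M.continuous_v
  have h6 := M.continuous_ρ
  have h7 : ∀ x, (M.ρ x : ℂ) ≠ 0 := fun y => by exact_mod_cast (M.ρ_pos _).ne'
  unfold toRight
  fun_prop (disch := intro; exact h7 _)

theorem continuous_toLeft (σ : ℝ) : Continuous (M.toLeft σ) := by
  have h1 := M.continuous_X
  have h2 := M.continuous_dv
  have h3 := M.continuous_g (-σ)
  have h4 := M.continuous_ψ
  have h5 := M.continuous_v
  have h6 := M.continuous_ρ
  have h7 : ∀ x, (M.ρ x : ℂ) ≠ 0 := fun y => by exact_mod_cast (M.ρ_pos _).ne'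
  unfold toLeft
  fun_prop (disch := intro; exact h7 _)

end Medium

/-! ### Folding and unfolding of states -/

/-- The inclusion of the `i`-th coordinate axis of `ℂ²`. -/
def axis (i : Fin 2) : ℂ →L[ℂ] C2 :=
  (ContinuousLinearMap.id ℂ ℂ).smulRight (EuclideanSpace.single i 1)

theorem axis_zero_apply (z : ℂ) : axis 0 z 0 = z ∧ axis 0 z 1 = 0 := by
  simp [axis]

theorem axis_one_apply (z : ℂ) : axis 1 z 0 = 0 ∧ axis 1 z 1 = z := by
  simp [axis]

namespace Medium

variable (M : Medium)

/-- The first component of the state on the half-line that unfolds to `P`. The wave travelling to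
the right is `P` on the positive half-line, the wave travelling to the left is `-P(-y)`; the
minus sign makes `P` continuous at `0` where the first component vanishes. -/
def foldFst (σ : ℝ) (P : ℝ → ℂ) (x : ℝ) : ℂ :=
  1 / 2 * M.u x * (M.g (-σ) x * P (M.τ x) - M.g σ x * P (-M.τ x))

/-- The second component of the state on the half-line that unfolds to `P`. -/
def foldSnd (σ : ℝ) (P : ℝ → ℂ) (x : ℝ) : ℂ :=
  1 / 2 * Complex.I * σ * M.ui x * (M.g (-σ) x * P (M.τ x) + M.g σ x * P (-M.τ x))

theorem map_τ_le : (volume.restrict (Ioi 0)).map M.τ ≤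
    (ENNReal.ofReal M.m)⁻¹ • (volume : Measure ℝ) := by
  have := map_restrict_le_of_deriv (t := univ) measurableSet_Ioi M.continuous_τ.measurable
    (fun x _ => M.hasDerivAt_τ x) (M.strictMono_τ.injective.injOn (s := Ioi 0)) M.m_pos
    (fun x _ => (M.m_le x).trans (le_abs_self _)) (mapsTo_univ _ _)
  rwa [Measure.restrict_univ] at this

theorem map_neg_τ_le : (volume.restrict (Ioi 0)).map (fun x => -M.τ x) ≤
    (ENNReal.ofReal M.m)⁻¹ • (volume : Measure ℝ) := by
  have := map_restrict_le_of_deriv (t := univ) measurableSet_Ioi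
    (M.continuous_τ.neg.measurable)
    (fun x _ => (M.hasDerivAt_τ x).neg)
    ((neg_injective.comp M.strictMono_τ.injective).injOn (s := Ioi 0)) M.m_pos
    (fun x _ => by rw [abs_neg]; exact (M.m_le x).trans (le_abs_self _)) (mapsTo_univ _ _)
  rwa [Measure.restrict_univ] at this

theorem inv_ofReal_m_ne_top : (ENNReal.ofReal M.m)⁻¹ ≠ ∞ := by
  simpa using M.m_pos

theorem quasiMeasurePreserving_τ :
    Measure.QuasiMeasurePreserving M.τ (volume.restrict (Ioi 0)) volume :=
  ⟨M.continuous_τ.measurable, Measure.absolutelyContinuous_of_le_smul M.map_τ_le⟩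

theorem quasiMeasurePreserving_neg_τ :
    Measure.QuasiMeasurePreserving (fun x => -M.τ x) (volume.restrict (Ioi 0)) volume :=
  ⟨M.continuous_τ.neg.measurable, Measure.absolutelyContinuous_of_le_smul M.map_neg_τ_le⟩

/-- The map `y ↦ x(|y|)` covers the half-line twice, and its derivative is at least one in
modulus. -/
theorem map_X_abs_le : (volume : Measure ℝ).map (fun y => M.X |y|) ≤
    (2 : ℝ≥0∞) • volume.restrict (Ioi 0) := by
  have hXabs : Measurable fun y => M.X |y| := (M.continuous_X.comp continuous_abs).measurable
  have hXn : Measurable fun y => M.X (-y) := (M.continuous_X.comp continuous_neg).measurable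
  have hinv : ∀ x, 1 ≤ (M.ρ (M.X x))⁻¹ := fun x => (one_le_inv₀ (M.ρ_pos _)).2 (M.ρ_le _)
  have h1 := map_restrict_le_of_deriv (t := Ioi 0) measurableSet_Ioi M.continuous_X.measurable
    (fun x _ => M.hasDerivAt_X x) (M.strictMono_X.injective.injOn (s := Ioi 0)) one_pos
    (fun x _ => (hinv x).trans (le_abs_self _)) (fun x hx => M.X_pos hx)
  have h2 := map_restrict_le_of_deriv (f := fun y => M.X (-y)) (t := Ioi 0) measurableSet_Iio
    hXn
    (fun x _ => (M.hasDerivAt_X (-x)).comp x (hasDerivAt_neg x))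
    ((M.strictMono_X.injective.comp neg_injective).injOn (s := Iio 0)) one_pos
    (fun x _ => by rw [mul_neg_one, abs_neg]; exact (hinv _).trans (le_abs_self _))
    (fun x hx => M.X_pos (neg_pos.2 hx))
  rw [ENNReal.ofReal_one, inv_one, one_smul] at h1 h2
  refine Measure.le_iff.2 fun E hE => ?_
  have hE1 := Measure.le_iff.1 h1 E hE
  have hE2 := Measure.le_iff.1 h2 E hE
  rw [Measure.map_apply M.continuous_X.measurable hE,
    Measure.restrict_apply (M.continuous_X.measurable hE)] at hE1
  rw [Measure.map_apply hXn hE, Measure.restrict_apply (hXn hE)] at hE2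
  rw [Measure.map_apply hXabs hE, Measure.smul_apply, smul_eq_mul, two_mul]
  have hsub : (fun y => M.X |y|) ⁻¹' E ⊆
      (M.X ⁻¹' E ∩ Ioi 0) ∪ ((fun y => M.X (-y)) ⁻¹' E ∩ Iio 0) ∪ {0} := by
    intro y hy
    rcases lt_trichotomy y 0 with h | h | h
    · refine Or.inl (Or.inr ⟨?_, h⟩)
      simpa [abs_of_neg h] using hy
    · exact Or.inr h
    · refine Or.inl (Or.inl ⟨?_, h⟩)
      simpa [abs_of_pos h] using hy
  calc volume ((fun y => M.X |y|) ⁻¹' E)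
      ≤ volume ((M.X ⁻¹' E ∩ Ioi 0) ∪ ((fun y => M.X (-y)) ⁻¹' E ∩ Iio 0)) +
        volume ({0} : Set ℝ) := (measure_mono hsub).trans (measure_union_le _ _)
    _ ≤ _ := by
      rw [Real.volume_singleton, add_zero]
      exact (measure_union_le _ _).trans (add_le_add hE1 hE2)

/-- Folding as a bounded operator. -/
theorem exists_fold (σ : ℝ) : ∃ S : Lp ℂ 2 (volume : Measure ℝ) →L[ℂ] L2on (Ioi 0),
    ∀ P, ∀ᵐ x ∂(volume.restrict (Ioi (0 : ℝ))),
      S P x 0 = M.foldFst σ P x ∧ S P x 1 = M.foldSnd σ P x := by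
  have hb : ∀ (s : ℝ) (c₁ c₂ : ℂ), ∀ᵐ x ∂(volume.restrict (Ioi (0 : ℝ))),
      ‖(c₁ * M.u x * M.g s x) • axis 0 + (c₂ * M.ui x * M.g s x) • axis 1‖ ≤
      ‖c₁‖ * Real.exp M.N * ‖axis 0‖ + ‖c₂‖ * Real.exp M.N * ‖axis 1‖ := by
    intro s c₁ c₂
    filter_upwards [ae_restrict_mem measurableSet_Ioi] with x hx
    refine (norm_add_le _ _).trans ?_
    rw [norm_smul, norm_smul, norm_mul, norm_mul, norm_mul, norm_mul, M.norm_g, mul_one, mul_one]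
    have h1 := M.norm_u_le (le_of_lt hx)
    have h2 := M.norm_ui_le (le_of_lt hx)
    gcongr
  have hc : ∀ (s : ℝ) (c₁ c₂ : ℂ), AEStronglyMeasurable (fun x =>
      (c₁ * M.u x * M.g s x) • axis 0 + (c₂ * M.ui x * M.g s x) • axis 1)
      (volume.restrict (Ioi 0)) := by
    intro s c₁ c₂
    have h1 := M.continuous_u
    have h2 := M.continuous_ui
    have h3 := M.continuous_g s
    exact Continuous.aestronglyMeasurable (by fun_prop)
  obtain ⟨S₁, hS₁⟩ := exists_substitution_operator (hc (-σ) (1 / 2) (1 / 2 * Complex.I * σ))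
    (hb (-σ) (1 / 2) (1 / 2 * Complex.I * σ)) M.continuous_τ.measurable M.inv_ofReal_m_ne_top
    M.map_τ_le
  obtain ⟨S₂, hS₂⟩ := exists_substitution_operator (hc σ (-(1 / 2)) (1 / 2 * Complex.I * σ))
    (hb σ (-(1 / 2)) (1 / 2 * Complex.I * σ)) M.continuous_τ.neg.measurable
    M.inv_ofReal_m_ne_top M.map_neg_τ_le
  refine ⟨S₁ + S₂, fun P => ?_⟩
  filter_upwards [Lp.coeFn_add (S₁ P) (S₂ P), hS₁ P, hS₂ P] with x h1 h2 h3
  rw [add_apply, h1, Pi.add_apply, h2, h3, Pi.neg_apply]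
  simp only [add_apply, smul_apply, PiLp.add_apply,
    PiLp.smul_apply, smul_eq_mul, axis_zero_apply, axis_one_apply, foldFst, foldSnd]
  constructor <;> ring

/-- Unfolding as a bounded operator. It solves the two equations `Medium.foldFst` and
`Medium.foldSnd` for `P(τ)` and `P(-τ)`. -/
theorem exists_unfold (σ : ℝ) : ∃ S : L2on (Ioi 0) →L[ℂ] Lp ℂ 2 (volume : Measure ℝ),
    ∀ V, ∀ᵐ y, S V y = if 0 < y then
        M.g σ (M.X y) * (M.ui (M.X y) * V (M.X y) 0 - Complex.I * σ * M.u (M.X y) * V (M.X y) 1)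
      else -M.g (-σ) (M.X (-y)) *
        (M.ui (M.X (-y)) * V (M.X (-y)) 0 + Complex.I * σ * M.u (M.X (-y)) * V (M.X (-y)) 1) := by
  let w : ℝ → C2 →L[ℂ] ℂ := fun x =>
    (M.g σ x * M.ui x) • EuclideanSpace.proj 0 -
      (M.g σ x * (Complex.I * σ * M.u x)) • EuclideanSpace.proj 1
  let w' : ℝ → C2 →L[ℂ] ℂ := fun x =>
    -((M.g (-σ) x * M.ui x) • EuclideanSpace.proj 0 +
      (M.g (-σ) x * (Complex.I * σ * M.u x)) • EuclideanSpace.proj 1)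
  have h1 := M.continuous_u
  have h2 := M.continuous_ui
  have h3 := M.continuous_g σ
  have h4 := M.continuous_g (-σ)
  have hX := M.continuous_X
  have hwc : Continuous w := by simp only [w]; fun_prop
  have hwc' : Continuous w' := by simp only [w']; fun_prop
  set B : ℝ := Real.exp M.N * ‖(EuclideanSpace.proj 0 : C2 →L[ℂ] ℂ)‖ +
    ‖Complex.I * σ‖ * Real.exp M.N * ‖(EuclideanSpace.proj 1 : C2 →L[ℂ] ℂ)‖ with hB
  have hwb : ∀ x, 0 ≤ x → ‖w x‖ ≤ B := by
    intro x hx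
    refine (norm_sub_le _ _).trans ?_
    rw [norm_smul, norm_smul, norm_mul, norm_mul, norm_mul, M.norm_g, one_mul, one_mul]
    have := M.norm_u_le hx
    have := M.norm_ui_le hx
    rw [hB]
    gcongr
  have hwb' : ∀ x, 0 ≤ x → ‖w' x‖ ≤ B := by
    intro x hx
    simp only [w']
    rw [norm_neg]
    refine (norm_add_le _ _).trans ?_
    rw [norm_smul, norm_smul, norm_mul, norm_mul, norm_mul, M.norm_g, one_mul, one_mul]
    have := M.norm_u_le hx
    have := M.norm_ui_le hx
    rw [hB]
    gcongr
  have hXnn : ∀ y, 0 ≤ y → 0 ≤ M.X y := fun y hy => by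
    have := M.strictMono_X.monotone hy
    rwa [X_zero] at this
  obtain ⟨S, hS⟩ := exists_substitution_operator (μ := (volume : Measure ℝ))
    (ν := volume.restrict (Ioi 0)) (s := fun y => M.X |y|) (C := B) (c := 2)
    (M := fun y => if 0 < y then w (M.X y) else w' (M.X (-y)))
    (StronglyMeasurable.ite measurableSet_Ioi (hwc.comp hX).stronglyMeasurable
      (hwc'.comp (hX.comp continuous_neg)).stronglyMeasurable).aestronglyMeasurable
    (Eventually.of_forall fun y => by
      split_ifs with hy
      · exact hwb _ (hXnn _ hy.le)
      · exact hwb' _ (hXnn _ (by linarith)))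
    (hX.comp continuous_abs).measurable (by norm_num) M.map_X_abs_le
  refine ⟨S, fun V => ?_⟩
  filter_upwards [hS V] with y hy
  rw [hy]
  split_ifs with h
  · rw [abs_of_pos h]
    simp only [w, sub_apply, smul_apply,
      PiLp.proj_apply, smul_eq_mul]
    ring
  · rw [abs_of_nonpos (not_lt.1 h)]
    simp only [w', neg_apply, add_apply,
      smul_apply, PiLp.proj_apply, smul_eq_mul]
    ring

/-- Folding is a left inverse of unfolding. -/
theorem fold_unfold {σ : ℝ} (hσ : σ * σ = 1)
    {S : Lp ℂ 2 (volume : Measure ℝ) →L[ℂ] L2on (Ioi 0)}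
    (hS : ∀ P, ∀ᵐ x ∂(volume.restrict (Ioi (0 : ℝ))),
      S P x 0 = M.foldFst σ P x ∧ S P x 1 = M.foldSnd σ P x)
    {U : L2on (Ioi 0) →L[ℂ] Lp ℂ 2 (volume : Measure ℝ)}
    (hU : ∀ V, ∀ᵐ y, U V y = if 0 < y then
        M.g σ (M.X y) * (M.ui (M.X y) * V (M.X y) 0 - Complex.I * σ * M.u (M.X y) * V (M.X y) 1)
      else -M.g (-σ) (M.X (-y)) *
        (M.ui (M.X (-y)) * V (M.X (-y)) 0 + Complex.I * σ * M.u (M.X (-y)) * V (M.X (-y)) 1))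
    (V : L2on (Ioi 0)) : S (U V) = V := by
  refine Lp.ext ?_
  filter_upwards [hS (U V), M.quasiMeasurePreserving_τ.ae (hU V),
    M.quasiMeasurePreserving_neg_τ.ae (hU V), ae_restrict_mem measurableSet_Ioi]
    with x h1 h2 h3 hx
  have hx' := M.τ_pos hx
  rw [if_pos hx', X_τ] at h2
  rw [if_neg (by linarith), neg_neg, X_τ] at h3
  have e1 := M.g_mul_g_neg σ x
  have e2 := M.u_mul_ui x
  have e3 : (σ : ℂ) * σ = 1 := by exact_mod_cast hσ
  have e4 := Complex.I_mul_I
  ext i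
  fin_cases i
  · refine h1.1.trans ?_
    rw [foldFst, h2, h3]
    change _ = V x 0
    linear_combination (M.u x * M.ui x * V x 0) * e1 + V x 0 * e2
  · refine h1.2.trans ?_
    rw [foldSnd, h2, h3]
    change _ = V x 1
    linear_combination (-(Complex.I * Complex.I) * (σ * σ) * M.u x * M.ui x * V x 1) * e1 -
      (Complex.I * Complex.I) * (σ * σ) * V x 1 * e2 - (σ * σ) * V x 1 * e4 + V x 1 * e3

end Medium

/-! ### The weak formulation on the unfolded line -/

/-- Pairs of test functions for the waves travelling to the right and to the left, as functions
of the travel time and of the time. The boundary condition makes the unfolded test function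
`lineTest a b` continuous; it corresponds to the vanishing of the first component of the test
function on the half-line. -/
structure IsLineTest (T : ℝ) (a b : ℝ → ℝ → ℂ) : Prop where
  contDiff_fst : ContDiff ℝ 1 (fun z : ℝ × ℝ => a z.1 z.2)
  contDiff_snd : ContDiff ℝ 1 (fun z : ℝ × ℝ => b z.1 z.2)
  compact_fst : HasCompactSupport (fun z : ℝ × ℝ => a z.1 z.2)
  compact_snd : HasCompactSupport (fun z : ℝ × ℝ => b z.1 z.2)
  final_fst : ∀ y, a y T = 0
  final_snd : ∀ y, b y T = 0
  boundary : ∀ t, a 0 t + b 0 t = 0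

/-- The derivative at `(y, t)` of a function of two variables in the direction `w`. -/
def dirDeriv (w : ℝ × ℝ) (a : ℝ → ℝ → ℂ) (y t : ℝ) : ℂ :=
  fderiv ℝ (fun z : ℝ × ℝ => a z.1 z.2) (y, t) w

theorem hasDerivAt_comp_curve {a : ℝ → ℝ → ℂ}
    (ha : ContDiff ℝ 1 (fun z : ℝ × ℝ => a z.1 z.2)) {p q : ℝ → ℝ} {p' q' s : ℝ}
    (hp : HasDerivAt p p' s) (hq : HasDerivAt q q' s) :
    HasDerivAt (fun s => a (p s) (q s)) (dirDeriv (p', q') a (p s) (q s)) s := by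
  have h : HasFDerivAt (fun z : ℝ × ℝ => a z.1 z.2)
      (fderiv ℝ (fun z : ℝ × ℝ => a z.1 z.2) (p s, q s)) (p s, q s) :=
    (ha.differentiable one_ne_zero _).hasFDerivAt
  exact h.comp_hasDerivAt (f := fun x => (p x, q x)) s (hp.prodMk hq)

theorem continuous_dirDeriv {a : ℝ → ℝ → ℂ} (ha : ContDiff ℝ 1 (fun z : ℝ × ℝ => a z.1 z.2))
    (w : ℝ × ℝ) : Continuous fun z : ℝ × ℝ => dirDeriv w a z.1 z.2 :=
  (ha.continuous_fderiv one_ne_zero).clm_apply continuous_const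

theorem dirDeriv_eq (a : ℝ → ℝ → ℂ) (y t p q : ℝ) :
    dirDeriv (p, q) a y t = p * dirDeriv (1, 0) a y t + q * dirDeriv (0, 1) a y t := by
  have : ((p, q) : ℝ × ℝ) = p • (1, 0) + q • (0, 1) := by simp
  rw [dirDeriv, this, map_add, map_smul, map_smul]
  simp [dirDeriv]

theorem hasCompactSupport_dirDeriv {a : ℝ → ℝ → ℂ}
    (hc : HasCompactSupport (fun z : ℝ × ℝ => a z.1 z.2)) (w : ℝ × ℝ) :
    HasCompactSupport fun z : ℝ × ℝ => dirDeriv w a z.1 z.2 :=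
  hc.fderiv_apply ℝ w

theorem hasCompactSupport_slice {a : ℝ → ℝ → ℂ}
    (hc : HasCompactSupport (fun z : ℝ × ℝ => a z.1 z.2)) (t : ℝ) :
    HasCompactSupport fun y => a y t := by
  refine HasCompactSupport.of_support_subset_isCompact (hc.isCompact.image continuous_fst) ?_
  intro y hy
  exact ⟨(y, t), subset_tsupport _ hy, rfl⟩

/-- The test function for waves on the unfolded line that is given by a pair of test functions:
the second one is carried to the negative half-line, with the sign of the wave to the left. -/
def lineTest (a b : ℝ → ℝ → ℂ) (y t : ℝ) : ℂ := if 0 ≤ y then a y t else -b (-y) t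

/-- The derivative of the unfolded test function along the characteristics `y - t = const`. -/
def lineTestDeriv (a b : ℝ → ℝ → ℂ) (y t : ℝ) : ℂ :=
  if 0 ≤ y then dirDeriv (1, 1) a y t else -dirDeriv (-1, 1) b (-y) t

theorem integrable_mul_of_hasCompactSupport {P h : ℝ → ℂ} (hP : MemLp P 2 volume)
    (hh : Continuous h) (hc : HasCompactSupport h) : Integrable fun y => P y * h y :=
  hP.integrable_mul (q := 2) (hh.memLp_of_hasCompactSupport hc)

theorem integrable_of_integrableOn_Ioi {G : ℝ → ℂ} (h1 : IntegrableOn G (Ioi 0))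
    (h2 : IntegrableOn (fun y => G (-y)) (Ioi 0)) : Integrable G := by
  have h3 : IntegrableOn G (Iio 0) := by
    rw [← (Measure.measurePreserving_neg (volume : Measure ℝ)).integrableOn_comp_preimage
      (MeasurableEquiv.neg ℝ).measurableEmbedding (f := G) (s := Iio 0)]
    simpa [Function.comp_def] using h2
  rw [← integrableOn_univ, ← Iic_union_Ioi (a := (0 : ℝ))]
  exact ((integrableOn_Iic_iff_integrableOn_Iio).2 h3).union h1

/-- An integral over the line as an integral over the half-line. -/
theorem integral_eq_integral_Ioi {G : ℝ → ℂ} (h1 : IntegrableOn G (Ioi 0))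
    (h2 : IntegrableOn (fun y => G (-y)) (Ioi 0)) :
    ∫ y, G y = ∫ y in Ioi (0 : ℝ), (G y + G (-y)) := by
  rw [integral_add h1 h2, integral_comp_neg_Ioi, neg_zero, add_comm,
    intervalIntegral.integral_Iic_add_Ioi (integrable_of_integrableOn_Ioi h1 h2).integrableOn h1]

namespace Medium

variable (M : Medium)

/-- The reflection coefficient on the unfolded line. -/
def reflectivity (σ : ℝ) : ℝ → ℂ := reflection (M.toRight σ) (M.toLeft σ)

/-- The first component of the test function on the half-line given by `a` and `b`. The factors
are those that decouple the transport terms of the adjoint system. -/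
def liftFst (σ : ℝ) (a b : ℝ → ℝ → ℂ) (x t : ℝ) : ℂ :=
  Complex.I * M.u x * (M.g σ x * a (M.τ x) t + M.g (-σ) x * b (M.τ x) t)

/-- The second component of the test function on the half-line given by `a` and `b`. -/
def liftSnd (σ : ℝ) (a b : ℝ → ℝ → ℂ) (x t : ℝ) : ℂ :=
  σ * M.ui x * (M.g σ x * a (M.τ x) t - M.g (-σ) x * b (M.τ x) t)

theorem isTest_lift (σ : ℝ) {T : ℝ} {a b : ℝ → ℝ → ℂ} (h : IsLineTest T a b) :
    IsTest T (M.liftFst σ a b) (M.liftSnd σ a b) := by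
  have hA : ContDiff ℝ 1 fun z : ℝ × ℝ => a (M.τ z.1) z.2 :=
    h.contDiff_fst.comp ((M.contDiff_τ.comp contDiff_fst).prodMk contDiff_snd)
  have hB : ContDiff ℝ 1 fun z : ℝ × ℝ => b (M.τ z.1) z.2 :=
    h.contDiff_snd.comp ((M.contDiff_τ.comp contDiff_fst).prodMk contDiff_snd)
  have hA' : HasCompactSupport fun z : ℝ × ℝ => a (M.τ z.1) z.2 :=
    h.compact_fst.comp_homeomorph M.planeHomeo
  have hB' : HasCompactSupport fun z : ℝ × ℝ => b (M.τ z.1) z.2 :=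
    h.compact_snd.comp_homeomorph M.planeHomeo
  have h1 := M.contDiff_u.comp (contDiff_fst (E := ℝ) (F := ℝ))
  have h2 := M.contDiff_ui.comp (contDiff_fst (E := ℝ) (F := ℝ))
  have h3 := (M.contDiff_g σ).comp (contDiff_fst (E := ℝ) (F := ℝ))
  have h4 := (M.contDiff_g (-σ)).comp (contDiff_fst (E := ℝ) (F := ℝ))
  refine ⟨(contDiff_const.mul h1).mul ((h3.mul hA).add (h4.mul hB)),
    (contDiff_const.mul h2).mul ((h3.mul hA).sub (h4.mul hB)),
    ((hA'.mul_left).add (hB'.mul_left)).mul_left,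
    ((hA'.mul_left).sub (hB'.mul_left)).mul_left, fun x => ?_, fun x => ?_, fun t => ?_⟩
  · simp [liftFst, h.final_fst, h.final_snd]
  · simp [liftSnd, h.final_fst, h.final_snd]
  · have := h.boundary t
    rw [liftFst, M.τ_zero, M.g_zero, M.g_zero, one_mul, one_mul, this, mul_zero]

/-- Every test function on the half-line is given by a pair of line test functions, so that the
weak problem on the line is equivalent to the one on the half-line. -/
theorem exists_lift {σ : ℝ} (hσ : σ * σ = 1) {T : ℝ} {φ₁ φ₂ : ℝ → ℝ → ℂ} (h : IsTest T φ₁ φ₂) :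
    ∃ a b, IsLineTest T a b ∧ φ₁ = M.liftFst σ a b ∧ φ₂ = M.liftSnd σ a b := by
  have hA : ContDiff ℝ 1 fun z : ℝ × ℝ => φ₁ (M.X z.1) z.2 :=
    h.contDiff₁.comp ((M.contDiff_X.comp contDiff_fst).prodMk contDiff_snd)
  have hB : ContDiff ℝ 1 fun z : ℝ × ℝ => φ₂ (M.X z.1) z.2 :=
    h.contDiff₂.comp ((M.contDiff_X.comp contDiff_fst).prodMk contDiff_snd)
  have hA' : HasCompactSupport fun z : ℝ × ℝ => φ₁ (M.X z.1) z.2 :=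
    h.compact₁.comp_homeomorph M.planeHomeo.symm
  have hB' : HasCompactSupport fun z : ℝ × ℝ => φ₂ (M.X z.1) z.2 :=
    h.compact₂.comp_homeomorph M.planeHomeo.symm
  have hX := M.contDiff_X.comp (contDiff_fst (E := ℝ) (F := ℝ))
  have h1 := M.contDiff_u.comp hX
  have h2 := M.contDiff_ui.comp hX
  have h3 := (M.contDiff_g σ).comp hX
  have h4 := (M.contDiff_g (-σ)).comp hX
  refine ⟨fun y t => 1 / 2 * M.g (-σ) (M.X y) *
      (-Complex.I * M.ui (M.X y) * φ₁ (M.X y) t + σ * M.u (M.X y) * φ₂ (M.X y) t),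
    fun y t => 1 / 2 * M.g σ (M.X y) *
      (-Complex.I * M.ui (M.X y) * φ₁ (M.X y) t - σ * M.u (M.X y) * φ₂ (M.X y) t),
    ⟨(contDiff_const.mul h4).mul (((contDiff_const.mul h2).mul hA).add
        ((contDiff_const.mul h1).mul hB)),
      (contDiff_const.mul h3).mul (((contDiff_const.mul h2).mul hA).sub
        ((contDiff_const.mul h1).mul hB)),
      ((hA'.mul_left).add (hB'.mul_left)).mul_left,
      ((hA'.mul_left).sub (hB'.mul_left)).mul_left, fun y => ?_, fun y => ?_, fun t => ?_⟩, ?_, ?_⟩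
  · simp [h.final₁, h.final₂]
  · simp [h.final₁, h.final₂]
  · simp only [M.X_zero, M.g_zero, h.boundary]
    ring
  · funext x t
    have e1 := M.g_mul_g_neg σ x
    have e2 := M.u_mul_ui x
    simp only [liftFst, M.X_τ]
    linear_combination (Complex.I * Complex.I * M.u x * M.ui x * φ₁ x t) * e1 +
      (Complex.I * Complex.I * φ₁ x t) * e2 + φ₁ x t * Complex.I_mul_I
  · funext x t
    have e1 := M.g_mul_g_neg σ x
    have e2 := M.u_mul_ui x
    have e3 : (σ : ℂ) * σ = 1 := by exact_mod_cast hσ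
    simp only [liftSnd, M.X_τ]
    linear_combination -(σ * σ * M.u x * M.ui x * φ₂ x t) * e1 -
      (σ * σ * φ₂ x t) * e2 - φ₂ x t * e3

/-- The integrand of the weak formulation in the unfolded variables, up to the density `ρ` of the
travel time. The right-hand side collects the contributions of the points `τ(x)` and `-τ(x)`. The
phase factors cancel the diagonal part of the potential, and what is left of it and the derivative
of `v` couple `P(y)` with `P(-y)`. -/
theorem integrand_eq {σ : ℝ} (hσ : σ * σ = 1) {a b : ℝ → ℝ → ℂ}
    (ha : ContDiff ℝ 1 (fun z : ℝ × ℝ => a z.1 z.2))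
    (hb : ContDiff ℝ 1 (fun z : ℝ × ℝ => b z.1 z.2)) (P : ℝ → ℂ) {x : ℝ} (hx : 0 < x) (t : ℝ) :
    -Complex.I * (((M.ρ x : ℂ) * M.ui x ^ 2) * M.foldFst σ P x *
            deriv (fun s => M.liftFst σ a b x s) t
          + ((M.ρ x : ℂ) * M.u x ^ 2) * M.foldSnd σ P x * deriv (fun s => M.liftSnd σ a b x s) t)
        + (σ : ℂ) * (M.foldFst σ P x * deriv (fun y => M.liftSnd σ a b y t) x
          - M.foldSnd σ P x * deriv (fun y => M.liftFst σ a b y t) x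
          + (M.ψ x : ℂ) * (M.foldFst σ P x * M.liftFst σ a b x t +
            M.foldSnd σ P x * M.liftSnd σ a b x t)) =
      M.ρ x * ((P (M.τ x) * lineTestDeriv a b (M.τ x) t
          + M.reflectivity σ (M.τ x) * P (-M.τ x) * lineTest a b (M.τ x) t)
        + (P (-M.τ x) * lineTestDeriv a b (-M.τ x) t
          + M.reflectivity σ (-M.τ x) * P (- -M.τ x) * lineTest a b (-M.τ x) t)) := by
  have hτ := M.τ_pos hx
  have hat := hasDerivAt_comp_curve ha (hasDerivAt_const t (M.τ x)) (hasDerivAt_id t)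
  have hbt := hasDerivAt_comp_curve hb (hasDerivAt_const t (M.τ x)) (hasDerivAt_id t)
  have hax := hasDerivAt_comp_curve ha (M.hasDerivAt_τ x) (hasDerivAt_const x t)
  have hbx := hasDerivAt_comp_curve hb (M.hasDerivAt_τ x) (hasDerivAt_const x t)
  have h1 := (((hat.const_mul (M.g σ x)).add (hbt.const_mul (M.g (-σ) x))).const_mul
    (Complex.I * M.u x)).deriv
  have h2 := (((hat.const_mul (M.g σ x)).sub (hbt.const_mul (M.g (-σ) x))).const_mul
    (σ * M.ui x)).deriv
  have h3 := (((M.hasDerivAt_u x).const_mul Complex.I).mul (((M.hasDerivAt_g σ x).mul hax).add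
    ((M.hasDerivAt_g (-σ) x).mul hbx))).deriv
  have h4 := (((M.hasDerivAt_ui x).const_mul (σ : ℂ)).mul (((M.hasDerivAt_g σ x).mul hax).sub
    ((M.hasDerivAt_g (-σ) x).mul hbx))).deriv
  have k1 : deriv (fun s => M.liftFst σ a b x s) t = _ := h1
  have k2 : deriv (fun s => M.liftSnd σ a b x s) t = _ := h2
  have k3 : deriv (fun y => M.liftFst σ a b y t) x = _ := h3
  have k4 : deriv (fun y => M.liftSnd σ a b y t) x = _ := h4
  rw [k1, k2, k3, k4, neg_neg]
  have r1 : M.reflectivity σ (M.τ x) = M.toRight σ (M.τ x) := if_pos hτ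
  have r2 : M.reflectivity σ (-M.τ x) = M.toLeft σ (-M.τ x) := if_neg (by linarith)
  have r3 : lineTest a b (M.τ x) t = a (M.τ x) t := if_pos hτ.le
  have r4 : lineTest a b (-M.τ x) t = -b (M.τ x) t := by
    rw [lineTest, if_neg (by linarith), neg_neg]
  have r5 : lineTestDeriv a b (M.τ x) t = dirDeriv (1, 1) a (M.τ x) t := if_pos hτ.le
  have r6 : lineTestDeriv a b (-M.τ x) t = -dirDeriv (-1, 1) b (M.τ x) t := by
    rw [lineTestDeriv, if_neg (by linarith), neg_neg]
  have hρ : (M.ρ x : ℂ) ≠ 0 := by exact_mod_cast (M.ρ_pos x).ne'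
  rw [r1, r2, r3, r4, r5, r6, toRight, toLeft, neg_neg, M.X_τ, M.sinh_eq, dirDeriv_eq a _ _ 1 1,
    dirDeriv_eq b _ _ (-1) 1, dirDeriv_eq a _ _ (M.ρ x) 0, dirDeriv_eq b _ _ (M.ρ x) 0]
  simp only [id]
  have e1 := M.g_mul_g_neg σ x
  have e2 := M.u_mul_ui x
  have e3 : (σ : ℂ) * σ = 1 := by exact_mod_cast hσ
  have e4 := Complex.I_mul_I
  have e5 := M.cosh_eq x
  simp only [foldFst, foldSnd, liftFst, liftSnd, Pi.add_apply, Pi.sub_apply, Pi.mul_apply]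
  push_cast at e5 ⊢
  rw [e5]
  clear h1 h2 h3 h4 k1 k2 k3 k4 hat hbt hax hbx r1 r2 r3 r4 r5 r6 hτ hσ ha hb e5 hx
  generalize M.g σ x = G at *
  generalize M.g (-σ) x = H at *
  generalize M.u x = U at *
  generalize M.ui x = W at *
  generalize (M.ρ x : ℂ) = R at *
  generalize (M.dv x : ℂ) = L at *
  generalize (M.ψ x : ℂ) = Q at *
  generalize (σ : ℂ) = S at *
  generalize a (M.τ x) t = A at *
  generalize b (M.τ x) t = B at *
  generalize dirDeriv (1, 0) a (M.τ x) t = Ay at *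
  generalize dirDeriv (1, 0) b (M.τ x) t = By at *
  generalize dirDeriv (0, 1) a (M.τ x) t = At at *
  generalize dirDeriv (0, 1) b (M.τ x) t = Bt at *
  generalize P (M.τ x) = P1 at *
  generalize P (-M.τ x) = P2 at *
  generalize Complex.I = I at *
  grind

end Medium

namespace Medium

variable (M : Medium)

/-- The coefficients of the system are those of the medium on the half-line. -/
structure Represents (d₁ d₂ ψ : ℝ → ℝ) : Prop where
  fst : ∀ x, 0 < x → (d₁ x : ℂ) = M.ρ x * M.ui x ^ 2
  snd : ∀ x, 0 < x → (d₂ x : ℂ) = M.ρ x * M.u x ^ 2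
  potential : ∀ x, 0 < x → ψ x = M.ψ x

theorem image_τ_Ioi : M.τ '' Ioi 0 = Ioi 0 := by
  ext y
  constructor
  · rintro ⟨x, hx, rfl⟩
    exact M.τ_pos hx
  · exact fun hy => ⟨M.X y, M.X_pos hy, M.τ_X y⟩

/-- The substitution of the travel time in an integral over the half-line. -/
theorem integral_comp_τ (H : ℝ → ℂ) :
    ∫ x in Ioi (0 : ℝ), M.ρ x * H (M.τ x) = ∫ y in Ioi (0 : ℝ), H y := by
  have := integral_image_eq_integral_abs_deriv_smul measurableSet_Ioi
    (fun x _ => (M.hasDerivAt_τ x).hasDerivWithinAt) (M.strictMono_τ.injective.injOn (s := Ioi 0)) H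
  rw [M.image_τ_Ioi] at this
  rw [this]
  refine integral_congr_ae (Eventually.of_forall fun x => ?_)
  simp [abs_of_pos (M.ρ_pos x)]

theorem reflectivity_of_pos (σ : ℝ) {y : ℝ} (hy : 0 < y) :
    M.reflectivity σ y = M.toRight σ y := if_pos hy

theorem reflectivity_of_neg (σ : ℝ) {y : ℝ} (hy : 0 < y) :
    M.reflectivity σ (-y) = M.toLeft σ (-y) := if_neg (by linarith)

theorem integrableOn_unfolded (σ : ℝ) {T : ℝ} {a b : ℝ → ℝ → ℂ} (h : IsLineTest T a b)
    {P : ℝ → ℂ} (hP : MemLp P 2 volume) (t : ℝ) :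
    IntegrableOn (fun y => P y * lineTestDeriv a b y t
      + M.reflectivity σ y * P (-y) * lineTest a b y t) (Ioi 0) ∧
    IntegrableOn (fun y => P (-y) * lineTestDeriv a b (-y) t
      + M.reflectivity σ (-y) * P (- -y) * lineTest a b (-y) t) (Ioi 0) := by
  have hP' : MemLp (fun y => P (-y)) 2 volume :=
    hP.comp_measurePreserving (Measure.measurePreserving_neg volume)
  have hp : Continuous fun y : ℝ => (y, t) := by fun_prop
  have ha : Continuous fun y => a y t := h.contDiff_fst.continuous.comp hp
  have hb : Continuous fun y => b y t := h.contDiff_snd.continuous.comp hp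
  have hda : Continuous fun y => dirDeriv (1, 1) a y t :=
    (continuous_dirDeriv h.contDiff_fst _).comp hp
  have hdb : Continuous fun y => dirDeriv (-1, 1) b y t :=
    (continuous_dirDeriv h.contDiff_snd _).comp hp
  have hr := M.continuous_toRight σ
  have hl : Continuous fun y => M.toLeft σ (-y) := (M.continuous_toLeft σ).comp continuous_neg
  have i1 := integrable_mul_of_hasCompactSupport hP hda
    (hasCompactSupport_slice (hasCompactSupport_dirDeriv h.compact_fst _) t)
  have i2 := integrable_mul_of_hasCompactSupport hP' (hr.mul ha)
    (hasCompactSupport_slice h.compact_fst t).mul_left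
  have i3 := integrable_mul_of_hasCompactSupport hP' hdb
    (hasCompactSupport_slice (hasCompactSupport_dirDeriv h.compact_snd _) t)
  have i4 := integrable_mul_of_hasCompactSupport hP (hl.mul hb)
    (hasCompactSupport_slice h.compact_snd t).mul_left
  constructor
  · refine ((i1.add i2).integrableOn (s := Ioi 0)).congr_fun (fun y hy => ?_) measurableSet_Ioi
    have hy' : (0 : ℝ) < y := hy
    simp only [Pi.add_apply, M.reflectivity_of_pos σ hy', lineTest, lineTestDeriv, if_pos hy'.le,
      Pi.mul_apply]
    ring
  · refine ((i3.add i4).neg.integrableOn (s := Ioi 0)).congr_fun (fun y hy => ?_) measurableSet_Ioi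
    have hy' : (0 : ℝ) < y := hy
    have hy2 : ¬ 0 ≤ -y := by linarith
    simp only [Pi.add_apply, Pi.neg_apply, M.reflectivity_of_neg σ hy', lineTest, lineTestDeriv,
      if_neg hy2, neg_neg, Pi.mul_apply]
    ring

variable {M}

/-- The space integral of the weak formulation in the unfolded variables. -/
theorem Represents.integral_eq {d₁ d₂ ψ : ℝ → ℝ} (hM : M.Represents d₁ d₂ ψ) {σ : ℝ}
    (hσ : σ * σ = 1) {T : ℝ} {a b : ℝ → ℝ → ℂ} (h : IsLineTest T a b)
    {P : ℝ → ℂ} (hP : MemLp P 2 volume) {V : ℝ → C2}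
    (hV : ∀ᵐ x ∂(volume.restrict (Ioi (0 : ℝ))),
      V x 0 = M.foldFst σ P x ∧ V x 1 = M.foldSnd σ P x) (t : ℝ) :
    (∫ x in Ioi (0 : ℝ),
      (-Complex.I * ((d₁ x : ℂ) * V x 0 * deriv (fun s => M.liftFst σ a b x s) t
          + (d₂ x : ℂ) * V x 1 * deriv (fun s => M.liftSnd σ a b x s) t)
        + (σ : ℂ) * (V x 0 * deriv (fun y => M.liftSnd σ a b y t) x
          - V x 1 * deriv (fun y => M.liftFst σ a b y t) x
          + (ψ x : ℂ) * (V x 0 * M.liftFst σ a b x t + V x 1 * M.liftSnd σ a b x t)))) =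
    ∫ y, (P y * lineTestDeriv a b y t + M.reflectivity σ y * P (-y) * lineTest a b y t) := by
  obtain ⟨i1, i2⟩ := M.integrableOn_unfolded σ h hP t
  rw [integral_eq_integral_Ioi i1 i2]
  refine Eq.trans (integral_congr_ae ?_) (M.integral_comp_τ _)
  filter_upwards [hV, ae_restrict_mem measurableSet_Ioi] with x hx hx0
  rw [hx.1, hx.2, hM.fst x hx0, hM.snd x hx0, hM.potential x hx0]
  exact M.integrand_eq hσ h.contDiff_fst h.contDiff_snd P hx0 t

/-- The boundary term of the weak formulation in the unfolded variables. -/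
theorem liftSnd_zero {σ : ℝ} (hσ : σ * σ = 1) {T : ℝ} {a b : ℝ → ℝ → ℂ} (h : IsLineTest T a b)
    (t : ℝ) : σ * M.liftSnd σ a b 0 t = 2 * M.ui 0 * lineTest a b 0 t := by
  have e3 : (σ : ℂ) * σ = 1 := by exact_mod_cast hσ
  rw [liftSnd, lineTest, if_pos le_rfl, M.τ_zero, M.g_zero, M.g_zero]
  linear_combination M.ui 0 * (a 0 t - b 0 t) * e3 - M.ui 0 * h.boundary t

end Medium

theorem hasDerivAt_lineTest {T : ℝ} {a b : ℝ → ℝ → ℂ} (h : IsLineTest T a b) {z t : ℝ}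
    (hz : z + t ≠ 0) :
    HasDerivAt (fun s => lineTest a b (z + s) s) (lineTestDeriv a b (z + t) t) t := by
  have h1 : HasDerivAt (fun s => z + s) 1 t := (hasDerivAt_id t).const_add z
  have h2 : HasDerivAt (fun s => -(z + s)) (-1) t := h1.neg
  rcases lt_or_gt_of_ne hz with hz | hz
  · have h3 := (hasDerivAt_comp_curve h.contDiff_snd h2 (hasDerivAt_id t)).neg
    rw [lineTestDeriv, if_neg (not_le.2 hz)]
    refine h3.congr_of_eventuallyEq ?_
    have : ∀ᶠ s in 𝓝 t, z + s < 0 := h1.continuousAt.eventually (gt_mem_nhds hz)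
    filter_upwards [this] with s hs
    simp [lineTest, not_le.2 hs]
  · have h3 := hasDerivAt_comp_curve h.contDiff_fst h1 (hasDerivAt_id t)
    rw [lineTestDeriv, if_pos hz.le]
    refine h3.congr_of_eventuallyEq ?_
    have : ∀ᶠ s in 𝓝 t, 0 < z + s := h1.continuousAt.eventually (lt_mem_nhds hz)
    filter_upwards [this] with s hs
    simp [lineTest, hs.le]

theorem continuous_lineTest {T : ℝ} {a b : ℝ → ℝ → ℂ} (h : IsLineTest T a b) :
    Continuous fun z : ℝ × ℝ => lineTest a b z.1 z.2 := by
  refine Continuous.if_le h.contDiff_fst.continuous ?_ continuous_const continuous_fst ?_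
  · exact (h.contDiff_snd.continuous.comp
      ((continuous_fst.neg).prodMk continuous_snd)).neg
  · intro z hz
    rw [← hz, neg_zero]
    linear_combination h.boundary z.2

theorem measurable_lineTestDeriv {T : ℝ} {a b : ℝ → ℝ → ℂ} (h : IsLineTest T a b) :
    Measurable fun z : ℝ × ℝ => lineTestDeriv a b z.1 z.2 := by
  refine Measurable.ite (measurableSet_le measurable_const measurable_fst)
    (continuous_dirDeriv h.contDiff_fst _).measurable ?_
  exact ((continuous_dirDeriv h.contDiff_snd (-1, 1)).comp
      ((continuous_fst.neg).prodMk continuous_snd)).neg.measurable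

theorem exists_norm_lineTest_le {T : ℝ} {a b : ℝ → ℝ → ℂ} (h : IsLineTest T a b) :
    ∃ A, (∀ y t, ‖lineTest a b y t‖ ≤ A) ∧ ∀ y t, ‖lineTestDeriv a b y t‖ ≤ A := by
  obtain ⟨A₁, h1⟩ := h.compact_fst.exists_bound_of_continuous h.contDiff_fst.continuous
  obtain ⟨A₂, h2⟩ := h.compact_snd.exists_bound_of_continuous h.contDiff_snd.continuous
  obtain ⟨A₃, h3⟩ := (hasCompactSupport_dirDeriv h.compact_fst (1, 1)).exists_bound_of_continuous
    (continuous_dirDeriv h.contDiff_fst _)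
  obtain ⟨A₄, h4⟩ := (hasCompactSupport_dirDeriv h.compact_snd (-1, 1)).exists_bound_of_continuous
    (continuous_dirDeriv h.contDiff_snd _)
  refine ⟨max (max A₁ A₂) (max A₃ A₄), fun y t => ?_, fun y t => ?_⟩
  · rw [lineTest]
    split_ifs
    · exact (h1 (y, t)).trans ((le_max_left _ _).trans (le_max_left _ _))
    · rw [norm_neg]
      exact (h2 (-y, t)).trans ((le_max_right _ _).trans (le_max_left _ _))
  · rw [lineTestDeriv]
    split_ifs
    · exact (h3 (y, t)).trans ((le_max_left _ _).trans (le_max_right _ _))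
    · rw [norm_neg]
      exact (h4 (-y, t)).trans ((le_max_right _ _).trans (le_max_right _ _))

/-- The fundamental theorem of calculus along a characteristic. The test function need not be
differentiable where the characteristic crosses the boundary `y = 0`. -/
theorem integral_lineTestDeriv {T : ℝ} {a b : ℝ → ℝ → ℂ} (h : IsLineTest T a b) (z : ℝ) {s : ℝ}
    (hs : s ≤ T) : ∫ t in s..T, lineTestDeriv a b (z + t) t =
      lineTest a b (z + T) T - lineTest a b (z + s) s := by
  have hc : Continuous fun t : ℝ => (z + t, t) := by fun_prop
  obtain ⟨A, -, hA⟩ := exists_norm_lineTest_le h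
  refine integral_eq_of_hasDerivAt_off_countable_of_le (f := fun t => lineTest a b (z + t) t) _ hs
    (s := {-z}) (countable_singleton _)
    ((continuous_lineTest h).comp hc).continuousOn (fun t ht => ?_) ?_
  · exact hasDerivAt_lineTest h fun h0 => ht.2 (by simp; linarith)
  · refine (intervalIntegrable_const (c := A)).mono_fun' ?_ ?_
    · exact ((measurable_lineTestDeriv h).comp hc.measurable).aestronglyMeasurable
    · exact Eventually.of_forall fun t => hA _ _

/-! ### Existence and uniqueness of the solutions -/

/-- Test functions that are transported with the waves to the right. -/
theorem isLineTest_transport {T : ℝ} {χ : ℝ → ℂ} {θ : ℝ → ℝ} (hχ : ContDiff ℝ 1 χ)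
    (hχc : HasCompactSupport χ) (hχT : χ T = 0) (hθ : ContDiff ℝ 1 θ)
    (hθc : HasCompactSupport θ) :
    IsLineTest T (fun y t => χ t * (θ (y - t) : ℂ)) (fun y t => -(χ t * (θ (-y - t) : ℂ))) := by
  have hθ' : ContDiff ℝ 1 fun y => (θ y : ℂ) := Complex.ofRealCLM.contDiff.comp hθ
  have key : ∀ s : ℝ, s * s = 1 →
      HasCompactSupport fun z : ℝ × ℝ => χ z.2 * (θ (s * z.1 - z.2) : ℂ) := by
    intro s hs
    refine HasCompactSupport.of_support_subset_isCompact ((hθc.isCompact.prod hχc.isCompact).image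
      (f := fun w : ℝ × ℝ => (s * (w.1 + w.2), w.2)) (by fun_prop)) ?_
    rintro ⟨y, t⟩ h
    rw [Function.mem_support, mul_ne_zero_iff, Complex.ofReal_ne_zero] at h
    refine ⟨(s * y - t, t), ⟨subset_tsupport _ h.2, subset_tsupport _ h.1⟩, ?_⟩
    refine Prod.ext ?_ rfl
    simp only
    linear_combination y * hs
  have k1 := key 1 (by norm_num)
  have k2 := (key (-1) (by norm_num)).neg
  simp only [one_mul, neg_one_mul] at k1 k2
  refine ⟨?_, ?_, k1, k2, fun y => ?_, fun y => ?_, fun t => ?_⟩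
  · exact (hχ.comp contDiff_snd).mul (hθ'.comp (contDiff_fst.sub contDiff_snd))
  · exact ((hχ.comp contDiff_snd).mul (hθ'.comp (contDiff_fst.neg.sub contDiff_snd))).neg
  · simp [hχT]
  · simp [hχT]
  · simp

theorem lineTest_transport {χ : ℝ → ℂ} {θ : ℝ → ℝ} (y t : ℝ) :
    lineTest (fun y t => χ t * (θ (y - t) : ℂ)) (fun y t => -(χ t * (θ (-y - t) : ℂ))) y t =
      χ t * (θ (y - t) : ℂ) := by
  rw [lineTest]
  split_ifs <;> simp

theorem lineTestDeriv_transport {T : ℝ} {χ : ℝ → ℂ} {θ : ℝ → ℝ} (hχ : ContDiff ℝ 1 χ)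
    (hχc : HasCompactSupport χ) (hχT : χ T = 0) (hθ : ContDiff ℝ 1 θ)
    (hθc : HasCompactSupport θ) (y t : ℝ) :
    lineTestDeriv (fun y t => χ t * (θ (y - t) : ℂ)) (fun y t => -(χ t * (θ (-y - t) : ℂ))) y t =
      deriv χ t * (θ (y - t) : ℂ) := by
  have h := isLineTest_transport hχ hχc hχT hθ hθc
  have hd : HasDerivAt χ (deriv χ t) t := (hχ.differentiable one_ne_zero t).hasDerivAt
  rw [lineTestDeriv]
  split_ifs
  · have h1 := hasDerivAt_comp_curve (a := fun y t => χ t * (θ (y - t) : ℂ)) h.contDiff_fst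
      ((hasDerivAt_id t).const_add (y - t)) (hasDerivAt_id t)
    have h2 := h1.unique (by simpa using hd.mul_const (θ (y - t) : ℂ))
    simpa using h2
  · have hp : HasDerivAt (fun s => -(y - t + s)) (-1) t := ((hasDerivAt_id t).const_add (y - t)).neg
    have h1 := hasDerivAt_comp_curve (a := fun y t => -(χ t * (θ (-y - t) : ℂ)))
      h.contDiff_snd hp (hasDerivAt_id t)
    have h3 : HasDerivAt (fun s => -(χ s * (θ (y - t) : ℂ))) (-(deriv χ t * (θ (y - t) : ℂ))) t :=
      (hd.mul_const (θ (y - t) : ℂ)).neg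
    have h2 := h1.unique (by simpa using h3)
    simp only [id, sub_add_cancel] at h2
    rw [h2, neg_neg]

namespace Medium

variable {M : Medium}

/-- The solutions on `[0, T]` are unique. -/
theorem Represents.unique {d₁ d₂ ψ : ℝ → ℝ} (hM : M.Represents d₁ d₂ ψ) {σ : ℝ}
    (hσ : σ * σ = 1) {T : ℝ} (hT : 0 < T) {f : ℝ → ℂ} {V V' : ℝ → L2on (Ioi 0)}
    (hV : IsWeakSolution σ d₁ d₂ ψ T f V) (hV' : IsWeakSolution σ d₁ d₂ ψ T f V') :
    EqOn V' V (Icc 0 T) := by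
  obtain ⟨S, hS⟩ := M.exists_fold σ
  obtain ⟨U, hU⟩ := M.exists_unfold σ
  have hSU := M.fold_unfold hσ hS hU
  suffices h : EqOn (fun t => U (V' t)) (fun t => U (V t)) (Icc 0 T) by
    intro t ht
    rw [← hSU (V' t), ← hSU (V t)]
    exact congrArg S (h ht)
  refine unfolded_unique (M.continuous_toRight σ) (M.continuous_toLeft σ) hT
    (U.continuous.comp_continuousOn hV'.continuousOn)
    (U.continuous.comp_continuousOn hV.continuousOn) ?_
  intro χ θ hχ hχc hχT hθ hθc
  have hl := isLineTest_transport hχ hχc hχT hθ hθc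
  have key : ∀ V : ℝ → L2on (Ioi 0), IsWeakSolution σ d₁ d₂ ψ T f V →
      (∫ t in (0 : ℝ)..T, (deriv χ t * (∫ y, U (V t) y * (θ (y - t) : ℂ)) +
        χ t * ∫ y, reflection (M.toRight σ) (M.toLeft σ) y * U (V t) (-y) * (θ (y - t) : ℂ))) +
      σ * ∫ t in (0 : ℝ)..T, f t * M.liftSnd σ (fun y t => χ t * (θ (y - t) : ℂ))
        (fun y t => -(χ t * (θ (-y - t) : ℂ))) 0 t = 0 := by
    intro V hV
    rw [← hV.weak _ _ (M.isTest_lift σ hl)]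
    congr 1
    refine intervalIntegral.integral_congr fun t _ => ?_
    -- `V t` is the folding of its unfolding, so that the weak form can be carried over
    have hfold := hS (U (V t))
    rw [hSU] at hfold
    have hP : MemLp (U (V t)) 2 volume := Lp.memLp _
    refine Eq.trans ?_ (hM.integral_eq hσ hl hP hfold t).symm
    obtain ⟨i1, i2⟩ := M.integrableOn_unfolded σ hl hP t
    have i3 := integrable_of_integrableOn_Ioi i1 i2
    have hθt : HasCompactSupport fun y => (θ (y - t) : ℂ) := by
      have : HasCompactSupport fun y => θ (y - t) := hθc.comp_homeomorph (Homeomorph.subRight t)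
      exact this.comp_left (g := fun r : ℝ => (r : ℂ)) Complex.ofReal_zero
    have i4 : Integrable fun y => U (V t) y * (θ (y - t) : ℂ) :=
      integrable_mul_of_hasCompactSupport hP
        (Complex.continuous_ofReal.comp (hθ.continuous.comp (by fun_prop))) hθt
    simp only [lineTest_transport, lineTestDeriv_transport hχ hχc hχT hθ hθc] at i3 ⊢
    have i5 : Integrable fun y => U (V t) y * (deriv χ t * (θ (y - t) : ℂ)) := by
      refine (i4.const_mul (deriv χ t)).congr (Eventually.of_forall fun y => ?_)
      simp only
      ring
    have i6 : Integrable fun y => M.reflectivity σ y * U (V t) (-y) * (χ t * (θ (y - t) : ℂ)) := by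
      refine (i3.sub i5).congr (Eventually.of_forall fun y => ?_)
      simp only [Pi.sub_apply]
      ring
    rw [integral_add i5 i6, ← integral_const_mul, ← integral_const_mul]
    congr 1 <;> refine integral_congr_ae (Eventually.of_forall fun y => ?_)
    · simp only
      ring
    · simp only [reflectivity]
      ring
  have h1 := key V hV
  have h2 := key V' hV'
  exact add_right_cancel (h2.trans h1.symm)

variable (M) in
/-- The kernel `K` describes the response of the medium to boundary controls up to the time `T`:
the waves that it generates solve the weak problem on the unfolded line. -/
structure IsResponseKernel (σ T : ℝ) (K : ℝ → ℝ → ℂ) : Prop where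
  continuous : Continuous fun z : ℝ × ℝ => K z.1 z.2
  weak : ∀ F : ℝ → ℂ, Measurable F → Integrable F → (∀ r, r ∉ Ioo 0 T → F r = 0) →
    ∀ a b, IsLineTest T a b →
      (∫ t in (0 : ℝ)..T, ∫ y, (wave K F y t * lineTestDeriv a b y t +
        M.reflectivity σ y * wave K F (-y) t * lineTest a b y t)) +
      ∫ t in (0 : ℝ)..T, F t * lineTest a b 0 t = 0

variable (M) in
theorem exists_responseKernel (σ : ℝ) {T : ℝ} (hT : 0 < T) :
    ∃ K, M.IsResponseKernel σ T K := by
  -- the reflection coefficients matter only for `|y| < T`, so they may be made bounded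
  set p : ℝ → ℝ := fun y => max (-T) (min y T) with hp
  have hpc : Continuous p := by fun_prop
  have hpm : ∀ y, p y ∈ Icc (-T) T := fun y =>
    ⟨le_max_left _ _, max_le (by linarith) (min_le_right _ _)⟩
  have hpe : ∀ y, |y| < T → p y = y := fun y hy => by
    obtain ⟨h1, h2⟩ := abs_lt.1 hy
    simp [hp, h1.le, h2.le]
  have hb : Continuous fun y => M.toRight σ (p y) := (M.continuous_toRight σ).comp hpc
  have hc : Continuous fun y => M.toLeft σ (p y) := (M.continuous_toLeft σ).comp hpc
  obtain ⟨C₁, hC₁⟩ := (isCompact_Icc (a := -T) (b := T)).exists_bound_of_continuousOn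
    (M.continuous_toRight σ).continuousOn
  obtain ⟨C₂, hC₂⟩ := (isCompact_Icc (a := -T) (b := T)).exists_bound_of_continuousOn
    (M.continuous_toLeft σ).continuousOn
  have hbC : ∀ y, ‖M.toRight σ (p y)‖ ≤ max C₁ C₂ :=
    fun y => (hC₁ _ (hpm y)).trans (le_max_left _ _)
  have hcC : ∀ y, ‖M.toLeft σ (p y)‖ ≤ max C₁ C₂ :=
    fun y => (hC₂ _ (hpm y)).trans (le_max_right _ _)
  obtain ⟨K, hK, hKeq⟩ := exists_goursat_kernel hb hc hbC hcC
  refine ⟨K, hK, fun F hFm hF1 hF0 a b h => ?_⟩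
  obtain ⟨A, hA1, hA2⟩ := exists_norm_lineTest_le h
  have hw := wave_weak hb hc hbC hcC hK hKeq hFm hF1 hF0 hT
    (continuous_lineTest h).measurable (measurable_lineTestDeriv h) hA1 hA2
    (fun z s hs => integral_lineTestDeriv h z hs) (fun y => by
      simp [lineTest, h.final_fst, h.final_snd])
  rw [← hw]
  congr 1
  refine intervalIntegral.integral_congr fun t ht => ?_
  rw [uIcc_of_le hT.le] at ht
  refine integral_congr_ae (Eventually.of_forall fun y => ?_)
  simp only
  rcases lt_or_ge |y| T with hy | hy
  · simp only [reflectivity, reflection, hpe y hy]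
  · have : wave K F (-y) t = 0 := wave_eq_zero hF0 (by rw [abs_neg]; exact ht.2.trans hy)
    rw [this]
    ring

variable (M) in
/-- The amplitude of the wave that enters the unfolded line for the control `f`. -/
def source (T : ℝ) (f : ℝ → ℂ) : ℝ → ℂ := (Ioo 0 T).indicator fun t => 2 * M.ui 0 * f t

theorem source_eq_zero {T : ℝ} {f : ℝ → ℂ} (r : ℝ) (hr : r ∉ Ioo 0 T) : M.source T f r = 0 :=
  indicator_of_notMem hr _

theorem memLp_source {T : ℝ} {f : ℝ → ℂ} (hf : MemLp f 2 (volume.restrict (Ioo 0 T))) :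
    MemLp (M.source T f) 2 volume :=
  (memLp_indicator_iff_restrict measurableSet_Ioo).2 (hf.const_mul _)

theorem integrable_source {T : ℝ} {f : ℝ → ℂ} (hf : MemLp f 2 (volume.restrict (Ioo 0 T))) :
    Integrable (M.source T f) volume :=
  (integrable_indicator_iff measurableSet_Ioo).2
    ((hf.integrable (by norm_num)).const_mul (2 * M.ui 0))

/-- The wave generated by a control solves the problem on the half-line. -/
theorem Represents.exists_solution {d₁ d₂ ψ : ℝ → ℝ} (hM : M.Represents d₁ d₂ ψ) {σ : ℝ}
    (hσ : σ * σ = 1) {T : ℝ} (hT : 0 < T) {K : ℝ → ℝ → ℂ} (hK : M.IsResponseKernel σ T K)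
    {f : ℝ → ℂ} (hfm : Measurable f) (hf : MemLp f 2 (volume.restrict (Ioo 0 T))) :
    ∃ V, IsWeakSolution σ d₁ d₂ ψ T f V ∧ ∀ t, ∀ᵐ x ∂(volume.restrict (Ioi (0 : ℝ))),
      V t x 0 = M.foldFst σ (fun y => wave K (M.source T f) y t) x ∧
      V t x 1 = M.foldSnd σ (fun y => wave K (M.source T f) y t) x := by
  obtain ⟨S, hS⟩ := M.exists_fold σ
  have hF0 := source_eq_zero (M := M) (T := T) (f := f)
  obtain ⟨Q, hQ, hQw⟩ := exists_wave_toLp hK.continuous (M.memLp_source hf)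
    (M.integrable_source hf) hF0
  have hQn : ∀ t, ∀ᵐ y, Q t (-y) = wave K (M.source T f) (-y) t := fun t =>
    (Measure.measurePreserving_neg (volume : Measure ℝ)).quasiMeasurePreserving.ae (hQw t)
  refine ⟨fun t => S (Q t), ⟨(S.continuous.comp hQ).continuousOn, ?_, ?_⟩, fun t => ?_⟩
  · have : Q 0 = 0 := by
      refine Lp.ext ?_
      filter_upwards [hQw 0, Lp.coeFn_zero ℂ 2 (volume : Measure ℝ)] with y h1 h2
      rw [h1, h2, wave_eq_zero hF0 (abs_nonneg y), Pi.zero_apply]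
    simp only [this, map_zero]
  · intro φ₁ φ₂ hφ
    obtain ⟨a, b, h, rfl, rfl⟩ := M.exists_lift hσ hφ
    have hFm : Measurable (M.source T f) :=
      (measurable_const.mul hfm).indicator measurableSet_Ioo
    have hw := hK.weak (M.source T f) hFm (M.integrable_source hf) hF0 a b h
    rw [← hw]
    congr 1
    · refine intervalIntegral.integral_congr fun t _ => ?_
      refine (hM.integral_eq hσ h (Lp.memLp (Q t)) (hS (Q t)) t).trans (integral_congr_ae ?_)
      filter_upwards [hQw t, hQn t] with y h1 h2
      rw [h1, h2]
    · rw [← intervalIntegral.integral_const_mul, intervalIntegral.integral_of_le hT.le,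
        intervalIntegral.integral_of_le hT.le, integral_Ioc_eq_integral_Ioo,
        integral_Ioc_eq_integral_Ioo]
      refine setIntegral_congr_fun measurableSet_Ioo fun t ht => ?_
      simp only [source, indicator_of_mem ht]
      linear_combination f t * M.liftSnd_zero hσ h t
  · filter_upwards [hS (Q t), M.quasiMeasurePreserving_τ.ae (hQw t),
      M.quasiMeasurePreserving_neg_τ.ae (hQw t)] with x h1 h2 h3
    rw [h1.1, h1.2, foldFst, foldSnd, foldFst, foldSnd, h2, h3]
    exact ⟨rfl, rfl⟩

end Medium

/-- The weak formulation depends only on the class of the control. -/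
theorem IsWeakSolution.congr_control {σ T : ℝ} {d₁ d₂ ψ : ℝ → ℝ} {f f' : ℝ → ℂ} (hT : 0 < T)
    {V : ℝ → L2on (Ioi 0)} (hV : IsWeakSolution σ d₁ d₂ ψ T f V)
    (h : f =ᵐ[volume.restrict (Ioo 0 T)] f') : IsWeakSolution σ d₁ d₂ ψ T f' V := by
  refine ⟨hV.continuousOn, hV.initial, fun φ₁ φ₂ hφ => ?_⟩
  rw [← hV.weak φ₁ φ₂ hφ]
  congr 2
  rw [intervalIntegral.integral_of_le hT.le, intervalIntegral.integral_of_le hT.le,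
    integral_Ioc_eq_integral_Ioo, integral_Ioc_eq_integral_Ioo]
  refine integral_congr_ae ?_
  filter_upwards [h] with t ht
  rw [ht]

/-- Existence and uniqueness for square integrable controls. -/
theorem Medium.Represents.existsUnique_solution {M : Medium} {d₁ d₂ ψ : ℝ → ℝ}
    (hM : M.Represents d₁ d₂ ψ) {σ : ℝ} (hσ : σ * σ = 1) {T : ℝ} (hT : 0 < T) {f : ℝ → ℂ}
    (hf : MemLp f 2 (volume.restrict (Ioo 0 T))) :
    ∃ V, IsWeakSolution σ d₁ d₂ ψ T f V ∧
      ∀ V', IsWeakSolution σ d₁ d₂ ψ T f V' → EqOn V' V (Icc 0 T) := by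
  obtain ⟨K, hK⟩ := M.exists_responseKernel σ hT
  have hae := hf.1.ae_eq_mk
  obtain ⟨V, hV, -⟩ := hM.exists_solution hσ hT hK hf.1.stronglyMeasurable_mk.measurable
    ((memLp_congr_ae hae).1 hf)
  have hV' := hV.congr_control hT hae.symm
  exact ⟨V, hV', fun V' h => hM.unique hσ hT hV' h⟩

/-! ### The state at the final time as a Volterra operator of the controls -/

/-- The operator on `ℂ²` with the matrix `(p q; r s)`. -/
def mat (p q r s : ℂ) : C2 →L[ℂ] C2 :=
  p • (axis 0 ∘L EuclideanSpace.proj 0) + q • (axis 0 ∘L EuclideanSpace.proj 1) +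
    r • (axis 1 ∘L EuclideanSpace.proj 0) + s • (axis 1 ∘L EuclideanSpace.proj 1)

theorem mat_apply_zero (p q r s : ℂ) (V : C2) : mat p q r s V 0 = p * V 0 + q * V 1 := by
  simp [mat, axis]

theorem mat_apply_one (p q r s : ℂ) (V : C2) : mat p q r s V 1 = r * V 0 + s * V 1 := by
  simp [mat, axis]

theorem exists_norm_mat_le (C : ℝ) : ∃ B, 0 ≤ B ∧ ∀ p q r s : ℂ, ‖p‖ ≤ C → ‖q‖ ≤ C → ‖r‖ ≤ C →
    ‖s‖ ≤ C → ‖mat p q r s‖ ≤ B := by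
  let e : Fin 2 → Fin 2 → C2 →L[ℂ] C2 := fun i j => axis i ∘L EuclideanSpace.proj j
  refine ⟨max C 0 * ‖e 0 0‖ + max C 0 * ‖e 0 1‖ + max C 0 * ‖e 1 0‖ + max C 0 * ‖e 1 1‖,
    by positivity, fun p q r s hp hq hr hs => ?_⟩
  have h1 := le_max_left C 0
  refine (norm_add_le _ _).trans (add_le_add ((norm_add_le _ _).trans (add_le_add
    ((norm_add_le _ _).trans (add_le_add ?_ ?_)) ?_)) ?_) <;> rw [norm_smul] <;>
    exact mul_le_mul_of_nonneg_right (by linarith) (norm_nonneg _)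

section Volterra

variable {T : ℝ} {K K' : ℝ → ℝ → ℂ}

/-- The kernel of the operator that takes a pair of controls to the amplitudes of the waves
that they generate at the final time, at the distance `T - η` from the boundary. The waves of the
second system are those of the first one reversed in time, so that the amplitudes combine
crosswise. -/
def controlKernel (T : ℝ) (K K' : ℝ → ℝ → ℂ) (η r : ℝ) : C2 →L[ℂ] C2 :=
  mat (impulseResponse K (T - η) (T - r)) (-impulseResponse K' (-(T - η)) (T - r))
    (-impulseResponse K (-(T - η)) (T - r)) (impulseResponse K' (T - η) (T - r))

theorem measurable_impulseResponse_slice (hK : Continuous fun z : ℝ × ℝ => K z.1 z.2) (y : ℝ) :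
    Measurable fun r => impulseResponse K y (T - r) :=
  (measurable_impulseResponse hK).comp (by fun_prop : Measurable fun r : ℝ => (y, T - r))

theorem stronglyMeasurable_controlKernel (hK : Continuous fun z : ℝ × ℝ => K z.1 z.2)
    (hK' : Continuous fun z : ℝ × ℝ => K' z.1 z.2) :
    StronglyMeasurable (Function.uncurry (controlKernel T K K')) := by
  have h1 : Measurable fun z : ℝ × ℝ => (T - z.1, T - z.2) := by fun_prop
  have h2 : Measurable fun z : ℝ × ℝ => (-(T - z.1), T - z.2) := by fun_prop
  have m1 := ((measurable_impulseResponse hK).comp h1).stronglyMeasurable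
  have m2 := ((measurable_impulseResponse hK').comp h2).neg.stronglyMeasurable
  have m3 := ((measurable_impulseResponse hK).comp h2).neg.stronglyMeasurable
  have m4 := ((measurable_impulseResponse hK').comp h1).stronglyMeasurable
  exact (((m1.smul_const _).add (m2.smul_const _)).add (m3.smul_const _)).add (m4.smul_const _)

theorem exists_norm_controlKernel_le (hK : Continuous fun z : ℝ × ℝ => K z.1 z.2)
    (hK' : Continuous fun z : ℝ × ℝ => K' z.1 z.2) :
    ∃ B, 0 ≤ B ∧ ∀ η r, 0 ≤ r → ‖controlKernel T K K' η r‖ ≤ B := by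
  obtain ⟨B₁, -, hB₁⟩ := exists_impulseResponse_bound hK T
  obtain ⟨B₂, -, hB₂⟩ := exists_impulseResponse_bound hK' T
  obtain ⟨B, hB0, hB⟩ := exists_norm_mat_le (max B₁ B₂)
  refine ⟨B, hB0, fun η r hr => ?_⟩
  have k1 : ∀ y, ‖impulseResponse K y (T - r)‖ ≤ max B₁ B₂ := fun y =>
    (hB₁ y _ (by linarith)).trans (le_max_left _ _)
  have k2 : ∀ y, ‖impulseResponse K' y (T - r)‖ ≤ max B₁ B₂ := fun y =>
    (hB₂ y _ (by linarith)).trans (le_max_right _ _)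
  exact hB _ _ _ _ (k1 _) (by rw [norm_neg]; exact k2 _) (by rw [norm_neg]; exact k1 _) (k2 _)

/-- The control kernel is a Volterra kernel: a control acting after the time `η` has not reached
the distance `T - η` at the time `T`. -/
theorem controlKernel_eq_zero {η r : ℝ} (hη : η ≤ T) (h : η ≤ r) :
    controlKernel T K K' η r = 0 := by
  have h1 : T - r ≤ |T - η| := by
    rw [abs_of_nonneg (by linarith)]
    linarith
  have h2 : T - r ≤ |-(T - η)| := by rwa [abs_neg]
  rw [controlKernel, impulseResponse_of_le h1, impulseResponse_of_le h1,
    impulseResponse_of_le h2, impulseResponse_of_le h2, neg_zero]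
  ext V i
  fin_cases i
  · exact (mat_apply_zero _ _ _ _ _).trans (by simp)
  · exact (mat_apply_one _ _ _ _ _).trans (by simp)

/-- The identity plus the integral operator with the control kernel is invertible. -/
theorem exists_control_equiv (hT : 0 < T) (hK : Continuous fun z : ℝ × ℝ => K z.1 z.2)
    (hK' : Continuous fun z : ℝ × ℝ => K' z.1 z.2) :
    ∃ A : L2on (Ioo 0 T) ≃L[ℂ] L2on (Ioo 0 T), ∀ F, A F =ᵐ[volume.restrict (Ioo 0 T)]
      fun η => F η + ∫ r in Ioo 0 T, controlKernel T K K' η r (F r) := by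
  obtain ⟨B, hB0, hB⟩ := exists_norm_controlKernel_le (T := T) hK hK'
  obtain ⟨S, hS⟩ := exists_integral_operator (T := T) (C := B)
    (stronglyMeasurable_controlKernel (T := T) hK hK') (fun x _ r hr => hB x r hr.1.le)
  have hu : IsUnit (1 + S) := by
    refine isUnit_one_add_of_volterra hT hB0 rfl S fun F => ?_
    have hF : Integrable F (volume.restrict (Ioo 0 T)) := (Lp.memLp F).integrable (by norm_num)
    filter_upwards [hS F, ae_restrict_mem measurableSet_Ioo] with x hx hx0
    have hsub : Ioo 0 x ⊆ Ioo 0 T := Ioo_subset_Ioo_right hx0.2.le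
    have hi : Integrable (fun r => B * ‖F r‖) (volume.restrict (Ioo 0 x)) :=
      (hF.norm.const_mul B).mono_measure (Measure.restrict_mono_set _ hsub)
    rw [hx]
    calc _ ≤ ∫ r in Ioo 0 T, (Ioo 0 x).indicator (fun r => B * ‖F r‖) r := by
          refine norm_integral_le_of_norm_le ?_ ?_
          · exact (hF.norm.const_mul B).indicator measurableSet_Ioo
          · filter_upwards [ae_restrict_mem measurableSet_Ioo] with r hr
            by_cases hrx : r < x
            · rw [indicator_of_mem (show r ∈ Ioo 0 x from ⟨hr.1, hrx⟩)]
              exact ContinuousLinearMap.le_of_opNorm_le _ (hB x r hr.1.le) _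
            · rw [controlKernel_eq_zero hx0.2.le (not_lt.1 hrx),
                indicator_of_notMem fun h => hrx h.2]
              simp
      _ = ∫ r in Ioo 0 x, B * ‖F r‖ := by
          rw [setIntegral_indicator measurableSet_Ioo, inter_eq_self_of_subset_right hsub]
      _ = _ := integral_const_mul _ _
  obtain ⟨w, hw⟩ := hu
  refine ⟨ContinuousLinearEquiv.ofUnit w, fun F => ?_⟩
  have h1 : ContinuousLinearEquiv.ofUnit w F = F + S F := by
    change (w : L2on (Ioo 0 T) →L[ℂ] L2on (Ioo 0 T)) F = _
    rw [hw]
    rfl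
  rw [h1]
  filter_upwards [Lp.coeFn_add F (S F), hS F] with x h2 h3
  rw [h2, Pi.add_apply, h3]

/-- The components of the integral of the control kernel. -/
theorem integral_controlKernel (hK : Continuous fun z : ℝ × ℝ => K z.1 z.2)
    (hK' : Continuous fun z : ℝ × ℝ => K' z.1 z.2) (F : L2on (Ioo 0 T)) (η : ℝ) :
    (∫ r in Ioo 0 T, controlKernel T K K' η r (F r)) 0 =
      (∫ r in Ioo 0 T, impulseResponse K (T - η) (T - r) * F r 0) -
        ∫ r in Ioo 0 T, impulseResponse K' (-(T - η)) (T - r) * F r 1 ∧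
    (∫ r in Ioo 0 T, controlKernel T K K' η r (F r)) 1 =
      (∫ r in Ioo 0 T, impulseResponse K' (T - η) (T - r) * F r 1) -
        ∫ r in Ioo 0 T, impulseResponse K (-(T - η)) (T - r) * F r 0 := by
  have hF : Integrable F (volume.restrict (Ioo 0 T)) := (Lp.memLp F).integrable (by norm_num)
  have hFi : ∀ i : Fin 2, Integrable (fun r => F r i) (volume.restrict (Ioo 0 T)) := fun i =>
    (EuclideanSpace.proj i : C2 →L[ℂ] ℂ).integrable_comp hF
  obtain ⟨B, hB0, hB⟩ := exists_norm_controlKernel_le (T := T) hK hK'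
  have hsl : ∀ {K : ℝ → ℝ → ℂ} (_ : Continuous fun z : ℝ × ℝ => K z.1 z.2) (y : ℝ) (i : Fin 2),
      Integrable (fun r => impulseResponse K y (T - r) * F r i) (volume.restrict (Ioo 0 T)) := by
    intro K hK y i
    obtain ⟨B, -, hB⟩ := exists_impulseResponse_bound hK T
    refine (hFi i).bdd_mul (c := B)
      (measurable_impulseResponse_slice hK y).aestronglyMeasurable ?_
    filter_upwards [ae_restrict_mem measurableSet_Ioo] with r hr
    exact hB _ _ (by linarith [hr.1])
  have hN : Integrable (fun r => controlKernel T K K' η r (F r)) (volume.restrict (Ioo 0 T)) := by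
    refine (hF.norm.const_mul B).mono' ?_ ?_
    · exact (ContinuousLinearMap.id ℂ (C2 →L[ℂ] C2)).aestronglyMeasurable_comp₂
        ((stronglyMeasurable_controlKernel (T := T) hK hK').comp_measurable
          measurable_prodMk_left).aestronglyMeasurable hF.1
    · filter_upwards [ae_restrict_mem measurableSet_Ioo] with r hr
      exact ContinuousLinearMap.le_of_opNorm_le _ (hB η r hr.1.le) _
  constructor
  · rw [← integral_sub (hsl hK _ 0) (hsl hK' _ 1)]
    refine ((EuclideanSpace.proj 0 : C2 →L[ℂ] ℂ).integral_comp_comm hN).symm.trans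
      (integral_congr_ae (Eventually.of_forall fun r => ?_))
    refine (mat_apply_zero _ _ _ _ _).trans ?_
    ring
  · rw [← integral_sub (hsl hK' _ 1) (hsl hK _ 0)]
    refine ((EuclideanSpace.proj 1 : C2 →L[ℂ] ℂ).integral_comp_comm hN).symm.trans
      (integral_congr_ae (Eventually.of_forall fun r => ?_))
    refine (mat_apply_one _ _ _ _ _).trans ?_
    ring

end Volterra

namespace Medium

variable (M : Medium)

/-- The wave on the unfolded line at the final time. -/
theorem wave_source {T : ℝ} (K : ℝ → ℝ → ℂ) (f : ℝ → ℂ) {y : ℝ} :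
    wave K (M.source T f) y T = (if 0 < y then M.source T f (T - y) else 0) +
      2 * M.ui 0 * ∫ r in Ioo 0 T, impulseResponse K y (T - r) * f r := by
  rw [wave, ← integral_const_mul, ← integral_indicator measurableSet_Ioo]
  congr 1
  refine integral_congr_ae (Eventually.of_forall fun r => ?_)
  simp only [source, indicator]
  split_ifs
  · ring
  · ring

end Medium

/-! ### The extended control operator -/

namespace Medium

variable (M : Medium)

/-- The matrix that gives the state at the point `x` in terms of the amplitudes of the two
polarizations there. The first polarization consists of the waves of the Dirac system to the right
and those of the auxiliary system to the left, whose phase factors agree; the second one of the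
others. -/
def stateMatrix (x : ℝ) : C2 →L[ℂ] C2 :=
  mat (M.ui 0 * M.u x * M.g (-1) x) (M.ui 0 * M.u x * M.g 1 x)
    (M.ui 0 * Complex.I * M.ui x * M.g (-1) x) (-(M.ui 0 * Complex.I * M.ui x * M.g 1 x))

/-- The inverse of the state matrix. -/
def stateMatrixInv (x : ℝ) : C2 →L[ℂ] C2 :=
  mat (1 / 2 * M.u 0 * M.g 1 x * M.ui x) (-(1 / 2 * M.u 0 * M.g 1 x * Complex.I * M.u x))
    (1 / 2 * M.u 0 * M.g (-1) x * M.ui x) (1 / 2 * M.u 0 * M.g (-1) x * Complex.I * M.u x)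

theorem stateMatrix_mul_inv (x : ℝ) (Z : C2) : M.stateMatrix x (M.stateMatrixInv x Z) = Z := by
  have e1 := M.g_mul_g_neg 1 x
  have e2 := M.u_mul_ui x
  have e3 := M.u_mul_ui 0
  have e4 := Complex.I_mul_I
  ext i
  fin_cases i
  · refine (mat_apply_zero _ _ _ _ _).trans ?_
    rw [stateMatrixInv, mat_apply_zero, mat_apply_one]
    change _ = Z 0
    linear_combination (M.u 0 * M.ui 0 * M.u x * M.ui x * Z 0) * e1 +
      (M.u 0 * M.ui 0 * Z 0) * e2 + Z 0 * e3
  · refine (mat_apply_one _ _ _ _ _).trans ?_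
    rw [stateMatrixInv, mat_apply_zero, mat_apply_one]
    change _ = Z 1
    linear_combination (-(Complex.I * Complex.I) * M.u 0 * M.ui 0 * M.u x * M.ui x * Z 1) * e1 -
      (Complex.I * Complex.I * M.u 0 * M.ui 0 * Z 1) * e2 -
      (Complex.I * Complex.I * Z 1) * e3 - Z 1 * e4

theorem stateMatrixInv_mul (x : ℝ) (Z : C2) : M.stateMatrixInv x (M.stateMatrix x Z) = Z := by
  have e1 := M.g_mul_g_neg 1 x
  have e2 := M.u_mul_ui x
  have e3 := M.u_mul_ui 0
  have e4 := Complex.I_mul_I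
  ext i
  fin_cases i
  · refine (mat_apply_zero _ _ _ _ _).trans ?_
    rw [stateMatrix, mat_apply_zero, mat_apply_one]
    change _ = Z 0
    grind
  · refine (mat_apply_one _ _ _ _ _).trans ?_
    rw [stateMatrix, mat_apply_zero, mat_apply_one]
    change _ = Z 1
    grind

theorem continuous_stateMatrix : Continuous M.stateMatrix := by
  have h1 := M.continuous_u
  have h2 := M.continuous_ui
  have h3 := M.continuous_g 1
  have h4 := M.continuous_g (-1)
  unfold stateMatrix mat
  fun_prop

theorem continuous_stateMatrixInv : Continuous M.stateMatrixInv := by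
  have h1 := M.continuous_u
  have h2 := M.continuous_ui
  have h3 := M.continuous_g 1
  have h4 := M.continuous_g (-1)
  unfold stateMatrixInv mat
  fun_prop

theorem mapsTo_filled {T : ℝ} {Ω : Set ℝ} (hΩ : Ω = {x | 0 < x ∧ M.τ x < T}) :
    MapsTo (fun x => T - M.τ x) Ω (Ioo 0 T) ∧ MapsTo (fun η => M.X (T - η)) (Ioo 0 T) Ω := by
  subst hΩ
  refine ⟨fun x hx => ⟨sub_pos.2 hx.2, by linarith [M.τ_pos hx.1]⟩, fun η hη => ⟨M.X_pos (by
    linarith [hη.2]), ?_⟩⟩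
  rw [M.τ_X]
  linarith [hη.1]

theorem measurableSet_filled {T : ℝ} {Ω : Set ℝ} (hΩ : Ω = {x | 0 < x ∧ M.τ x < T}) :
    MeasurableSet Ω := by
  subst hΩ
  exact measurableSet_Ioi.inter (measurableSet_lt M.continuous_τ.measurable measurable_const)

theorem filled_subset_Icc {T : ℝ} {Ω : Set ℝ} (hΩ : Ω = {x | 0 < x ∧ M.τ x < T}) :
    Ω ⊆ Icc 0 (M.X T) := by
  subst hΩ
  intro x hx
  refine ⟨hx.1.le, ?_⟩
  have := M.strictMono_X.monotone hx.2.le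
  rwa [M.X_τ] at this

theorem source_of_mem {T : ℝ} {f : ℝ → ℂ} {r : ℝ} (hr : r ∈ Ioo 0 T) :
    M.source T f r = 2 * M.ui 0 * f r := indicator_of_mem hr _

theorem map_delay_le {T : ℝ} {Ω : Set ℝ} (hΩ : Ω = {x | 0 < x ∧ M.τ x < T}) :
    (volume.restrict Ω).map (fun x => T - M.τ x) ≤
      (ENNReal.ofReal M.m)⁻¹ • volume.restrict (Ioo 0 T) :=
  map_restrict_le_of_deriv (M.measurableSet_filled hΩ)
    (continuous_const.sub M.continuous_τ).measurable (fun x _ => (M.hasDerivAt_τ x).const_sub T)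
    (fun x _ y _ h => M.strictMono_τ.injective (sub_right_injective h)) M.m_pos
    (fun x _ => by rw [abs_neg]; exact (M.m_le x).trans (le_abs_self _)) (M.mapsTo_filled hΩ).1

theorem quasiMeasurePreserving_delay {T : ℝ} {Ω : Set ℝ} (hΩ : Ω = {x | 0 < x ∧ M.τ x < T}) :
    Measure.QuasiMeasurePreserving (fun x => T - M.τ x) (volume.restrict Ω)
      (volume.restrict (Ioo 0 T)) :=
  ⟨(continuous_const.sub M.continuous_τ).measurable,
    Measure.absolutelyContinuous_of_le_smul (M.map_delay_le hΩ)⟩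

/-- The amplitudes as functions of the delay and the states as functions of the position are
isomorphic. -/
theorem exists_state_equiv {T : ℝ} {Ω : Set ℝ} (hΩ : Ω = {x | 0 < x ∧ M.τ x < T}) :
    ∃ E : L2on (Ioo 0 T) ≃L[ℂ] L2on Ω, ∀ G, ∀ᵐ x ∂(volume.restrict Ω),
      E G x = M.stateMatrix x (G (T - M.τ x)) := by
  obtain ⟨hm1, hm2⟩ := M.mapsTo_filled hΩ
  have hΩm := M.measurableSet_filled hΩ
  have hΩs := M.filled_subset_Icc hΩ
  have hs1 : Measurable fun x => T - M.τ x := (continuous_const.sub M.continuous_τ).measurable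
  have hs2 : Measurable fun η => M.X (T - η) :=
    (M.continuous_X.comp (continuous_const.sub continuous_id)).measurable
  have hle1 := M.map_delay_le hΩ
  have hle2 := map_restrict_le_of_deriv (m := 1) measurableSet_Ioo hs2
    (fun η _ => (M.hasDerivAt_X (T - η)).comp η ((hasDerivAt_id η).const_sub T))
    (fun x _ y _ h => sub_right_injective (M.strictMono_X.injective h)) one_pos
    (fun η _ => by
      rw [mul_neg_one, abs_neg]
      exact ((one_le_inv₀ (M.ρ_pos _)).2 (M.ρ_le _)).trans (le_abs_self _)) hm2
  obtain ⟨C₁, hC₁⟩ := (isCompact_Icc (a := 0) (b := M.X T)).exists_bound_of_continuousOn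
    M.continuous_stateMatrix.continuousOn
  obtain ⟨C₂, hC₂⟩ := (isCompact_Icc (a := 0) (b := M.X T)).exists_bound_of_continuousOn
    M.continuous_stateMatrixInv.continuousOn
  have hc1 : (ENNReal.ofReal M.m)⁻¹ ≠ ∞ := M.inv_ofReal_m_ne_top
  have hc2 : (ENNReal.ofReal 1)⁻¹ ≠ ∞ := by simp
  obtain ⟨A, hA⟩ := exists_substitution_operator
    (M.continuous_stateMatrix.aestronglyMeasurable (μ := volume.restrict Ω))
    (by filter_upwards [ae_restrict_mem hΩm] with x hx using hC₁ x (hΩs hx)) hs1 hc1 hle1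
  obtain ⟨B, hB⟩ := exists_substitution_operator (M := fun η => M.stateMatrixInv (M.X (T - η)))
    ((M.continuous_stateMatrixInv.comp (M.continuous_X.comp
      (continuous_const.sub continuous_id))).aestronglyMeasurable
        (μ := volume.restrict (Ioo 0 T)))
    (by filter_upwards [ae_restrict_mem measurableSet_Ioo] with η hη using hC₂ _ (hΩs (hm2 hη)))
    hs2 hc2 hle2
  have hq1 := M.quasiMeasurePreserving_delay hΩ
  have hq2 : Measure.QuasiMeasurePreserving (fun η => M.X (T - η)) (volume.restrict (Ioo 0 T))
      (volume.restrict Ω) := ⟨hs2, Measure.absolutelyContinuous_of_le_smul hle2⟩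
  refine ⟨ContinuousLinearEquiv.equivOfInverse A B (fun G => Lp.ext ?_) (fun Z => Lp.ext ?_), hA⟩
  · filter_upwards [hB (A G), hq2.ae (hA G)] with η h1 h2
    rw [h1, h2, M.τ_X, sub_sub_cancel, M.stateMatrixInv_mul]
  · filter_upwards [hA (B Z), hq1.ae (hB Z)] with x h1 h2
    rw [h1, h2, sub_sub_cancel, M.X_τ, M.stateMatrix_mul_inv]

variable {M}

/-- The extended control operator is an isomorphism: it is the composition of the isomorphisms of
`exists_control_equiv` and `Medium.exists_state_equiv`. -/
theorem Represents.exists_control_operator {d₁ d₂ ψ : ℝ → ℝ} (hM : M.Represents d₁ d₂ ψ) {T : ℝ}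
    (hT : 0 < T) {Ω : Set ℝ} (hΩ : Ω = {x | 0 < x ∧ M.τ x < T}) :
    ∃ W : L2on (Ioo 0 T) ≃L[ℂ] L2on Ω, ∀ (F : L2on (Ioo 0 T)) (V U : ℝ → L2on (Ioi 0)),
      IsDiracSolution d₁ d₂ ψ T (fun t => F t 0) V →
      IsAuxiliarySolution d₁ d₂ ψ T (fun t => F t 1) U →
      ∀ᵐ x ∂(volume.restrict (Ioi (0 : ℝ))), Ω.indicator (W F) x = V T x + U T x := by
  have hσ₁ : (1 : ℝ) * 1 = 1 := one_mul 1
  have hσ₂ : (-1 : ℝ) * -1 = 1 := by norm_num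
  obtain ⟨K, hK⟩ := M.exists_responseKernel 1 hT
  obtain ⟨K', hK'⟩ := M.exists_responseKernel (-1) hT
  obtain ⟨A, hA⟩ := exists_control_equiv hT hK.continuous hK'.continuous
  obtain ⟨E, hE⟩ := M.exists_state_equiv hΩ
  have hm1 := (M.mapsTo_filled hΩ).1
  have hΩm := M.measurableSet_filled hΩ
  refine ⟨A.trans E, fun F V U hV hU => ?_⟩
  have hFm : ∀ i : Fin 2, Measurable fun t => F t i := fun i =>
    (EuclideanSpace.proj i : C2 →L[ℂ] ℂ).continuous.measurable.comp
      (Lp.stronglyMeasurable F).measurable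
  have hFi : ∀ i : Fin 2, MemLp (fun t => F t i) 2 (volume.restrict (Ioo 0 T)) := fun i =>
    (EuclideanSpace.proj i : C2 →L[ℂ] ℂ).comp_memLp' (Lp.memLp F)
  obtain ⟨V', hV', hVw⟩ := hM.exists_solution hσ₁ hT hK (hFm 0) (hFi 0)
  obtain ⟨U', hU', hUw⟩ := hM.exists_solution hσ₂ hT hK' (hFm 1) (hFi 1)
  have hTm : T ∈ Icc 0 T := ⟨hT.le, le_rfl⟩
  rw [hM.unique hσ₁ hT hV' hV hTm, hM.unique hσ₂ hT hU' hU hTm]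
  have hq1 := M.quasiMeasurePreserving_delay hΩ
  -- the states of the two systems add up to the state matrix applied to the amplitudes
  have hW := (hE (A F)).and (hq1.ae (hA F))
  have hW' : ∀ᵐ x ∂(volume.restrict (Ioi (0 : ℝ))), x ∈ Ω → E (A F) x =
      M.stateMatrix x (F (T - M.τ x) +
        ∫ r in Ioo 0 T, controlKernel T K K' (T - M.τ x) r (F r)) := by
    refine ae_restrict_of_ae ((ae_restrict_iff' hΩm).1 ?_)
    filter_upwards [hW] with x hx
    rw [hx.1, hx.2]
  filter_upwards [hVw T, hUw T, hW', ae_restrict_mem measurableSet_Ioi] with x h1 h2 h3 hx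
  have hx' : (0 : ℝ) < x := hx
  have hτ := M.τ_pos hx'
  have hτn : ¬ 0 < -M.τ x := by linarith
  by_cases hxΩ : x ∈ Ω
  · have hη : T - M.τ x ∈ Ioo 0 T := hm1 hxΩ
    obtain ⟨i1, i2⟩ := integral_controlKernel hK.continuous hK'.continuous F (T - M.τ x)
    rw [sub_sub_cancel] at i1 i2
    rw [indicator_of_mem hxΩ]
    refine (h3 hxΩ).trans ?_
    ext i
    fin_cases i
    · refine (mat_apply_zero _ _ _ _ _).trans ?_
      change _ = V' T x 0 + U' T x 0
      rw [PiLp.add_apply, PiLp.add_apply, i1, i2, h1.1, h2.1]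
      simp only [foldFst, wave_source, if_pos hτ, if_neg hτn, M.source_of_mem hη, neg_neg]
      ring
    · refine (mat_apply_one _ _ _ _ _).trans ?_
      change _ = V' T x 1 + U' T x 1
      rw [PiLp.add_apply, PiLp.add_apply, i1, i2, h1.2, h2.2]
      simp only [foldSnd, wave_source, if_pos hτ, if_neg hτn, M.source_of_mem hη, neg_neg]
      push_cast
      ring
  · -- no wave has arrived at a point outside the filled domain
    have hle : T ≤ M.τ x := by
      by_contra h
      exact hxΩ (hΩ ▸ ⟨hx', not_le.1 h⟩)
    have w1 : ∀ (K : ℝ → ℝ → ℂ) (f : ℝ → ℂ), wave K (M.source T f) (M.τ x) T = 0 := fun K f =>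
      wave_eq_zero source_eq_zero (hle.trans (le_abs_self _))
    have w2 : ∀ (K : ℝ → ℝ → ℂ) (f : ℝ → ℂ), wave K (M.source T f) (-M.τ x) T = 0 := fun K f =>
      wave_eq_zero source_eq_zero (by rw [abs_neg]; exact hle.trans (le_abs_self _))
    rw [indicator_of_notMem hxΩ]
    ext i
    fin_cases i
    · change 0 = V' T x 0 + U' T x 0
      rw [h1.1, h2.1]
      simp [foldFst, w1, w2]
    · change 0 = V' T x 1 + U' T x 1
      rw [h1.2, h2.2]
      simp [foldSnd, w1, w2]

end Medium

/-! ### The medium of the given coefficients -/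

/-- Extension of a continuously differentiable function from the half-line to the line. -/
theorem exists_contDiff_extension {w : ℝ → ℝ} (hw : ContDiffOn ℝ 1 w (Ici 0)) :
    ∃ W : ℝ → ℝ, ContDiff ℝ 1 W ∧ EqOn W w (Ici 0) := by
  have hc : Continuous fun s => derivWithin w (Ici 0) (max s 0) :=
    (hw.continuousOn_derivWithin (uniqueDiffOn_Ici 0) le_rfl).comp_continuous (by fun_prop)
      fun s => le_max_right s 0
  have hd : ∀ x, HasDerivAt
      (fun x => w 0 + ∫ s in (0 : ℝ)..x, derivWithin w (Ici 0) (max s 0))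
      (derivWithin w (Ici 0) (max x 0)) x := fun x =>
    (hc.integral_hasStrictDerivAt 0 x).hasDerivAt.const_add _
  refine ⟨_, contDiff_one_iff_deriv.2 ⟨fun x => (hd x).differentiableAt, ?_⟩, fun x hx => ?_⟩
  · rwa [funext fun x => (hd x).deriv]
  · have := intervalIntegral.integral_eq_sub_of_hasDerivAt_of_le (a := 0) (b := x) (f := w)
      (f' := fun s => derivWithin w (Ici 0) (max s 0)) hx
      (hw.continuousOn.mono Icc_subset_Ici_self) (fun s hs => ?_) (hc.intervalIntegrable _ _)
    · simp only [this]
      ring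
    · rw [max_eq_left hs.1.le]
      exact ((hw.differentiableOn one_ne_zero) s hs.1.le).hasDerivWithinAt.hasDerivAt
        (Ici_mem_nhds hs.1)

theorem TwiceDifferentiable.contDiffOn {h : ℝ → ℝ} (hh : TwiceDifferentiable h) :
    ContDiffOn ℝ 1 h (Ici 0) :=
  (contDiffOn_one_iff_derivWithin (uniqueDiffOn_Ici 0)).2 ⟨hh.1, hh.2.continuousOn⟩

theorem sqrt_mul_eq_exp {p q : ℝ} (hp : 0 < p) (hq : 0 < q) :
    Real.sqrt (p * q) = Real.exp ((Real.log p + Real.log q) / 2) := by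
  rw [← Real.log_mul hp.ne' hq.ne', Real.exp_half, Real.exp_log (mul_pos hp hq)]

/-- Coefficients as in the problem come from a medium. The slowness and the potential are extended
by their values at `0`, while `v`, whose derivative enters the reflection coefficients, needs a
continuously differentiable extension. -/
theorem exists_medium {d₁ d₂ ψ : ℝ → ℝ} {δ : ℝ} (hδ : 0 < δ)
    (hd₁ : TwiceDifferentiable d₁) (hd₂ : TwiceDifferentiable d₂)
    (hd₁δ : ∀ x, 0 ≤ x → δ ≤ d₁ x) (hd₂δ : ∀ x, 0 ≤ x → δ ≤ d₂ x)
    (htr : ∀ x, 0 ≤ x → d₁ x + d₂ x = 1) (hψ : ContinuousOn ψ (Ici 0)) :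
    ∃ M : Medium, M.Represents d₁ d₂ ψ := by
  have hp₁ : ∀ x, 0 ≤ x → 0 < d₁ x := fun x hx => hδ.trans_le (hd₁δ x hx)
  have hp₂ : ∀ x, 0 ≤ x → 0 < d₂ x := fun x hx => hδ.trans_le (hd₂δ x hx)
  have hle₁ : ∀ x, 0 ≤ x → d₁ x ≤ 1 := fun x hx => by linarith [htr x hx, hp₂ x hx]
  have hle₂ : ∀ x, 0 ≤ x → d₂ x ≤ 1 := fun x hx => by linarith [htr x hx, hp₁ x hx]
  have hmax : ∀ x : ℝ, max x 0 ∈ Ici (0 : ℝ) := fun x => le_max_right x 0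
  have hlog : ContDiffOn ℝ 1 (fun x => (Real.log (d₂ x) - Real.log (d₁ x)) / 4) (Ici 0) :=
    ((hd₂.contDiffOn.log fun x hx => (hp₂ x hx).ne').sub
      (hd₁.contDiffOn.log fun x hx => (hp₁ x hx).ne')).div_const 4
  obtain ⟨v, hv, hve⟩ := exists_contDiff_extension hlog
  have hve' : ∀ x, 0 ≤ x → v x = (Real.log (d₂ x) - Real.log (d₁ x)) / 4 := fun x hx => hve hx
  have habs : ∀ p, δ ≤ p → p ≤ 1 → Real.log δ ≤ Real.log p ∧ Real.log p ≤ 0 := fun p h1 h2 =>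
    ⟨Real.log_le_log hδ h1, Real.log_nonpos (hδ.le.trans h1) h2⟩
  let M : Medium :=
    { ρ := fun x => Real.sqrt (d₁ (max x 0) * d₂ (max x 0))
      v := v
      ψ := fun x => ψ (max x 0)
      m := δ
      N := -Real.log δ
      m_pos := hδ
      continuous_ρ := ((hd₁.1.continuousOn.comp_continuous (by fun_prop) hmax).mul
        (hd₂.1.continuousOn.comp_continuous (by fun_prop) hmax)).sqrt
      m_le := fun x => Real.le_sqrt_of_sq_le (by
        rw [sq]
        exact mul_le_mul (hd₁δ _ (hmax x)) (hd₂δ _ (hmax x)) hδ.le (hp₁ _ (hmax x)).le)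
      ρ_le := fun x => Real.sqrt_le_one.2 (mul_le_one₀ (hle₁ _ (hmax x)) (hp₂ _ (hmax x)).le
        (hle₂ _ (hmax x)))
      contDiff_v := hv
      abs_v_le := fun x hx => by
        obtain ⟨h1, h2⟩ := habs _ (hd₁δ x hx) (hle₁ x hx)
        obtain ⟨h3, h4⟩ := habs _ (hd₂δ x hx) (hle₂ x hx)
        rw [hve' x hx, abs_le]
        constructor <;> linarith
      continuous_ψ := hψ.comp_continuous (by fun_prop) hmax }
  have hρ : ∀ x, 0 < x → M.ρ x = Real.exp ((Real.log (d₁ x) + Real.log (d₂ x)) / 2) := by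
    intro x hx
    rw [← sqrt_mul_eq_exp (hp₁ x hx.le) (hp₂ x hx.le)]
    simp [M, max_eq_left hx.le]
  refine ⟨M, fun x hx => ?_, fun x hx => ?_, fun x hx => ?_⟩
  · rw [hρ x hx, Medium.ui, ← Complex.ofReal_pow, ← Complex.ofReal_mul, ← Real.exp_nat_mul,
      ← Real.exp_add, Complex.ofReal_inj]
    change d₁ x = Real.exp (_ + _ * -v x)
    conv_lhs => rw [← Real.exp_log (hp₁ x hx.le)]
    rw [hve' x hx.le]
    congr 1
    push_cast
    ring
  · rw [hρ x hx, Medium.u, ← Complex.ofReal_pow, ← Complex.ofReal_mul, ← Real.exp_nat_mul,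
      ← Real.exp_add, Complex.ofReal_inj]
    change d₂ x = Real.exp (_ + _ * v x)
    conv_lhs => rw [← Real.exp_log (hp₂ x hx.le)]
    rw [hve' x hx.le]
    congr 1
    push_cast
    ring
  · simp [M, max_eq_left hx.le]

namespace Medium

variable {M : Medium}

theorem Represents.filledDomain_eq {d₁ d₂ ψ : ℝ → ℝ} (hM : M.Represents d₁ d₂ ψ) (T : ℝ) :
    filledDomain d₁ d₂ T = {x | 0 < x ∧ M.τ x < T} := by
  have h : ∀ x, 0 < x → eikonal d₁ d₂ x = M.τ x := by
    intro x hx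
    rw [eikonal, τ, intervalIntegral.integral_of_le hx.le, intervalIntegral.integral_of_le hx.le]
    refine setIntegral_congr_fun measurableSet_Ioc fun s hs => ?_
    have h1 : ((d₁ s * d₂ s : ℝ) : ℂ) = ((M.ρ s ^ 2 : ℝ) : ℂ) := by
      push_cast
      rw [hM.fst s hs.1, hM.snd s hs.1]
      linear_combination M.ρ s ^ 2 * (M.u s * M.ui s + 1) * M.u_mul_ui s
    rw [Complex.ofReal_inj.1 h1, Real.sqrt_sq (M.ρ_pos s).le]
  ext x
  exact and_congr_right fun hx => by rw [h x hx]

end Medium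

end DiracControl

end

theorem proposition2 (d₁ d₂ ψ : ℝ → ℝ) (δ T : ℝ) (hδ : 0 < δ) (hT : 0 < T)
    (hd₁ : DiracControl.TwiceDifferentiable d₁) (hd₂ : DiracControl.TwiceDifferentiable d₂)
    (hd₁δ : ∀ x, 0 ≤ x → δ ≤ d₁ x) (hd₂δ : ∀ x, 0 ≤ x → δ ≤ d₂ x)
    (htr : ∀ x, 0 ≤ x → d₁ x + d₂ x = 1)
    (hψ : ContDiffOn ℝ 2 ψ (Set.Ici 0)) :
    -- both problems have exactly one solution for every square integrable control
    (∀ f : ℝ → ℂ, MeasureTheory.MemLp f 2 (MeasureTheory.volume.restrict (Set.Ioo 0 T)) →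
      ∃ V, DiracControl.IsDiracSolution d₁ d₂ ψ T f V ∧
        ∀ V', DiracControl.IsDiracSolution d₁ d₂ ψ T f V' → Set.EqOn V' V (Set.Icc 0 T)) ∧
    (∀ g : ℝ → ℂ, MeasureTheory.MemLp g 2 (MeasureTheory.volume.restrict (Set.Ioo 0 T)) →
      ∃ U, DiracControl.IsAuxiliarySolution d₁ d₂ ψ T g U ∧
        ∀ U', DiracControl.IsAuxiliarySolution d₁ d₂ ψ T g U' → Set.EqOn U' U (Set.Icc 0 T)) ∧
    -- and the extended control operator is an isomorphism
    ∃ W : DiracControl.L2on (Set.Ioo 0 T) ≃L[ℂ]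
        DiracControl.L2on (DiracControl.filledDomain d₁ d₂ T),
      DiracControl.IsExtendedControlOperator d₁ d₂ ψ T W := by
  obtain ⟨M, hM⟩ := DiracControl.exists_medium hδ hd₁ hd₂ hd₁δ hd₂δ htr hψ.continuousOn
  exact ⟨fun f hf => hM.existsUnique_solution (one_mul 1) hT hf,
    fun g hg => hM.existsUnique_solution (by norm_num) hT hg,
    hM.exists_control_operator hT (hM.filledDomain_eq T)⟩
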